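/- **Setting.** Let $\Omega\subset\mathbb R^3$ be open, bounded and connected, and let $\mathbf F:(0,1)^3\to\Omega$ be a $C^1$-diffeomorphism onto $\Omega$ such that $\mathbf F$ and $\mathbf F^{-1}$ are of class $W^{2,\infty}$. *Meshes and B-splines.* For $n\in\mathbb N$ let $\mathcal Q_n$ be a tensor product mesh of $(0,1)^3$, given in each coordinate direction by a partition $0=x_0<\dots<x_m=1$ (depending on $n$ and on the direction); its elements are the open boxes $Q$ whose sides are consecutive intervals of the three partitions. Let $h_n$ be such that $\operatorname{diam} Q\le h_n$ for all $Q\in\mathcal Q_n$, and assume that the meshes are uniformly shape regular: there is $c>0$ such that for every $n$ and every $Q\in\mathcal Q_n$ all edges of $Q$ have length at least $c\,\operatorname{diam}Q$. Let $\mathcal V_{h_n}$ be the span of the functions $B\circ\mathbf F^{-1}$ on $\Omega$, where $B$ ranges over the tensor product quadratic B-splines on $\mathcal Q_n$ (open knot vectors $x_0,x_0,x_0,x_1,\dots,x_{m-1},x_m,x_m,x_m$ in each direction), and let $\mathcal U_{h_n}$ be the space of vector fields $\Omega\to\mathbb R^3$ whose three components belong to $\mathcal V_{h_n}$. *Energies.*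 Let $W(E)=\tfrac12E:\mathbf C E$ with $\mathbf C$ linear and $c_1|E|^2\le W(E)\le c_2|E|^2$ for all symmetric $E\in\mathbb R^{3\times3}$, for some $c_1,c_2>0$. For a displacement $u$ let $\boldsymbol\epsilon(u)=\tfrac12(Du+Du^T)$, all derivatives being weak derivatives. For $\varepsilon_n>0$ and $\eta_n\ge0$ put $$\mathcal F_{\varepsilon_n,h_n}(u,v)=\int_\Omega (v^2+\eta_n)\,W(\boldsymbol\epsilon(u))\,dx+\int_\Omega \varepsilon_n^{-1}|v-1|^2+2\varepsilon_n|\nabla v|^2+\varepsilon_n^3|\Delta v|^2\,dx$$ if $u\in\mathcal U_{h_n}$, $v\in\mathcal V_{h_n}$ and $0\le v\le1$ (a.e. in $\Omega$), and $\mathcal F_{\varepsilon_n,h_n}(u,v)=+\infty$ otherwise. **Proposition.** Let $\varepsilon_n\to0^+$, $\eta_n=o(\varepsilon_n)$ and $h_n=o(\varepsilon_n)$. Let $J\subset\Omega$ be a closed $2$-simplex (a non-degenerate closed triangle) and let $u\in W^{2,\infty}(\Omega\setminus J,\mathbb R^3)$. There exists $C>0$ such that for every $\delta>0$ there exist $u_{h_n}\in\mathcal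 U_{h_n}$ and $v_{h_n}\in\mathcal V_{h_n}$ with $0\le v_{h_n}\le1$ in $\Omega$ for every $n$, such that $u_{h_n}\to u$ in $L^2(\Omega,\mathbb R^3)$, $v_{h_n}\to1$ in $L^2(\Omega)$ and $$\limsup_{n\to+\infty}\mathcal F_{\varepsilon_n,h_n}(u_{h_n},v_{h_n})\le(1+\delta)\int_{\Omega\setminus J}W(\boldsymbol\epsilon(u))\,dx+4|J|+C\delta ,$$ where $|J|=\mathcal H^2(J)$ is the area of $J$. -/

import Mathlib

open MeasureTheory Filter Topology Set Asymptotics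
open scoped ENNReal ContDiff

noncomputable section

/-- Euclidean space `ℝ³`. -/
abbrev E3 : Type := EuclideanSpace ℝ (Fin 3)

/-- Real `3 × 3` matrices. -/
abbrev Mat3 : Type := Matrix (Fin 3) (Fin 3) ℝ

/-! ### Weak derivatives and the space `W^{k,∞}` -/

/-- `g` is the weak partial derivative `∂ᵢ f` on the open set `O`: both functions are locally
integrable on `O` and `∫_O f ∂ᵢφ = - ∫_O g φ` for every `φ ∈ C_c^∞(O)`. -/
def IsWeakPartial (O : Set E3) (i : Fin 3) (f g : E3 → ℝ) : Prop :=
  LocallyIntegrableOn f O volume ∧ LocallyIntegrableOn g O volume ∧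
    ∀ φ : E3 → ℝ, ContDiff ℝ ∞ φ → HasCompactSupport φ → tsupport φ ⊆ O →
      ∫ x in O, f x * fderiv ℝ φ x (EuclideanSpace.single i (1 : ℝ)) =
        - ∫ x in O, g x * φ x

open Classical in
/-- The weak partial derivative `∂ᵢ f` on `O` (determined a.e. on `O` when it exists;
the function `0` when it does not exist). -/
def weakPartial (O : Set E3) (i : Fin 3) (f : E3 → ℝ) : E3 → ℝ :=
  if hf : ∃ g, IsWeakPartial O i f g then hf.choose else 0

/-- `f ∈ W^{k,∞}(O)` for a scalar function `f`. -/
def MemWkInf (O : Set E3) : ℕ → (E3 → ℝ) → Prop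
  | 0, f => MemLp f ∞ (volume.restrict O)
  | k + 1, f => MemLp f ∞ (volume.restrict O) ∧
      ∀ i : Fin 3, ∃ g, IsWeakPartial O i f g ∧ MemWkInf O k g

/-- `u ∈ W^{k,∞}(O, ℝ³)`. -/
def MemWkInfVec (O : Set E3) (k : ℕ) (u : E3 → E3) : Prop :=
  ∀ a : Fin 3, MemWkInf O k (fun x => u x a)

/-- The weak Laplacian `Δv = ∑ᵢ ∂ᵢ∂ᵢ v` on `O`. -/
def weakLaplacian (O : Set E3) (v : E3 → ℝ) (x : E3) : ℝ :=
  ∑ i : Fin 3, weakPartial O i (weakPartial O i v) x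

/-- The linearized strain `(Du + Duᵀ) / 2` on `O`, with `(Du)ₐᵦ = ∂ᵦ uₐ` taken weakly. -/
def strain (O : Set E3) (u : E3 → E3) (x : E3) : Mat3 :=
  Matrix.of fun a b =>
    (weakPartial O b (fun y => u y a) x + weakPartial O a (fun y => u y b) x) / 2

/-! ### The linear elastic energy density -/

/-- `W(E) = ½ E : 𝐂 E`, the elastic energy density of the (possibly anisotropic) elasticity
tensor `𝐂`. -/
def elasticDensity (Cel : Mat3 →ₗ[ℝ] Mat3) (A : Mat3) : ℝ :=
  (1 / 2) * ∑ a : Fin 3, ∑ b : Fin 3, A a b * Cel A a b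

/-- `c₁ |E|² ≤ W(E) ≤ c₂ |E|²` for all symmetric `E`, with constants `c₁, c₂ > 0` and the
Euclidean (Frobenius) norm. -/
def IsCoerciveContinuous (Cel : Mat3 →ₗ[ℝ] Mat3) : Prop :=
  ∃ c₁ c₂ : ℝ, 0 < c₁ ∧ 0 < c₂ ∧ ∀ A : Mat3, A.IsSymm →
    c₁ * ∑ a : Fin 3, ∑ b : Fin 3, A a b ^ 2 ≤ elasticDensity Cel A ∧
      elasticDensity Cel A ≤ c₂ * ∑ a : Fin 3, ∑ b : Fin 3, A a b ^ 2

/-! ### Parametrization of the physical domain -/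

/-- The parametric patch `(0,1)³`. -/
def patch : Set E3 := {y | ∀ a : Fin 3, y a ∈ Ioo (0 : ℝ) 1}

/-- `F : (0,1)³ → Ω` is a (`C¹`) diffeomorphism onto `Ω` with inverse `G`, and both `F` and
`G = F⁻¹` are of class `W^{2,∞}`. -/
structure IsW2InfDiffeo (F G : E3 → E3) (Ω : Set E3) : Prop where
  mapsTo : MapsTo F patch Ω
  mapsTo_inv : MapsTo G Ω patch
  invOn : InvOn G F patch Ω
  contDiffOn : ContDiffOn ℝ 1 F patch
  contDiffOn_inv : ContDiffOn ℝ 1 G Ω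
  memW : MemWkInfVec patch 2 F
  memW_inv : MemWkInfVec Ω 2 G

/-! ### Tensor product meshes and quadratic B-splines -/

/-- A finite partition `0 = x₀ < x₁ < ⋯ < x_m = 1` of the unit interval
(the values `x i` with `i > m` play no role). -/
structure UnitPartition where
  m : ℕ
  x : ℕ → ℝ
  x_zero : x 0 = 0
  x_last : x m = 1
  lt : ∀ i j : ℕ, i < j → j ≤ m → x i < x j

/-- The open quadratic knot vector `x₀, x₀, x₀, x₁, …, x_{m-1}, x_m, x_m, x_m` of a partition
(simple interior knots, end knots repeated three times). Truncated subtraction gives the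
repetition on the left, the minimum gives it on the right. -/
def UnitPartition.knot (P : UnitPartition) (i : ℕ) : ℝ := P.x (min (i - 2) P.m)

/-- Cox–de Boor recursion: `bspline t p i` is the `i`-th B-spline of degree `p` for the knots
`t`. Division by zero yields zero, which is the usual convention `0/0 = 0` at repeated knots. -/
def bspline (t : ℕ → ℝ) : ℕ → ℕ → ℝ → ℝ
  | 0, i, s => if t i ≤ s ∧ s < t (i + 1) then 1 else 0
  | p + 1, i, s =>
      (s - t i) / (t (i + p + 1) - t i) * bspline t p i s +
        (t (i + p + 2) - s) / (t (i + p + 2) - t (i + 1)) * bspline t p (i + 1) s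

/-- A tensor product mesh of `(0,1)³`: one partition for each coordinate direction. -/
abbrev TensorMesh : Type := Fin 3 → UnitPartition

/-- Indices of elements: `k` labels the box `∏ₐ (x_{kₐ}, x_{kₐ+1})`. -/
def TensorMesh.IsElement (M : TensorMesh) (k : Fin 3 → ℕ) : Prop :=
  ∀ a : Fin 3, k a < (M a).m

/-- Length of the edges in direction `a` of the element `k`. -/
def TensorMesh.edge (M : TensorMesh) (k : Fin 3 → ℕ) (a : Fin 3) : ℝ :=
  (M a).x (k a + 1) - (M a).x (k a)

/-- Diameter `h_Q` of the element `k`: the length of the diagonal of the box. -/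
def TensorMesh.elementDiam (M : TensorMesh) (k : Fin 3 → ℕ) : ℝ :=
  Real.sqrt (∑ a : Fin 3, M.edge k a ^ 2)

/-- Uniform shape regularity of a sequence of meshes: the ratio between the edges and the
diameter of an element is bounded below, uniformly in the elements and in the meshes. -/
def UniformlyShapeRegular (M : ℕ → TensorMesh) : Prop :=
  ∃ c : ℝ, 0 < c ∧ ∀ n : ℕ, ∀ k : Fin 3 → ℕ, (M n).IsElement k →
    ∀ a : Fin 3, c * (M n).elementDiam k ≤ (M n).edge k a

/-- The tensor product quadratic B-spline with multi-index `j` on the patch. -/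
def TensorMesh.basisFun (M : TensorMesh) (j : Fin 3 → ℕ) (y : E3) : ℝ :=
  ∏ a : Fin 3, bspline (M a).knot 2 (j a) (y a)

/-- The discrete phase-field space: the span of the push-forwards `B_j ∘ F⁻¹` of the tensor
product quadratic B-splines (there are `m + 2` of them in each direction); `G = F⁻¹`. -/
def splineV (M : TensorMesh) (G : E3 → E3) : Submodule ℝ (E3 → ℝ) :=
  Submodule.span ℝ
    {v | ∃ j : Fin 3 → ℕ, (∀ a : Fin 3, j a < (M a).m + 2) ∧ v = fun x => M.basisFun j (G x)}

/-- The discrete displacement space: all three components are splines. -/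
def splineU (M : TensorMesh) (G : E3 → E3) : Set (E3 → E3) :=
  {u | ∀ a : Fin 3, (fun x => u x a) ∈ splineV M G}

/-! ### The discrete phase-field functional -/

open Classical in
/-- The discrete functional
`∫_Ω (v² + η) W(ε(u)) + ∫_Ω ε⁻¹ |v-1|² + 2 ε |∇v|² + ε³ |Δv|²` for `u`, `v` in the discrete spaces
with `0 ≤ v ≤ 1`, and `+∞` otherwise. Functions are considered up to a.e. equality on `Ω`. -/
def discreteEnergy (Cel : Mat3 →ₗ[ℝ] Mat3) (Ω : Set E3) (G : E3 → E3) (M : TensorMesh)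
    (ε η : ℝ) (u : E3 → E3) (v : E3 → ℝ) : ℝ≥0∞ :=
  if (∃ w ∈ splineU M G, u =ᵐ[volume.restrict Ω] w) ∧
      (∃ w ∈ splineV M G, v =ᵐ[volume.restrict Ω] w) ∧
      (∀ᵐ x ∂(volume.restrict Ω), 0 ≤ v x ∧ v x ≤ 1) then
    (∫⁻ x in Ω, ENNReal.ofReal ((v x ^ 2 + η) * elasticDensity Cel (strain Ω u x))) +
      ∫⁻ x in Ω, ENNReal.ofReal (ε⁻¹ * (v x - 1) ^ 2 +
        2 * ε * ∑ i : Fin 3, weakPartial Ω i v x ^ 2 + ε ^ 3 * weakLaplacian Ω v x ^ 2)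
  else ⊤

end

/-! ### Weak derivatives -/

/-! The recovery sequence is explicit. Let `n` be the unit normal of the plane containing the
triangle and let `H` be the mesh size. For a tensor product mesh, shape regularity forces global
quasi-uniformity, so `H` describes every edge, and `H = o(ε)`.

Phase field. The optimal transition for `1 - v` is `w(t) = (1 + |t|) e^{-|t|}`, for which `w² + 2
w'² + w''²` integrates to 4 over the line. It is smoothed near the origin, where it becomes
identically 1, and cut off at infinity, at an arbitrarily small cost in energy. With a cutoff `χ`
equal to 1 near the triangle, the target is `Θ = χ(x) w(n·(x - p)/ε)`. It is pulled back by `F` and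
replaced by a quadratic quasi-interpolant that reproduces quadratic polynomials. Second derivatives
of splines cost `H⁻²`, while those of the target are of order `ε⁻²`. The coefficients must therefore
be accurate to `o((H/ε)²)`, and a second order Taylor expansion of `Θ` provides this. Since `F` is
only of class `W^{2,∞}`, it is linearised; its curvature contributes an error that is smaller by a
factor `ε`.

Constraint. Nonnegative B-splines that sum to one give `0 ≤ v ≤ 1` as soon as the coefficients lie
in `[0,1]`, so these are clamped. Clamping must not spoil the accuracy. A coefficient leaves `[0,1]`
only where the profile is close to 0 or 1, and the profile is built so that its second derivative is
small there (`exists_sepProfile_flat`, `IsTubeData.transitionCoeff_close`). This yields a pointwise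
bound of the scaled density by the profile energy (`IsTubeData.phaseField_density`). Fubini in
normal and tangential coordinates turns it into `4|J|`
(`hausdorff_lt_top_and_lintegral_cthickening_le`, `exists_phaseFields`).

Displacement. Components of `u` have representatives on `Ω \ J` that are bounded and locally
Lipschitz with a uniform constant. They are multiplied by a cutoff that vanishes near `J` at scale
`ε`, and sampled at Greville points (`exists_displacement`). The gradient is `O(1/ε)` near `J`,
bounded beyond distance `l ε`, and converges almost everywhere by Rademacher's theorem. Within
distance `l ε` the phase field vanishes identically, so only `η` weights the elastic energy there.
This gives `η · O(ε⁻²) · O(ε) = O(η/ε) → 0`. On the rest, dominated convergence gives the elastic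
energy of `u`. -/

theorem IsWeakPartial.congr {O : Set E3} (hO : IsOpen O) {i : Fin 3} {f f' g : E3 → ℝ}
    (h : IsWeakPartial O i f g) (hff : f =ᵐ[volume.restrict O] f') : IsWeakPartial O i f' g := by
  obtain ⟨h1, h2, h3⟩ := h
  refine ⟨?_, h2, fun φ hφ hc hs => ?_⟩
  · rw [locallyIntegrableOn_iff hO.isLocallyClosed] at h1 ⊢
    intro K hK hKc
    exact (h1 K hK hKc).congr (ae_restrict_of_ae_restrict_of_subset hK hff)
  · rw [← h3 φ hφ hc hs]
    refine integral_congr_ae ?_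
    filter_upwards [hff] with x hx
    rw [hx]

theorem IsWeakPartial.ae_eq {O : Set E3} (hO : IsOpen O) {i : Fin 3} {f g g' : E3 → ℝ}
    (h : IsWeakPartial O i f g) (h' : IsWeakPartial O i f g') : g =ᵐ[volume.restrict O] g' := by
  have key := hO.ae_eq_zero_of_integral_contDiff_smul_eq_zero (f := fun x => g x - g' x) (μ := volume)
    (h.2.1.sub h'.2.1) (fun φ hφ hc hs => ?_)
  · rw [Filter.EventuallyEq, ae_restrict_iff' hO.measurableSet]
    filter_upwards [key] with x hx hxO
    linarith [hx hxO]
  · have hint : ∀ q : E3 → ℝ, LocallyIntegrableOn q O volume →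
        Integrable (fun x => q x * φ x) (volume.restrict O) := by
      intro q hq
      have h1 : IntegrableOn (fun x => q x * φ x) (tsupport φ) := by
        exact ((hq.integrableOn_compact_subset hs hc).mul_continuousOn hφ.continuous.continuousOn hc)
      have h2 : Integrable (fun x => q x * φ x) := by
        rw [integrableOn_iff_integrable_of_support_subset] at h1
        · exact h1
        · intro x hx
          apply subset_tsupport
          intro h0
          exact hx (by simp [h0])
      exact h2.integrableOn
    have e1 := h.2.2 φ hφ hc hs
    have e2 := h'.2.2 φ hφ hc hs
    have e3 : ∫ x in O, (g x * φ x - g' x * φ x) = 0 := by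
      rw [integral_sub (hint g h.2.1) (hint g' h'.2.1)]
      linarith
    have e4 : ∫ x, φ x • (g x - g' x) = ∫ x in O, φ x • (g x - g' x) := by
      symm
      apply setIntegral_eq_integral_of_forall_compl_eq_zero
      intro x hx
      have : φ x = 0 := by
        by_contra h0
        exact hx (hs (subset_tsupport _ h0))
      simp [this]
    rw [e4, ← e3]
    congr 1
    ext x
    simp only [smul_eq_mul]
    ring

/-- The value of `weakPartial` is an arbitrary choice. It is only ever accessed here, by exhibiting
one weak derivative and using uniqueness. -/
theorem weakPartial_ae_eq {O : Set E3} (hO : IsOpen O) {i : Fin 3} {f f' g : E3 → ℝ}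
    (h : IsWeakPartial O i f' g) (hff : f =ᵐ[volume.restrict O] f') :
    weakPartial O i f =ᵐ[volume.restrict O] g := by
  have hex : ∃ g, IsWeakPartial O i f g := ⟨g, h.congr hO hff.symm⟩
  have : weakPartial O i f = hex.choose := by
    unfold weakPartial
    rw [dif_pos hex]
  rw [this]
  exact hex.choose_spec.ae_eq hO (h.congr hO hff.symm)

theorem LocallyLipschitzOn.locallyIntegrableOn_fderiv {O : Set E3} (hO : IsOpen O) {f : E3 → ℝ}
    (hf : LocallyLipschitzOn O f) (e : E3) :
    LocallyIntegrableOn (fun x => fderiv ℝ f x e) O volume := by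
  intro x hx
  obtain ⟨K, t, ht, hK⟩ := hf hx
  rw [hO.nhdsWithin_eq hx] at ht
  obtain ⟨r, hr, hrt⟩ := Metric.mem_nhds_iff.1 ht
  refine ⟨Metric.ball x r, mem_nhdsWithin_of_mem_nhds (Metric.ball_mem_nhds x hr), ?_⟩
  refine Measure.integrableOn_of_bounded (M := K * ‖e‖) measure_ball_lt_top.ne
    (measurable_fderiv_apply_const ℝ f e).aestronglyMeasurable ?_
  filter_upwards [ae_restrict_mem measurableSet_ball] with y hy
  refine (ContinuousLinearMap.le_opNorm _ _).trans ?_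
  gcongr
  exact norm_fderiv_le_of_lipschitzOn ℝ (Metric.isOpen_ball.mem_nhds hy) (hK.mono hrt)

/-- Integration by parts holds for globally Lipschitz functions by Rademacher's theorem. On a
compact neighbourhood of the support of the test function, `f` is Lipschitz and can be replaced by a
global Lipschitz extension. -/
theorem isWeakPartial_fderiv {O : Set E3} (hO : IsOpen O) {f : E3 → ℝ}
    (hf : LocallyLipschitzOn O f) (i : Fin 3) :
    IsWeakPartial O i f (fun x => fderiv ℝ f x (EuclideanSpace.single i (1 : ℝ))) := by
  refine ⟨hf.continuousOn.locallyIntegrableOn hO.measurableSet,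
    hf.locallyIntegrableOn_fderiv hO _, fun φ hφ hc hs => ?_⟩
  -- A thickening of the support is needed: the extension must share the derivatives of `f` at
  -- points of the support, and not only its values.
  obtain ⟨r, hr, hrO⟩ := (show IsCompact (tsupport φ) from hc).exists_cthickening_subset_open hO hs
  have hcomp : IsCompact (Metric.cthickening r (tsupport φ)) := IsCompact.cthickening hc
  obtain ⟨K, hK⟩ := (hf.mono hrO).exists_lipschitzOnWith_of_compact hcomp
  obtain ⟨F, hF, hFf⟩ := hK.extend_real
  obtain ⟨D, hD⟩ := hφ.lipschitzWith_of_hasCompactSupport hc (by simp)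
  set e : E3 := EuclideanSpace.single i (1 : ℝ) with he
  have key := hF.integral_lineDeriv_mul_eq (μ := volume) hD hc e
  have hnear : ∀ x ∈ tsupport φ, F =ᶠ[𝓝 x] f := by
    intro x hx
    have : Metric.cthickening r (tsupport φ) ∈ 𝓝 x :=
      mem_of_superset (Metric.isOpen_thickening.mem_nhds
        (Metric.self_subset_thickening hr _ hx)) (Metric.thickening_subset_cthickening _ _)
    filter_upwards [this] with y hy
    exact (hFf hy).symm
  have e1 : ∫ x in O, f x * fderiv ℝ φ x e = ∫ x, F x * fderiv ℝ φ x e := by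
    rw [setIntegral_eq_integral_of_forall_compl_eq_zero]
    · refine integral_congr_ae (ae_of_all _ fun x => ?_)
      by_cases hx : x ∈ tsupport φ
      · simp only [(hnear x hx).eq_of_nhds]
      · simp [fderiv_of_notMem_tsupport ℝ hx]
    · intro x hx
      simp [fderiv_of_notMem_tsupport ℝ (fun h => hx (hs h))]
  have e2 : ∫ x in O, fderiv ℝ f x e * φ x = ∫ x, lineDeriv ℝ F x e * φ x := by
    rw [setIntegral_eq_integral_of_forall_compl_eq_zero]
    · refine integral_congr_ae ?_
      filter_upwards [hF.ae_differentiableAt (μ := volume)] with x hdx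
      by_cases hx : x ∈ tsupport φ
      · rw [hdx.lineDeriv_eq_fderiv, (hnear x hx).fderiv_eq]
      · simp [image_eq_zero_of_notMem_tsupport hx]
    · intro x hx
      simp [image_eq_zero_of_notMem_tsupport (fun h => hx (hs h))]
  rw [e1, e2, key, ← integral_neg]
  congr 1
  ext x
  rw [((hφ.differentiable (by simp)) x).lineDeriv_eq_fderiv, map_neg]
  ring

/-! ### Functions that are locally Lipschitz with a uniform constant -/

/-- Every point of `O` has a neighbourhood in `O` on which `f` is Lipschitz with constant `L`. -/
def UniformlyLocLip (L : ℝ) (O : Set E3) (f : E3 → ℝ) : Prop :=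
  ∀ x ∈ O, ∃ r > 0, Metric.ball x r ⊆ O ∧
    ∀ y ∈ Metric.ball x r, ∀ z ∈ Metric.ball x r, |f y - f z| ≤ L * dist y z

theorem UniformlyLocLip.locallyLipschitzOn {L : ℝ} {O : Set E3} {f : E3 → ℝ}
    (hf : UniformlyLocLip L O f) : LocallyLipschitzOn O f := by
  intro x hx
  obtain ⟨r, hr, -, h⟩ := hf x hx
  refine ⟨L.toNNReal, Metric.ball x r, mem_nhdsWithin_of_mem_nhds (Metric.ball_mem_nhds x hr),
    LipschitzOnWith.of_dist_le_mul fun y hy z hz => ?_⟩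
  rw [Real.dist_eq]
  refine (h y hy z hz).trans ?_
  gcongr
  exact Real.le_coe_toNNReal L

theorem UniformlyLocLip.mono {L L' : ℝ} {O O' : Set E3} {f : E3 → ℝ}
    (hf : UniformlyLocLip L O f) (hO' : IsOpen O') (hO : O' ⊆ O) (hL : L ≤ L') :
    UniformlyLocLip L' O' f := by
  intro x hx
  obtain ⟨r, hr, -, h⟩ := hf x (hO hx)
  obtain ⟨r', hr', h'⟩ := Metric.isOpen_iff.1 hO' x hx
  refine ⟨min r r', lt_min hr hr', (Metric.ball_subset_ball (min_le_right _ _)).trans h',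
    fun y hy z hz => ?_⟩
  refine (h y (Metric.ball_subset_ball (min_le_left _ _) hy) z
    (Metric.ball_subset_ball (min_le_left _ _) hz)).trans ?_
  gcongr

theorem UniformlyLocLip.norm_fderiv_le {L : ℝ} (hL : 0 ≤ L) {O : Set E3} {f : E3 → ℝ}
    (hf : UniformlyLocLip L O f) {x : E3} (hx : x ∈ O) : ‖fderiv ℝ f x‖ ≤ L := by
  obtain ⟨r, hr, -, h⟩ := hf x hx
  refine norm_fderiv_le_of_lip' ℝ hL ?_
  filter_upwards [Metric.ball_mem_nhds x hr] with y hy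
  rw [Real.norm_eq_abs, ← dist_eq_norm]
  exact h y hy x (Metric.mem_ball_self hr)

theorem LocallyLipschitzOn.ae_differentiableAt {O : Set E3} (hO : IsOpen O) {f : E3 → ℝ}
    (hf : LocallyLipschitzOn O f) : ∀ᵐ x ∂(volume.restrict O), DifferentiableAt ℝ f x := by
  rw [ae_restrict_iff' hO.measurableSet, ae_iff]
  refine measure_null_of_locally_null _ fun x hx => ?_
  simp only [Classical.not_imp, Set.mem_ofPred_eq] at hx
  obtain ⟨K, t, ht, hK⟩ := hf hx.1
  rw [hO.nhdsWithin_eq hx.1] at ht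
  obtain ⟨r, hr, hrt⟩ := Metric.mem_nhds_iff.1 ht
  refine ⟨Metric.ball x r ∩ {a | ¬(a ∈ O → DifferentiableAt ℝ f a)},
    inter_mem (mem_nhdsWithin_of_mem_nhds (Metric.ball_mem_nhds x hr)) self_mem_nhdsWithin, ?_⟩
  have h := (hK.mono hrt).ae_differentiableWithinAt_of_mem (μ := volume)
  refine measure_mono_null ?_ (ae_iff.1 h)
  rintro y ⟨hy1, hy2⟩
  simp only [Classical.not_imp, Set.mem_ofPred_eq] at hy2 ⊢
  exact ⟨hy1, fun hd => hy2.2 (hd.differentiableAt (Metric.isOpen_ball.mem_nhds hy1))⟩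

/-- The segment is subdivided below a Lebesgue number of the cover by good balls, and the local
bounds telescope. Only the segment has to lie in `O`; for sets such as `Ω \ J` no global Lipschitz
bound can be expected. -/
theorem UniformlyLocLip.le_of_segment_subset {L : ℝ} {O : Set E3} {f : E3 → ℝ}
    (hf : UniformlyLocLip L O f) {x y : E3} (hxy : segment ℝ x y ⊆ O) :
    |f x - f y| ≤ L * dist x y := by
  have hcomp : IsCompact (segment ℝ x y) := by
    rw [← Path.range_segment]
    exact isCompact_range (Path.segment x y).continuous
  choose! r hr hrO hrl using hf
  obtain ⟨δ, hδ, H⟩ := lebesgue_number_lemma_of_metric (s := segment ℝ x y)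
    (c := fun z : segment ℝ x y => Metric.ball (z : E3) (r z)) hcomp
    (fun z => Metric.isOpen_ball) (fun z hz => mem_iUnion.2 ⟨⟨z, hz⟩,
      Metric.mem_ball_self (hr z (hxy hz))⟩)
  obtain ⟨N, hN⟩ := exists_nat_gt (dist x y / δ)
  have hN0 : (0 : ℝ) < N := lt_of_le_of_lt (by positivity) hN
  set p : ℕ → E3 := fun k => AffineMap.lineMap x y ((k : ℝ) / N) with hp
  have hpd : ∀ k, dist (p k) (p (k + 1)) = dist x y / N := by
    intro k
    simp only [hp, dist_lineMap_lineMap]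
    rw [Real.dist_eq]
    have : ((k : ℝ) / N - ((k + 1 : ℕ) : ℝ) / N) = -(1 / N) := by push_cast; ring
    rw [this, abs_neg, abs_of_pos (by positivity)]
    ring
  have hps : ∀ k ≤ N, p k ∈ segment ℝ x y := by
    intro k hk
    rw [segment_eq_image_lineMap]
    refine ⟨(k : ℝ) / N, ⟨by positivity, ?_⟩, rfl⟩
    rw [div_le_one hN0]
    exact_mod_cast hk
  have hind : ∀ k ≤ N, |f (p 0) - f (p k)| ≤ L * (k * (dist x y / N)) := by
    intro k
    induction k with
    | zero => intro _; simp
    | succ k ih =>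
      intro hk
      have h1 := ih (by omega)
      obtain ⟨⟨z, hz⟩, hzb⟩ := H (p k) (hps k (by omega))
      have h2 := hrl z (hxy hz) (p k) (hzb (Metric.mem_ball_self hδ)) (p (k + 1)) (hzb (by
        rw [Metric.mem_ball, dist_comm, hpd, div_lt_iff₀ hN0]
        rwa [div_lt_iff₀ hδ, mul_comm] at hN))
      rw [hpd] at h2
      calc |f (p 0) - f (p (k + 1))| ≤ |f (p 0) - f (p k)| + |f (p k) - f (p (k + 1))| :=
            abs_sub_le _ _ _
        _ ≤ L * (k * (dist x y / N)) + L * (dist x y / N) := add_le_add h1 h2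
        _ = _ := by push_cast; ring
  have := hind N le_rfl
  have e0 : p 0 = x := by simp [hp]
  have e1 : p N = y := by simp [hp, hN0.ne']
  rw [e0, e1] at this
  refine this.trans (le_of_eq ?_)
  field_simp

/-- Bump functions on `E3` with shrinking supports. -/
noncomputable def shrinkingBump (k : ℕ) : ContDiffBump (0 : E3) where
  rIn := 1 / (2 * ((k : ℝ) + 1))
  rOut := 1 / ((k : ℝ) + 1)
  rIn_pos := by positivity
  rIn_lt_rOut := by
    have : (0 : ℝ) < (k : ℝ) + 1 := by positivity
    rw [div_lt_div_iff_of_pos_left one_pos (by positivity) this]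
    linarith

/-- Mollification of `f`. -/
noncomputable def mollify (k : ℕ) (f : E3 → ℝ) : E3 → ℝ :=
  convolution ((shrinkingBump k).normed volume) f (ContinuousLinearMap.lsmul ℝ ℝ) volume

theorem abs_convolution_bump_le (k : ℕ) {f : E3 → ℝ} {B : ℝ} (hB : 0 ≤ B)
    (hf : ∀ᵐ x, |f x| ≤ B) (x : E3) : |mollify k f x| ≤ B := by
  unfold mollify
  rw [convolution_def, ← Real.norm_eq_abs]
  have hint : Integrable (fun t => (shrinkingBump k).normed volume t * B) :=
    ((shrinkingBump k).integrable_normed).mul_const B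
  refine (norm_integral_le_of_norm_le hint ?_).trans (le_of_eq ?_)
  · have : ∀ᵐ t, |f (x - t)| ≤ B :=
      (quasiMeasurePreserving_sub_left_of_right_invariant volume x).ae hf
    filter_upwards [this] with t ht
    simp only [ContinuousLinearMap.lsmul_apply, smul_eq_mul, norm_mul, Real.norm_eq_abs]
    rw [abs_of_nonneg ((shrinkingBump k).nonneg_normed t)]
    exact mul_le_mul_of_nonneg_left ht ((shrinkingBump k).nonneg_normed t)
  · rw [integral_mul_const, (shrinkingBump k).integral_normed, one_mul]

theorem fderiv_mollify_apply (k : ℕ) {f : E3 → ℝ} (hf : LocallyIntegrable f volume) (x : E3) :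
    DifferentiableAt ℝ (mollify k f) x ∧ ∀ e : E3, fderiv ℝ (mollify k f) x e =
      ∫ y, f y * fderiv ℝ ((shrinkingBump k).normed volume) (x - y) e := by
  have hc := (shrinkingBump k).hasCompactSupport_normed (μ := volume)
  have hd : ContDiff ℝ 1 ((shrinkingBump k).normed (volume : Measure E3)) :=
    (shrinkingBump k).contDiff_normed
  have h := hc.hasFDerivAt_convolution_left (ContinuousLinearMap.lsmul ℝ ℝ) hd hf x
  refine ⟨h.differentiableAt, fun e => ?_⟩
  unfold mollify
  have hex := (hc.fderiv ℝ).convolutionExists_left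
    ((ContinuousLinearMap.lsmul ℝ ℝ).precompL E3) (hd.continuous_fderiv one_ne_zero) hf x
  rw [h.fderiv, convolution_def, ContinuousLinearMap.integral_apply hex,
    ← integral_sub_left_eq_self _ volume x]
  congr 1
  ext y
  simp [mul_comm]

/-- The derivative falls on the kernel centred at `x`, which is an admissible test function because
its support lies in `O`. It is then moved onto `g`, and an average of `g` against a probability
density is at most `B`. -/
theorem abs_fderiv_mollify_le (k : ℕ) {O : Set E3} {f g : E3 → ℝ} {B : ℝ} (i : Fin 3)
    (hO : IsOpen O)
    (hfint : LocallyIntegrable (O.indicator f) volume) (hg : ∀ᵐ x ∂(volume.restrict O), |g x| ≤ B)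
    (hfg : IsWeakPartial O i f g) {x : E3} (hx : Metric.closedBall x (shrinkingBump k).rOut ⊆ O) :
    |fderiv ℝ (mollify k (O.indicator f)) x (EuclideanSpace.single i (1 : ℝ))| ≤ B := by
  rw [(fderiv_mollify_apply k hfint x).2]
  set b := shrinkingBump k
  set ψ : E3 → ℝ := fun y => b.normed volume (x - y) with hψ
  have hbc : ContDiff ℝ ∞ (b.normed (volume : Measure E3)) := b.contDiff_normed
  have hψd : ContDiff ℝ ∞ ψ := hbc.comp (contDiff_const.sub contDiff_id)
  have hψs : ∀ y, ψ y ≠ 0 → y ∈ Metric.ball x b.rOut := by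
    intro y hy
    have : x - y ∈ Function.support (b.normed (volume : Measure E3)) := hy
    rw [b.support_normed_eq] at this
    simpa [dist_eq_norm, norm_sub_rev] using this
  have hts : tsupport ψ ⊆ Metric.closedBall x b.rOut := by
    refine closure_minimal ?_ Metric.isClosed_closedBall
    intro y hy
    exact Metric.ball_subset_closedBall (hψs y hy)
  have hψc : HasCompactSupport ψ :=
    (isCompact_closedBall x b.rOut).of_isClosed_subset (isClosed_tsupport _) hts
  have h1 := hfg.2.2 ψ hψd hψc (hts.trans hx)
  have hder : ∀ y, fderiv ℝ ψ y (EuclideanSpace.single i (1 : ℝ)) =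
      - fderiv ℝ (b.normed volume) (x - y) (EuclideanSpace.single i (1 : ℝ)) := by
    intro y
    have h2 : HasFDerivAt ψ ((fderiv ℝ (b.normed volume) (x - y)).comp
        (-ContinuousLinearMap.id ℝ E3)) y := by
      have h3 := ((hbc.differentiable (by simp)) (x - y)).hasFDerivAt
      exact h3.comp y ((hasFDerivAt_id y).const_sub x)
    rw [h2.fderiv]
    simp
  have h2 : ∫ y, O.indicator f y * fderiv ℝ (b.normed volume) (x - y)
      (EuclideanSpace.single i (1 : ℝ)) = ∫ y in O, g y * ψ y := by
    have : ∫ y in O, g y * ψ y = - ∫ y in O, f y * fderiv ℝ ψ y (EuclideanSpace.single i (1 : ℝ)) := by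
      rw [h1, neg_neg]
    rw [this, ← integral_neg, ← integral_indicator hO.measurableSet]
    congr 1
    ext y
    by_cases hy : y ∈ O
    · simp [hy, hder]
    · simp [hy]
  rw [h2, ← Real.norm_eq_abs]
  have hψint : Integrable ψ := hψd.continuous.integrable_of_hasCompactSupport hψc
  have hψnn : ∀ y, 0 ≤ ψ y := fun y => b.nonneg_normed _
  refine (norm_integral_le_of_norm_le (g := fun y => B * ψ y) (hψint.integrableOn.const_mul B) ?_).trans ?_
  · filter_upwards [hg] with y hy
    rw [norm_mul, Real.norm_eq_abs, Real.norm_of_nonneg (hψnn y)]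
    exact mul_le_mul_of_nonneg_right hy (hψnn y)
  · rw [setIntegral_eq_integral_of_forall_compl_eq_zero, integral_const_mul]
    · have : ∫ y, ψ y = 1 := by
        rw [hψ]
        rw [integral_sub_left_eq_self (fun y => b.normed volume y) volume x]
        exact b.integral_normed
      rw [this, mul_one]
    · intro y hy
      have : ψ y = 0 := by
        by_contra h0
        exact hy (hx (Metric.ball_subset_closedBall (hψs y h0)))
      simp [this]

/-- Mollifications of `f` are bounded by `B` and, on small balls, eventually Lipschitz with a common
constant, the sum of the bounds of the weak partials. Their pointwise limsup is defined everywhere,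
inherits both bounds, and equals `f` almost everywhere because the mollifications converge there. -/
theorem exists_uniformlyLocLip_of_weakPartials {O : Set E3} (hO : IsOpen O) {f : E3 → ℝ}
    (hf : MemLp f ∞ (volume.restrict O))
    (hg : ∀ i : Fin 3, ∃ g, IsWeakPartial O i f g ∧ MemLp g ∞ (volume.restrict O)) :
    ∃ (L B : ℝ) (f' : E3 → ℝ), 0 ≤ L ∧ 0 ≤ B ∧ f =ᵐ[volume.restrict O] f' ∧ (∀ x, |f' x| ≤ B) ∧
      UniformlyLocLip L O f' := by
  have hbd : ∀ q : E3 → ℝ, MemLp q ∞ (volume.restrict O) →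
      ∃ B : ℝ, 0 ≤ B ∧ ∀ᵐ x ∂(volume.restrict O), |q x| ≤ B := by
    intro q hq
    refine ⟨(eLpNorm q ∞ (volume.restrict O)).toReal, ENNReal.toReal_nonneg, ?_⟩
    filter_upwards [ae_le_eLpNormEssSup (f := q) (μ := volume.restrict O)] with x hx
    rw [← eLpNorm_exponent_top] at hx
    have := ENNReal.toReal_mono hq.2.ne hx
    simpa using this
  obtain ⟨B, hB, hfB⟩ := hbd f hf
  choose g hg1 hg2 using hg
  choose M hM hgM using fun i => hbd (g i) (hg2 i)
  have hfB' : ∀ᵐ x, |O.indicator f x| ≤ B := by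
    rw [ae_restrict_iff' hO.measurableSet] at hfB
    filter_upwards [hfB] with x hx
    by_cases hxO : x ∈ O
    · simpa [hxO] using hx hxO
    · simpa [hxO] using hB
  have hfint : LocallyIntegrable (O.indicator f) volume := by
    have hm : AEStronglyMeasurable (O.indicator f) volume :=
      (aestronglyMeasurable_indicator_iff hO.measurableSet).2 hf.1
    intro x
    refine ⟨Metric.ball x 1, Metric.ball_mem_nhds x one_pos, ?_⟩
    exact Measure.integrableOn_of_bounded (M := B) measure_ball_lt_top.ne hm
      (ae_restrict_of_ae hfB')
  set L : ℝ := ∑ i, M i with hL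
  have hL0 : 0 ≤ L := Finset.sum_nonneg fun i _ => hM i
  have hlip : ∀ x₀ : E3, ∀ r > 0, Metric.ball x₀ (2 * r) ⊆ O → ∀ᶠ k in atTop,
      ∀ y ∈ Metric.ball x₀ r, ∀ z ∈ Metric.ball x₀ r,
        |mollify k (O.indicator f) y - mollify k (O.indicator f) z| ≤ L * dist y z := by
    intro x₀ r hr hball
    have hlim : Tendsto (fun k : ℕ => (shrinkingBump k).rOut) atTop (𝓝 0) :=
      tendsto_one_div_add_atTop_nhds_zero_nat
    filter_upwards [hlim.eventually (gt_mem_nhds hr)] with k hk y hy z hz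
    have := (convex_ball x₀ r).norm_image_sub_le_of_norm_fderiv_le (𝕜 := ℝ)
      (f := mollify k (O.indicator f)) (C := L)
      (fun x _ => (fderiv_mollify_apply k hfint x).1) (fun x hx => ?_) hz hy
    · rwa [← dist_eq_norm, ← Real.norm_eq_abs, dist_eq_norm, ← dist_eq_norm y z] at *
    · have hxO : Metric.closedBall x (shrinkingBump k).rOut ⊆ O := by
        refine Subset.trans (fun w hw => ?_) hball
        rw [Metric.mem_closedBall] at hw
        rw [Metric.mem_ball] at hx ⊢
        have := dist_triangle w x x₀
        linarith
      refine ContinuousLinearMap.opNorm_le_bound _ hL0 fun v => ?_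
      have hv : v = ∑ i, v i • EuclideanSpace.single i (1 : ℝ) := by
        ext j
        fin_cases j <;> simp [Fin.sum_univ_three]
      have hvle : ∀ i, |v i| ≤ ‖v‖ := fun i => by
        simpa using PiLp.norm_apply_le v i
      conv_lhs => rw [hv]
      rw [map_sum, hL, Finset.sum_mul]
      refine (norm_sum_le _ _).trans (Finset.sum_le_sum fun i _ => ?_)
      rw [map_smul, norm_smul, mul_comm, Real.norm_eq_abs, Real.norm_eq_abs]
      exact mul_le_mul (abs_fderiv_mollify_le k i hO hfint (hgM i) (hg1 i) hxO) (hvle i)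
        (abs_nonneg _) (hM i)
  have hconv : ∀ᵐ x, Tendsto (fun k => mollify k (O.indicator f) x) atTop
      (𝓝 (O.indicator f x)) :=
    ContDiffBump.ae_convolution_tendsto_right_of_locallyIntegrable (φ := shrinkingBump) (K := 2)
      tendsto_one_div_add_atTop_nhds_zero_nat
      (Eventually.of_forall fun k => by
        simp only [shrinkingBump]
        have : (k : ℝ) + 1 ≠ 0 := by positivity
        field_simp
        exact le_rfl) hfint
  have hbnd : ∀ k x, |mollify k (O.indicator f) x| ≤ B := fun k x =>
    abs_convolution_bump_le k hB hfB' x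
  have hbu : ∀ x, IsBoundedUnder (· ≤ ·) atTop (fun k => mollify k (O.indicator f) x) := fun x =>
    isBoundedUnder_of ⟨B, fun k => (abs_le.1 (hbnd k x)).2⟩
  have hbl : ∀ x, IsBoundedUnder (· ≥ ·) atTop (fun k => mollify k (O.indicator f) x) := fun x =>
    isBoundedUnder_of ⟨-B, fun k => (abs_le.1 (hbnd k x)).1⟩
  refine ⟨L, B, fun x => limsup (fun k => mollify k (O.indicator f) x) atTop, hL0, hB, ?_, ?_, ?_⟩
  · filter_upwards [ae_restrict_of_ae hconv, ae_restrict_mem hO.measurableSet] with x hx hxO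
    rw [hx.limsup_eq]
    simp [hxO]
  · intro x
    rw [abs_le]
    exact ⟨le_limsup_of_frequently_le (Frequently.of_forall fun k => (abs_le.1 (hbnd k x)).1) (hbu x),
      limsup_le_of_le (hbl x).isCoboundedUnder_le (Eventually.of_forall fun k => (abs_le.1 (hbnd k x)).2)⟩
  · intro x₀ hx₀
    obtain ⟨r, hr, hrO⟩ := Metric.isOpen_iff.1 hO x₀ hx₀
    refine ⟨r / 2, half_pos hr, (Metric.ball_subset_ball (by linarith)).trans hrO, ?_⟩
    have hev := hlip x₀ (r / 2) (half_pos hr) (by rwa [mul_div_cancel₀ _ (two_ne_zero)])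
    have key : ∀ y ∈ Metric.ball x₀ (r / 2), ∀ z ∈ Metric.ball x₀ (r / 2),
        limsup (fun k => mollify k (O.indicator f) y) atTop ≤
          limsup (fun k => mollify k (O.indicator f) z) atTop + L * dist y z := by
      intro y hy z hz
      refine le_of_forall_pos_le_add fun e he => ?_
      refine limsup_le_of_le (hbl y).isCoboundedUnder_le ?_
      have h1 := eventually_lt_of_limsup_lt (lt_add_of_pos_right
        (limsup (fun k => mollify k (O.indicator f) z) atTop) he) (hbu z)
      filter_upwards [hev, h1] with k hk h1k
      have := (abs_le.1 (hk y hy z hz)).2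
      linarith
    intro y hy z hz
    rw [abs_le]
    have h1 := key y hy z hz
    have h2 := key z hz y hy
    rw [dist_comm z y] at h2
    constructor <;> linarith

/-! ### Univariate quadratic B-splines -/

theorem bspline_succ (t : ℕ → ℝ) (p i : ℕ) (s : ℝ) :
    bspline t (p + 1) i s = (s - t i) / (t (i + p + 1) - t i) * bspline t p i s +
      (t (i + p + 2) - s) / (t (i + p + 2) - t (i + 1)) * bspline t p (i + 1) s := rfl

namespace UnitPartition

variable (P : UnitPartition)

theorem mono {i j : ℕ} (h : i ≤ j) (hj : j ≤ P.m) : P.x i ≤ P.x j := by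
  rcases h.eq_or_lt with rfl | h
  · exact le_rfl
  · exact (P.lt i j h hj).le

/-- The first knot is repeated three times, which shifts the breakpoints by two in the knot
sequence. -/
theorem knot_add_two {k : ℕ} (hk : k ≤ P.m) : P.knot (k + 2) = P.x k := by
  simp [knot, hk]

theorem knot_mono : Monotone P.knot := by
  intro i j h
  unfold knot
  exact P.mono (by omega) (min_le_right _ _)

theorem m_pos : 0 < P.m := by
  rcases Nat.eq_zero_or_pos P.m with h | h
  · have h0 := P.x_zero
    have h1 := P.x_last
    rw [h, h0] at h1
    exact absurd h1 zero_ne_one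
  · exact h

theorem x_nonneg {k : ℕ} (hk : k ≤ P.m) : 0 ≤ P.x k := P.x_zero ▸ P.mono (Nat.zero_le k) hk

theorem x_le_one {k : ℕ} (hk : k ≤ P.m) : P.x k ≤ 1 := P.x_last ▸ P.mono hk le_rfl

theorem knot_mem (i : ℕ) : P.knot i ∈ Icc (0 : ℝ) 1 :=
  ⟨P.x_nonneg (min_le_right _ _), P.x_le_one (min_le_right _ _)⟩

theorem exists_mem_Ico {s : ℝ} (hs : s ∈ Ico (0 : ℝ) 1) :
    ∃ k < P.m, s ∈ Ico (P.x k) (P.x (k + 1)) := by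
  classical
  have hex : ∃ k, k ≤ P.m ∧ s < P.x k := ⟨P.m, le_rfl, P.x_last ▸ hs.2⟩
  have h1 := Nat.find_spec hex
  have hpos : Nat.find hex ≠ 0 := by
    intro h0
    rw [h0, P.x_zero] at h1
    exact absurd hs.1 (not_le.2 h1.2)
  obtain ⟨k, hk⟩ := Nat.exists_eq_succ_of_ne_zero hpos
  rw [hk] at h1
  refine ⟨k, by omega, ?_, h1.2⟩
  have := Nat.find_min hex (m := k) (by omega)
  simp only [not_and, not_lt] at this
  exact this (by omega)

theorem bspline_zero {k : ℕ} (hk : k < P.m) {s : ℝ} (hs : s ∈ Ico (P.x k) (P.x (k + 1))) (i : ℕ) :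
    bspline P.knot 0 i s = if i = k + 2 then 1 else 0 := by
  have e2 := P.knot_add_two hk.le
  have e3 : P.knot (k + 3) = P.x (k + 1) := P.knot_add_two (k := k + 1) hk
  simp only [bspline]
  by_cases h : i = k + 2
  · subst h
    rw [if_pos rfl, if_pos ⟨by rw [e2]; exact hs.1, by rw [show k + 2 + 1 = k + 3 from rfl, e3]; exact hs.2⟩]
  · rw [if_neg h, if_neg]
    rintro ⟨h1, h2⟩
    rcases lt_or_gt_of_ne h with h | h
    · have := P.knot_mono (show i + 1 ≤ k + 2 by omega)
      linarith [hs.1]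
    · have := P.knot_mono (show k + 3 ≤ i by omega)
      linarith [hs.2]

/-- The quadratic piece on `[x_k, x_{k+1})` of the spline with coefficients `c`. -/
noncomputable def piece (c : ℕ → ℝ) (k : ℕ) (s : ℝ) : ℝ :=
  c (k + 1) +
    (c (k + 2) - c (k + 1)) * ((s - P.knot (k + 2)) ^ 2 /
      ((P.knot (k + 4) - P.knot (k + 2)) * (P.knot (k + 3) - P.knot (k + 2)))) +
    (c k - c (k + 1)) * ((P.knot (k + 3) - s) ^ 2 /
      ((P.knot (k + 3) - P.knot (k + 1)) * (P.knot (k + 3) - P.knot (k + 2))))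

/-- The derivative of `piece`. -/
noncomputable def pieceDeriv (c : ℕ → ℝ) (k : ℕ) (s : ℝ) : ℝ :=
    (c (k + 2) - c (k + 1)) * (2 * (s - P.knot (k + 2)) /
      ((P.knot (k + 4) - P.knot (k + 2)) * (P.knot (k + 3) - P.knot (k + 2)))) -
    (c k - c (k + 1)) * (2 * (P.knot (k + 3) - s) /
      ((P.knot (k + 3) - P.knot (k + 1)) * (P.knot (k + 3) - P.knot (k + 2))))

/-- The second derivative of `piece`. -/
noncomputable def pieceDeriv2 (c : ℕ → ℝ) (k : ℕ) : ℝ :=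
    (c (k + 2) - c (k + 1)) * (2 /
      ((P.knot (k + 4) - P.knot (k + 2)) * (P.knot (k + 3) - P.knot (k + 2)))) +
    (c k - c (k + 1)) * (2 /
      ((P.knot (k + 3) - P.knot (k + 1)) * (P.knot (k + 3) - P.knot (k + 2))))

theorem hasDerivAt_piece (c : ℕ → ℝ) (k : ℕ) (s : ℝ) :
    HasDerivAt (P.piece c k) (P.pieceDeriv c k s) s := by
  unfold piece pieceDeriv
  have h1 : HasDerivAt (fun s => s - P.knot (k + 2)) 1 s := (hasDerivAt_id s).sub_const _
  have h2 : HasDerivAt (fun s => P.knot (k + 3) - s) (-1) s := (hasDerivAt_id s).const_sub _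
  have := (((h1.pow 2).div_const ((P.knot (k + 4) - P.knot (k + 2)) *
    (P.knot (k + 3) - P.knot (k + 2)))).const_mul (c (k + 2) - c (k + 1))).const_add (c (k + 1))
  have := this.add (((h2.pow 2).div_const ((P.knot (k + 3) - P.knot (k + 1)) *
    (P.knot (k + 3) - P.knot (k + 2)))).const_mul (c k - c (k + 1)))
  refine this.congr_deriv ?_
  simp only [Nat.cast_ofNat, Nat.add_one_sub_one, pow_one, mul_one, mul_neg]
  ring

theorem hasDerivAt_pieceDeriv (c : ℕ → ℝ) (k : ℕ) (s : ℝ) :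
    HasDerivAt (P.pieceDeriv c k) (P.pieceDeriv2 c k) s := by
  unfold pieceDeriv pieceDeriv2
  have h1 : HasDerivAt (fun s => s - P.knot (k + 2)) 1 s := (hasDerivAt_id s).sub_const _
  have h2 : HasDerivAt (fun s => P.knot (k + 3) - s) (-1) s := (hasDerivAt_id s).const_sub _
  have := (((h1.const_mul 2).div_const ((P.knot (k + 4) - P.knot (k + 2)) *
    (P.knot (k + 3) - P.knot (k + 2)))).const_mul (c (k + 2) - c (k + 1)))
  have := this.sub (((h2.const_mul 2).div_const ((P.knot (k + 3) - P.knot (k + 1)) *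
    (P.knot (k + 3) - P.knot (k + 2)))).const_mul (c k - c (k + 1)))
  refine this.congr_deriv ?_
  ring

theorem knot_gap {k : ℕ} (hk : k < P.m) :
    0 < P.knot (k + 3) - P.knot (k + 2) ∧ P.knot (k + 3) ≤ P.knot (k + 4) ∧
      P.knot (k + 1) ≤ P.knot (k + 2) := by
  refine ⟨?_, P.knot_mono (by omega), P.knot_mono (by omega)⟩
  rw [P.knot_add_two hk.le, show k + 3 = k + 1 + 2 from rfl, P.knot_add_two (k := k + 1) hk]
  exact sub_pos.2 (P.lt k (k + 1) (by omega) hk)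

/-- On one element only the B-splines of index `k`, `k + 1`, `k + 2` survive the recursion. In
`piece` the middle one has been eliminated by the partition of unity, which is why only differences
of coefficients multiply the two outer weights. -/
theorem bspline_eq_piece {k : ℕ} (hk : k < P.m) {s : ℝ} (hs : s ∈ Ico (P.x k) (P.x (k + 1)))
    (j : ℕ) : bspline P.knot 2 j s = P.piece (Pi.single j 1) k s := by
  obtain ⟨h1, h2, h3⟩ := P.knot_gap hk
  have n1 : P.knot (k + 3) - P.knot (k + 2) ≠ 0 := h1.ne'
  have n2 : P.knot (k + 4) - P.knot (k + 2) ≠ 0 := by linarith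
  have n3 : P.knot (k + 3) - P.knot (k + 1) ≠ 0 := by linarith
  have hone : ∀ i, bspline P.knot 1 i s =
      if i = k + 2 then (s - P.knot (k + 2)) / (P.knot (k + 3) - P.knot (k + 2))
      else if i = k + 1 then (P.knot (k + 3) - s) / (P.knot (k + 3) - P.knot (k + 2)) else 0 := by
    intro i
    rw [bspline_succ, P.bspline_zero hk hs, P.bspline_zero hk hs]
    by_cases c2 : i = k + 2
    · subst c2
      rw [if_pos rfl, if_neg (by omega), if_pos rfl]
      simp only [mul_one, mul_zero, add_zero]
    by_cases c1 : i = k + 1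
    · subst c1
      rw [if_neg (by omega), if_pos rfl, if_neg (by omega), if_pos rfl]
      simp only [mul_one, mul_zero, zero_add, Nat.add_zero]
    · rw [if_neg c2, if_neg (by omega), if_neg c2, if_neg c1]
      simp
  rw [bspline_succ, hone, hone]
  simp only [piece, Pi.single_apply]
  by_cases c2 : j = k + 2
  · subst c2
    rw [if_pos rfl, if_neg (show ¬ (k + 2 + 1 = k + 2) by omega), if_neg (show ¬ (k + 2 + 1 = k + 1) by omega),
      if_neg (show ¬ (k + 1 = k + 2) by omega), if_pos rfl, if_neg (show ¬ (k = k + 2) by omega)]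
    simp only [show k + 2 + 1 + 1 = k + 4 from rfl]
    field_simp
    ring
  by_cases c1 : j = k + 1
  · subst c1
    rw [if_neg (show ¬ (k + 1 = k + 2) by omega), if_pos rfl, if_pos rfl, if_pos rfl,
      if_neg (show ¬ (k + 2 = k + 1) by omega), if_neg (show ¬ (k = k + 1) by omega)]
    simp only [show k + 1 + 1 + 1 = k + 3 from rfl, show k + 1 + 1 + 2 = k + 4 from rfl,
      show k + 1 + 1 = k + 2 from rfl]
    field_simp
    ring
  by_cases c0 : j = k
  · subst c0
    rw [if_neg (show ¬ (j = j + 2) by omega), if_neg (show ¬ (j = j + 1) by omega),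
      if_neg (show ¬ (j + 1 = j + 2) by omega), if_pos rfl, if_neg (show ¬ (j + 1 = j) by omega),
      if_neg (show ¬ (j + 2 = j) by omega), if_pos rfl]
    simp only [show j + 1 + 2 = j + 3 from rfl]
    field_simp
    ring
  · rw [if_neg c2, if_neg c1, if_neg (by omega), if_neg (by omega), if_neg (by omega),
      if_neg (by omega), if_neg (by omega)]
    simp

/-- Interior knots are simple, so quadratic splines are `C¹` across them. -/
theorem piece_glue (c : ℕ → ℝ) {k : ℕ} (hk : k + 1 < P.m) :
    P.piece c k (P.x (k + 1)) = P.piece c (k + 1) (P.x (k + 1)) ∧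
      P.pieceDeriv c k (P.x (k + 1)) = P.pieceDeriv c (k + 1) (P.x (k + 1)) := by
  obtain ⟨h1, h2, h3⟩ := P.knot_gap (k := k) (by omega)
  obtain ⟨h1', h2', h3'⟩ := P.knot_gap hk
  have e : P.x (k + 1) = P.knot (k + 3) := (P.knot_add_two (k := k + 1) hk.le).symm
  simp only [show k + 1 + 3 = k + 4 from rfl, show k + 1 + 2 = k + 3 from rfl,
    show k + 1 + 4 = k + 5 from rfl, show k + 1 + 1 = k + 2 from rfl] at h1' h2' h3'
  have n1 : P.knot (k + 3) - P.knot (k + 2) ≠ 0 := h1.ne'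
  have n2 : P.knot (k + 4) - P.knot (k + 2) ≠ 0 := by linarith
  have n4 : P.knot (k + 4) - P.knot (k + 3) ≠ 0 := h1'.ne'
  constructor
  · simp only [piece, e, show k + 1 + 3 = k + 4 from rfl, show k + 1 + 2 = k + 3 from rfl,
      show k + 1 + 4 = k + 5 from rfl, show k + 1 + 1 = k + 2 from rfl, sub_self]
    field_simp
    ring
  · simp only [pieceDeriv, e, show k + 1 + 3 = k + 4 from rfl, show k + 1 + 2 = k + 3 from rfl,
      show k + 1 + 4 = k + 5 from rfl, show k + 1 + 1 = k + 2 from rfl, sub_self]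
    field_simp
    ring

theorem bspline_eq_piece' {k : ℕ} (hk : k < P.m) {s : ℝ} (hs : s ∈ Icc (P.x k) (P.x (k + 1)))
    (hs1 : s < 1) (j : ℕ) : bspline P.knot 2 j s = P.piece (Pi.single j 1) k s := by
  rcases hs.2.lt_or_eq with h | h
  · exact P.bspline_eq_piece hk ⟨hs.1, h⟩ j
  · have hk1 : k + 1 < P.m := by
      rcases Nat.lt_or_ge (k + 1) P.m with h' | h'
      · exact h'
      · have : k + 1 = P.m := by omega
        rw [h, this, P.x_last] at hs1
        exact absurd hs1 (lt_irrefl _)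
    rw [h, (P.piece_glue _ hk1).1]
    exact P.bspline_eq_piece hk1 ⟨le_rfl, P.lt _ _ (by omega) hk1⟩ j

theorem hasDerivAt_bspline {k : ℕ} (hk : k < P.m) {s : ℝ} (hs : s ∈ Ico (P.x k) (P.x (k + 1)))
    (hs0 : 0 < s) (j : ℕ) :
    HasDerivAt (bspline P.knot 2 j) (P.pieceDeriv (Pi.single j 1) k s) s := by
  rcases hs.1.lt_or_eq with h | h
  · refine (P.hasDerivAt_piece _ k s).congr_of_eventuallyEq ?_
    filter_upwards [Ioo_mem_nhds h hs.2] with y hy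
    exact P.bspline_eq_piece hk ⟨hy.1.le, hy.2⟩ j
  -- The point is an interior knot. The pieces on its two sides give the one-sided derivatives,
  -- which agree by `piece_glue`.
  · have hk0 : k ≠ 0 := by
      rintro rfl
      rw [P.x_zero] at h
      linarith
    obtain ⟨k, rfl⟩ := Nat.exists_eq_succ_of_ne_zero hk0
    simp only [Nat.succ_eq_add_one] at *
    have hlt := P.lt k (k + 1) (by omega) (by omega)
    have hs1 : s < 1 := lt_of_lt_of_le hs.2 (P.x_le_one (by omega))
    have hR : HasDerivWithinAt (bspline P.knot 2 j) (P.pieceDeriv (Pi.single j 1) (k + 1) s)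
        (Ici s) s := by
      refine (P.hasDerivAt_piece _ (k + 1) s).hasDerivWithinAt.congr_of_eventuallyEq ?_
        (P.bspline_eq_piece hk hs j)
      filter_upwards [mem_nhdsWithin_of_mem_nhds (Iio_mem_nhds hs.2), self_mem_nhdsWithin] with y h1 h2
      exact P.bspline_eq_piece hk ⟨hs.1.trans h2, h1⟩ j
    have hL : HasDerivWithinAt (bspline P.knot 2 j) (P.pieceDeriv (Pi.single j 1) (k + 1) s)
        (Iic s) s := by
      have : P.pieceDeriv (Pi.single j 1) (k + 1) s = P.pieceDeriv (Pi.single j 1) k s := by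
        rw [← h, (P.piece_glue _ hk).2]
      rw [this]
      refine (P.hasDerivAt_piece _ k s).hasDerivWithinAt.congr_of_eventuallyEq ?_
        (P.bspline_eq_piece' (by omega) ⟨by rw [← h]; exact hlt.le, h.symm.le⟩ hs1 j)
      filter_upwards [mem_nhdsWithin_of_mem_nhds (Ioi_mem_nhds (h ▸ hlt)), self_mem_nhdsWithin] with y h1 h2
      have h2' : y ≤ s := h2
      exact P.bspline_eq_piece' (by omega) ⟨(show P.x k < y from h1).le, h2'.trans h.symm.le⟩ (h2'.trans_lt hs1) j
    have := hL.union hR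
    rwa [Iic_union_Ici, hasDerivWithinAt_univ] at this

theorem deriv_bspline_eq {k : ℕ} (hk : k < P.m) {s : ℝ} (hs : s ∈ Icc (P.x k) (P.x (k + 1)))
    (hs01 : s ∈ Ioo (0 : ℝ) 1) (j : ℕ) :
    deriv (bspline P.knot 2 j) s = P.pieceDeriv (Pi.single j 1) k s := by
  rcases hs.2.lt_or_eq with h | h
  · exact (P.hasDerivAt_bspline hk ⟨hs.1, h⟩ hs01.1 j).deriv
  · have hk1 : k + 1 < P.m := by
      rcases Nat.lt_or_ge (k + 1) P.m with h' | h'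
      · exact h'
      · have : k + 1 = P.m := by omega
        have h1 := hs01.2
        rw [h, this, P.x_last] at h1
        exact absurd h1 (lt_irrefl _)
    have h2 := (P.hasDerivAt_bspline hk1 (s := s) ⟨h.symm.le, by
      rw [h]; exact P.lt _ _ (by omega) hk1⟩ hs01.1 j).deriv
    rw [h2, h, (P.piece_glue _ hk1).2]

theorem differentiableAt_bspline {s : ℝ} (hs : s ∈ Ioo (0 : ℝ) 1) (j : ℕ) :
    HasDerivAt (bspline P.knot 2 j) (deriv (bspline P.knot 2 j) s) s := by
  obtain ⟨k, hk, hks⟩ := P.exists_mem_Ico ⟨hs.1.le, hs.2⟩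
  exact (P.hasDerivAt_bspline hk hks hs.1 j).differentiableAt.hasDerivAt

theorem hasDerivAt_deriv_bspline {k : ℕ} (hk : k < P.m) {s : ℝ}
    (hs : s ∈ Ioo (P.x k) (P.x (k + 1))) (j : ℕ) :
    HasDerivAt (deriv (bspline P.knot 2 j)) (P.pieceDeriv2 (Pi.single j 1) k) s := by
  refine (P.hasDerivAt_pieceDeriv _ k s).congr_of_eventuallyEq ?_
  filter_upwards [Ioo_mem_nhds hs.1 hs.2] with y hy
  exact P.deriv_bspline_eq hk ⟨hy.1.le, hy.2.le⟩ ⟨(P.x_nonneg hk.le).trans_lt hy.1,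
    hy.2.trans_le (P.x_le_one hk)⟩ j

theorem locallyLipschitz_pieceDeriv (c : ℕ → ℝ) (k : ℕ) : LocallyLipschitz (P.pieceDeriv c k) := by
  refine ContDiff.locallyLipschitz (𝕂 := ℝ) ?_
  unfold pieceDeriv
  fun_prop

/-- The derivative is continuous and piecewise affine. Its local Lipschitz continuity is what lets
the weak second derivatives of splines be computed classically almost everywhere. -/
theorem locallyLipschitzOn_deriv_bspline (j : ℕ) :
    LocallyLipschitzOn (Ioo (0 : ℝ) 1) (deriv (bspline P.knot 2 j)) := by
  have key : ∀ s ∈ Ioo (0 : ℝ) 1, ∃ q : ℝ → ℝ, LocallyLipschitz q ∧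
      deriv (bspline P.knot 2 j) =ᶠ[𝓝 s] q := by
    intro s hs
    obtain ⟨k, hk, hks⟩ := P.exists_mem_Ico ⟨hs.1.le, hs.2⟩
    rcases hks.1.lt_or_eq with h | h
    · refine ⟨_, P.locallyLipschitz_pieceDeriv (Pi.single j 1) k, ?_⟩
      filter_upwards [Ioo_mem_nhds h hks.2, Ioo_mem_nhds hs.1 hs.2] with y hy hy'
      exact P.deriv_bspline_eq hk ⟨hy.1.le, hy.2.le⟩ hy' j
    · have hk0 : k ≠ 0 := by
        rintro rfl
        rw [P.x_zero] at h
        linarith [hs.1]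
      obtain ⟨k, rfl⟩ := Nat.exists_eq_succ_of_ne_zero hk0
      simp only [Nat.succ_eq_add_one] at *
      have hlt := P.lt k (k + 1) (by omega) (by omega)
      have hmin : LocallyLipschitz (fun y : ℝ => min y s) :=
        (LipschitzWith.id.min_const s).locallyLipschitz
      have hmax : LocallyLipschitz (fun y : ℝ => max y s) :=
        (LipschitzWith.id.max_const s).locallyLipschitz
      -- Near a knot `s` the two affine pieces are joined into one function by freezing each of them
      -- beyond `s` with `min` and `max`; the common value at `s`, counted twice, is subtracted.
      refine ⟨fun y => P.pieceDeriv (Pi.single j 1) k (min y s) +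
        P.pieceDeriv (Pi.single j 1) (k + 1) (max y s) +
          (-P.pieceDeriv (Pi.single j 1) (k + 1) s),
        (((P.locallyLipschitz_pieceDeriv _ k).comp hmin).add
        ((P.locallyLipschitz_pieceDeriv _ (k + 1)).comp hmax)).add (LocallyLipschitz.const _), ?_⟩
      filter_upwards [Ioo_mem_nhds (h ▸ hlt : P.x k < s) hks.2, Ioo_mem_nhds hs.1 hs.2] with y hy hy'
      rcases le_total y s with hys | hys
      · rw [P.deriv_bspline_eq (k := k) (by omega) ⟨hy.1.le, hys.trans h.symm.le⟩ hy' j]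
        simp [min_eq_left hys, max_eq_right hys]
      · have e : P.pieceDeriv (Pi.single j 1) (k + 1) s = P.pieceDeriv (Pi.single j 1) k s := by
          rw [← h, (P.piece_glue _ hk).2]
        rw [P.deriv_bspline_eq hk ⟨hks.1.trans hys, hy.2.le⟩ hy' j]
        simp [min_eq_right hys, max_eq_left hys, e]
  intro s hs
  obtain ⟨q, hq, hqe⟩ := key s hs
  obtain ⟨K, t, ht, hK⟩ := hq s
  refine ⟨K, t ∩ {y | deriv (bspline P.knot 2 j) y = q y},
    mem_nhdsWithin_of_mem_nhds (inter_mem ht hqe), ?_⟩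
  intro y hy z hz
  rw [show deriv (bspline P.knot 2 j) y = q y from hy.2,
    show deriv (bspline P.knot 2 j) z = q z from hz.2]
  exact hK hy.1 hz.1

end UnitPartition

/-! ### Polynomial reproduction and inverse estimates for univariate splines -/

namespace UnitPartition

variable (P : UnitPartition)

/-- All elements of the partition have length between `c * H` and `H`. -/
def IsQuasiUniform (c H : ℝ) : Prop :=
  ∀ k < P.m, c * H ≤ P.x (k + 1) - P.x k ∧ P.x (k + 1) - P.x k ≤ H

/-- The `j`-th quadratic B-spline and its iterated derivatives. -/
noncomputable def jet (j r : ℕ) : ℝ → ℝ := deriv^[r] (bspline P.knot 2 j)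

variable {P}

theorem sum_mul_bspline (c : ℕ → ℝ) {k : ℕ} (hk : k < P.m) {s : ℝ}
    (hs : s ∈ Ico (P.x k) (P.x (k + 1))) :
    ∑ j ∈ Finset.range (P.m + 2), c j * P.jet j 0 s = P.piece c k s := by
  have hsub : ({k, k + 1, k + 2} : Finset ℕ) ⊆ Finset.range (P.m + 2) := by
    intro j hj
    simp only [Finset.mem_insert, Finset.mem_singleton] at hj
    rw [Finset.mem_range]
    omega
  rw [← Finset.sum_subset hsub]
  · rw [Finset.sum_insert (by simp), Finset.sum_insert (by simp), Finset.sum_singleton]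
    simp only [jet, Function.iterate_zero, id_eq, P.bspline_eq_piece hk hs]
    simp only [piece, Pi.single_apply, Nat.add_eq_left, Nat.left_eq_add, Nat.add_left_cancel_iff]
    norm_num
    ring
  · intro j _ hj
    simp only [Finset.mem_insert, Finset.mem_singleton, not_or] at hj
    simp only [jet, Function.iterate_zero, id_eq, P.bspline_eq_piece hk hs, piece, Pi.single_apply]
    rw [if_neg (by omega), if_neg (by omega), if_neg (by omega)]
    simp

theorem sum_bspline {s : ℝ} (hs : s ∈ Ioo (0 : ℝ) 1) :
    ∑ j ∈ Finset.range (P.m + 2), P.jet j 0 s = 1 := by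
  obtain ⟨k, hk, hks⟩ := P.exists_mem_Ico ⟨hs.1.le, hs.2⟩
  have := sum_mul_bspline (fun _ => 1) hk hks
  simpa [piece] using this

/-- Marsden's identity: the coefficient of a quadratic polynomial is its polar form at the two
interior knots of the B-spline. For `s - z` this is the mean of the two factors, for `(s - z)²`
their product. -/
theorem sum_greville_mul_bspline (z : ℝ) {s : ℝ} (hs : s ∈ Ioo (0 : ℝ) 1) :
    ∑ j ∈ Finset.range (P.m + 2), ((P.knot (j + 1) + P.knot (j + 2)) / 2 - z) * P.jet j 0 s =
      s - z := by
  obtain ⟨k, hk, hks⟩ := P.exists_mem_Ico ⟨hs.1.le, hs.2⟩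
  obtain ⟨h1, h2, h3⟩ := P.knot_gap hk
  rw [sum_mul_bspline (fun j => (P.knot (j + 1) + P.knot (j + 2)) / 2 - z) hk hks]
  have n1 : P.knot (k + 3) - P.knot (k + 2) ≠ 0 := h1.ne'
  have n2 : P.knot (k + 4) - P.knot (k + 2) ≠ 0 := by linarith
  have n3 : P.knot (k + 3) - P.knot (k + 1) ≠ 0 := by linarith
  simp only [piece, show k + 1 + 1 = k + 2 from rfl, show k + 1 + 2 = k + 3 from rfl,
    show k + 2 + 2 = k + 4 from rfl]
  field_simp
  ring

theorem sum_blossom_mul_bspline (z : ℝ) {s : ℝ} (hs : s ∈ Ioo (0 : ℝ) 1) :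
    ∑ j ∈ Finset.range (P.m + 2), ((P.knot (j + 1) - z) * (P.knot (j + 2) - z)) * P.jet j 0 s =
      (s - z) ^ 2 := by
  obtain ⟨k, hk, hks⟩ := P.exists_mem_Ico ⟨hs.1.le, hs.2⟩
  obtain ⟨h1, h2, h3⟩ := P.knot_gap hk
  rw [sum_mul_bspline (fun j => (P.knot (j + 1) - z) * (P.knot (j + 2) - z)) hk hks]
  have n1 : P.knot (k + 3) - P.knot (k + 2) ≠ 0 := h1.ne'
  have n2 : P.knot (k + 4) - P.knot (k + 2) ≠ 0 := by linarith
  have n3 : P.knot (k + 3) - P.knot (k + 1) ≠ 0 := by linarith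
  simp only [piece, show k + 1 + 1 = k + 2 from rfl, show k + 1 + 2 = k + 3 from rfl,
    show k + 2 + 2 = k + 4 from rfl]
  field_simp
  ring

theorem hasDerivAt_jet_zero (j : ℕ) {s : ℝ} (hs : s ∈ Ioo (0 : ℝ) 1) :
    HasDerivAt (P.jet j 0) (P.jet j 1 s) s :=
  P.differentiableAt_bspline hs j

theorem hasDerivAt_jet_one (j : ℕ) {s : ℝ} (hs : s ∈ Ioo (0 : ℝ) 1)
    (hoff : ∀ k ≤ P.m, s ≠ P.x k) : HasDerivAt (P.jet j 1) (P.jet j 2 s) s := by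
  obtain ⟨k, hk, hks⟩ := P.exists_mem_Ico ⟨hs.1.le, hs.2⟩
  have h := P.hasDerivAt_deriv_bspline hk (s := s) ⟨hks.1.lt_of_ne (hoff k hk.le).symm, hks.2⟩ j
  exact h.differentiableAt.hasDerivAt

theorem jet_eq {k : ℕ} (hk : k < P.m) {s : ℝ} (hs : s ∈ Ico (P.x k) (P.x (k + 1)))
    (hs0 : 0 < s) (j : ℕ) : P.jet j 0 s = P.piece (Pi.single j 1) k s ∧
      P.jet j 1 s = P.pieceDeriv (Pi.single j 1) k s :=
  ⟨P.bspline_eq_piece hk hs j, (P.hasDerivAt_bspline hk hs hs0 j).deriv⟩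

theorem jet_two_eq {k : ℕ} (hk : k < P.m) {s : ℝ} (hs : s ∈ Ioo (P.x k) (P.x (k + 1))) (j : ℕ) :
    P.jet j 2 s = P.pieceDeriv2 (Pi.single j 1) k :=
  (P.hasDerivAt_deriv_bspline hk hs j).deriv

theorem abs_single_sub_le (j a b : ℕ) :
    |(Pi.single j (1 : ℝ) : ℕ → ℝ) a - (Pi.single j (1 : ℝ) : ℕ → ℝ) b| ≤ 1 := by
  simp only [Pi.single_apply]
  split_ifs <;> norm_num

theorem quotients_bounds {k : ℕ} (hk : k < P.m) {s : ℝ} (hs : s ∈ Ico (P.x k) (P.x (k + 1)))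
    {c H : ℝ} (hP : P.IsQuasiUniform c H) :
    (P.knot (k + 2) ≤ s ∧ s < P.knot (k + 3)) ∧
    c * H ≤ P.knot (k + 3) - P.knot (k + 2) ∧
    P.knot (k + 3) - P.knot (k + 2) ≤ P.knot (k + 4) - P.knot (k + 2) ∧
    P.knot (k + 3) - P.knot (k + 2) ≤ P.knot (k + 3) - P.knot (k + 1) := by
  obtain ⟨h1, h2, h3⟩ := P.knot_gap hk
  have e2 := P.knot_add_two hk.le
  have e3 : P.knot (k + 3) = P.x (k + 1) := P.knot_add_two (k := k + 1) hk
  refine ⟨⟨e2 ▸ hs.1, e3 ▸ hs.2⟩, ?_, by linarith, by linarith⟩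
  rw [e2, e3]
  exact (hP k hk).1

theorem bspline_mem_Icc (j : ℕ) {s : ℝ} (hs : s ∈ Ioo (0 : ℝ) 1) :
    P.jet j 0 s ∈ Icc (0 : ℝ) 1 := by
  obtain ⟨k, hk, hks⟩ := P.exists_mem_Ico ⟨hs.1.le, hs.2⟩
  obtain ⟨h1, h2, h3⟩ := P.knot_gap hk
  have e2 : P.knot (k + 2) ≤ s := P.knot_add_two hk.le ▸ hks.1
  have e3 : s < P.knot (k + 3) := (P.knot_add_two (k := k + 1) hk).symm ▸ hks.2
  rw [(jet_eq hk hks hs.1 j).1]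
  -- `A` and `B` are the weights of the two outer B-splines. Each is at most a barycentric
  -- coordinate of `s` in the element, so the middle weight `1 - A - B` is nonnegative.
  set A := (s - P.knot (k + 2)) ^ 2 /
      ((P.knot (k + 4) - P.knot (k + 2)) * (P.knot (k + 3) - P.knot (k + 2))) with hA
  set B := (P.knot (k + 3) - s) ^ 2 /
      ((P.knot (k + 3) - P.knot (k + 1)) * (P.knot (k + 3) - P.knot (k + 2))) with hB
  have hA0 : 0 ≤ A := by
    rw [hA]
    exact div_nonneg (sq_nonneg _) (mul_nonneg (by linarith) h1.le)
  have hB0 : 0 ≤ B := by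
    rw [hB]
    exact div_nonneg (sq_nonneg _) (mul_nonneg (by linarith) h1.le)
  have hA' : A ≤ (s - P.knot (k + 2)) / (P.knot (k + 3) - P.knot (k + 2)) := by
    rw [hA, div_le_div_iff₀ (mul_pos (by linarith) h1) h1]
    have : 0 ≤ (s - P.knot (k + 2)) * (P.knot (k + 3) - P.knot (k + 2)) *
      ((P.knot (k + 4) - P.knot (k + 2)) - (s - P.knot (k + 2))) :=
      mul_nonneg (mul_nonneg (by linarith) h1.le) (by linarith)
    linarith
  have hB' : B ≤ (P.knot (k + 3) - s) / (P.knot (k + 3) - P.knot (k + 2)) := by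
    rw [hB, div_le_div_iff₀ (mul_pos (by linarith) h1) h1]
    have : 0 ≤ (P.knot (k + 3) - s) * (P.knot (k + 3) - P.knot (k + 2)) *
      ((P.knot (k + 3) - P.knot (k + 1)) - (P.knot (k + 3) - s)) :=
      mul_nonneg (mul_nonneg (by linarith) h1.le) (by linarith)
    linarith
  have hsum : (s - P.knot (k + 2)) / (P.knot (k + 3) - P.knot (k + 2)) +
      (P.knot (k + 3) - s) / (P.knot (k + 3) - P.knot (k + 2)) = 1 := by
    field_simp
    ring
  have hpiece : P.piece (Pi.single j 1) k s = (Pi.single j (1 : ℝ) : ℕ → ℝ) (k + 1) * (1 - A - B) +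
      (Pi.single j (1 : ℝ) : ℕ → ℝ) (k + 2) * A + (Pi.single j (1 : ℝ) : ℕ → ℝ) k * B := by
    simp only [piece, ← hA, ← hB]
    ring
  rw [hpiece]
  simp only [Pi.single_apply]
  constructor <;> split_ifs <;> (try omega) <;> norm_num <;> linarith

/-- Inverse estimate: each derivative costs a factor `4 / (c * H)`. For the first derivative, each
outer weight contributes `2 / (c * H)`. The bounds are powers of one base so that they multiply in
tensor products; second derivatives exist only off the knots. -/
theorem abs_jet_le {c H : ℝ} (hc : 0 < c) (hH : 0 < H) (hP : P.IsQuasiUniform c H) (j : ℕ)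
    {s : ℝ} (hs : s ∈ Ioo (0 : ℝ) 1) :
    |P.jet j 0 s| ≤ (4 / (c * H)) ^ 0 ∧ |P.jet j 1 s| ≤ (4 / (c * H)) ^ 1 ∧
      ((∀ k ≤ P.m, s ≠ P.x k) → |P.jet j 2 s| ≤ (4 / (c * H)) ^ 2) := by
  have h0 := P.bspline_mem_Icc j hs
  obtain ⟨k, hk, hks⟩ := P.exists_mem_Ico ⟨hs.1.le, hs.2⟩
  obtain ⟨⟨ha, hb⟩, hg, hg2, hg3⟩ := quotients_bounds hk hks hP
  have hcH : 0 < c * H := mul_pos hc hH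
  have hpos := hcH.trans_le hg
  refine ⟨?_, ?_, fun hoff => ?_⟩
  · rw [abs_of_nonneg h0.1, pow_zero]
    exact h0.2
  · have q1 : |2 * (s - P.knot (k + 2)) /
        ((P.knot (k + 4) - P.knot (k + 2)) * (P.knot (k + 3) - P.knot (k + 2)))| ≤ 2 / (c * H) := by
      rw [abs_of_nonneg (by apply div_nonneg <;> [linarith; exact mul_nonneg (by linarith) hpos.le]),
        div_le_div_iff₀ (mul_pos (by linarith) hpos) hcH, mul_assoc]
      refine mul_le_mul_of_nonneg_left ?_ (by norm_num)
      rw [mul_comm]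
      exact mul_le_mul (by linarith) (by linarith) (by linarith) (by linarith)
    have q2 : |2 * (P.knot (k + 3) - s) /
        ((P.knot (k + 3) - P.knot (k + 1)) * (P.knot (k + 3) - P.knot (k + 2)))| ≤ 2 / (c * H) := by
      rw [abs_of_nonneg (by apply div_nonneg <;> [linarith; exact mul_nonneg (by linarith) hpos.le]),
        div_le_div_iff₀ (mul_pos (by linarith) hpos) hcH, mul_assoc]
      refine mul_le_mul_of_nonneg_left ?_ (by norm_num)
      rw [mul_comm]
      exact mul_le_mul (by linarith) (by linarith) (by linarith) (by linarith)
    rw [(jet_eq hk hks hs.1 j).2, pieceDeriv, pow_one]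
    refine (abs_sub _ _).trans ?_
    rw [abs_mul, abs_mul]
    have r1 := mul_le_mul (abs_single_sub_le j (k + 2) (k + 1)) q1 (abs_nonneg _) zero_le_one
    have r2 := mul_le_mul (abs_single_sub_le j k (k + 1)) q2 (abs_nonneg _) zero_le_one
    have : 4 / (c * H) = 1 * (2 / (c * H)) + 1 * (2 / (c * H)) := by ring
    rw [this]
    exact add_le_add r1 r2
  · have q1 : |2 / ((P.knot (k + 4) - P.knot (k + 2)) * (P.knot (k + 3) - P.knot (k + 2)))| ≤
        2 / (c * H) ^ 2 := by
      rw [abs_of_nonneg (div_nonneg zero_le_two (mul_nonneg (by linarith) hpos.le)), sq]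
      gcongr <;> linarith
    have q2 : |2 / ((P.knot (k + 3) - P.knot (k + 1)) * (P.knot (k + 3) - P.knot (k + 2)))| ≤
        2 / (c * H) ^ 2 := by
      rw [abs_of_nonneg (div_nonneg zero_le_two (mul_nonneg (by linarith) hpos.le)), sq]
      gcongr <;> linarith
    rw [jet_two_eq hk ⟨hks.1.lt_of_ne (hoff k hk.le).symm, hks.2⟩ j, pieceDeriv2]
    refine (abs_add_le _ _).trans ?_
    rw [abs_mul, abs_mul]
    have r1 := mul_le_mul (abs_single_sub_le j (k + 2) (k + 1)) q1 (abs_nonneg _) zero_le_one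
    have r2 := mul_le_mul (abs_single_sub_le j k (k + 1)) q2 (abs_nonneg _) zero_le_one
    refine (add_le_add r1 r2).trans ?_
    rw [div_pow]
    have : 0 ≤ 1 / (c * H) ^ 2 := by positivity
    have e : (4 : ℝ) ^ 2 / (c * H) ^ 2 - (1 * (2 / (c * H) ^ 2) + 1 * (2 / (c * H) ^ 2)) =
      12 * (1 / (c * H) ^ 2) := by ring
    linarith

theorem jet_eq_zero_of_inactive {k : ℕ} (hk : k < P.m) {s : ℝ}
    (hs : s ∈ Ico (P.x k) (P.x (k + 1))) (hs0 : s ∈ Ioo (0 : ℝ) 1) {j : ℕ}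
    (hj : j ∉ ({k, k + 1, k + 2} : Finset ℕ)) :
    P.jet j 0 s = 0 ∧ P.jet j 1 s = 0 ∧ ((∀ k ≤ P.m, s ≠ P.x k) → P.jet j 2 s = 0) := by
  simp only [Finset.mem_insert, Finset.mem_singleton, not_or] at hj
  have e0 : (Pi.single j (1 : ℝ) : ℕ → ℝ) k = 0 := by simp [Pi.single_apply]; omega
  have e1 : (Pi.single j (1 : ℝ) : ℕ → ℝ) (k + 1) = 0 := by simp [Pi.single_apply]; omega
  have e2 : (Pi.single j (1 : ℝ) : ℕ → ℝ) (k + 2) = 0 := by simp [Pi.single_apply]; omega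
  refine ⟨?_, ?_, fun hoff => ?_⟩
  · rw [(jet_eq hk hs hs0.1 j).1, piece, e0, e1, e2]; simp
  · rw [(jet_eq hk hs hs0.1 j).2, pieceDeriv, e0, e1, e2]; simp
  · rw [jet_two_eq hk ⟨hs.1.lt_of_ne (hoff k hk.le).symm, hs.2⟩ j, pieceDeriv2, e0, e1, e2]; simp

theorem knot_near {c H : ℝ} (hH : 0 < H) (hP : P.IsQuasiUniform c H) {k : ℕ}
    (hk : k < P.m) {s : ℝ} (hs : s ∈ Ico (P.x k) (P.x (k + 1))) {j : ℕ}
    (hj : j ∈ ({k, k + 1, k + 2} : Finset ℕ)) :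
    |P.knot (j + 1) - s| ≤ 2 * H ∧ |P.knot (j + 2) - s| ≤ 2 * H := by
  -- Repeated end knots have gap zero, so the bound holds for every index.
  have hstep : ∀ i, P.knot (i + 1) - P.knot i ≤ H := by
    intro i
    unfold knot
    rcases Nat.lt_or_ge i 2 with h | h
    · have e1 : i + 1 - 2 = i - 2 := by omega
      rw [e1]
      linarith
    · obtain ⟨i, rfl⟩ := Nat.exists_eq_add_of_le' h
      simp only [Nat.add_sub_cancel, show i + 2 + 1 - 2 = i + 1 by omega]
      rcases Nat.lt_or_ge i P.m with h' | h'
      · rw [min_eq_left h'.le, min_eq_left (by omega)]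
        exact (hP i h').2
      · rw [min_eq_right h', min_eq_right (by omega)]
        linarith
  have e2 : P.knot (k + 2) ≤ s := P.knot_add_two hk.le ▸ hs.1
  have e3 : s < P.knot (k + 3) := (P.knot_add_two (k := k + 1) hk).symm ▸ hs.2
  have m1 := P.knot_mono (show k + 1 ≤ k + 2 by omega)
  have m2 := P.knot_mono (show k + 2 ≤ k + 3 by omega)
  have m3 := P.knot_mono (show k + 3 ≤ k + 4 by omega)
  have s1 : P.knot (k + 2) - P.knot (k + 1) ≤ H := hstep (k + 1)
  have s2 : P.knot (k + 3) - P.knot (k + 2) ≤ H := hstep (k + 2)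
  have s3 : P.knot (k + 4) - P.knot (k + 3) ≤ H := hstep (k + 3)
  have all : ∀ i ∈ ({k + 1, k + 2, k + 3, k + 4} : Finset ℕ), |P.knot i - s| ≤ 2 * H := by
    intro i hi
    simp only [Finset.mem_insert, Finset.mem_singleton] at hi
    rw [abs_le]
    rcases hi with rfl | rfl | rfl | rfl <;> constructor <;> linarith
  simp only [Finset.mem_insert, Finset.mem_singleton] at hj
  constructor <;> apply all <;> simp only [Finset.mem_insert, Finset.mem_singleton] <;> omega

end UnitPartition

/-! ### Tensor product splines -/

namespace TensorMesh

variable (M : TensorMesh)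

/-- Indices of the tensor product B-splines. -/
def idx : Finset (Fin 3 → ℕ) := Fintype.piFinset fun a => Finset.range ((M a).m + 2)

/-- Partial derivative of order `r` of the `j`-th B-spline. -/
noncomputable def basisJet (j r : Fin 3 → ℕ) (y : E3) : ℝ := ∏ a, (M a).jet (j a) (r a) (y a)

/-- Partial derivative of order `r` of the spline with coefficients `c`. -/
noncomputable def splineJet (c : (Fin 3 → ℕ) → ℝ) (r : Fin 3 → ℕ) (y : E3) : ℝ :=
  ∑ j ∈ M.idx, c j * M.basisJet j r y

/-- The Greville point of index `j`. -/
noncomputable def greville (j : Fin 3 → ℕ) : E3 :=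
  WithLp.toLp 2 fun a => ((M a).knot (j a + 1) + (M a).knot (j a + 2)) / 2

/-- The Greville point with one coordinate moved to a knot. -/
noncomputable def stencil (j : Fin 3 → ℕ) (a : Fin 3) (i : ℕ) : E3 :=
  WithLp.toLp 2 fun b => if b = a then (M a).knot (j a + i) else M.greville j b

/-- The quasi-interpolation functional of index `j`, exact on quadratic polynomials. -/
noncomputable def quasi (V : E3 → ℝ) (j : Fin 3 → ℕ) : ℝ :=
  4 * V (M.greville j) - 1 / 2 * ∑ a, (V (M.stencil j a 1) + V (M.stencil j a 2))

/-- `y` does not lie on a mesh plane. -/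
def OffMesh (y : E3) : Prop := ∀ a, ∀ k ≤ (M a).m, y a ≠ (M a).x k

/-- All edges have length between `c * H` and `H`. -/
def IsQuasiUniform (c H : ℝ) : Prop := ∀ a, (M a).IsQuasiUniform c H

/-- The knots of index `j` are within distance `2 * H` of `y` in every direction. -/
def IsNear (H : ℝ) (y : E3) (j : Fin 3 → ℕ) : Prop :=
  ∀ a, |(M a).knot (j a + 1) - y a| ≤ 2 * H ∧ |(M a).knot (j a + 2) - y a| ≤ 2 * H

variable {M}

theorem splineJet_zero_mem_splineV (c : (Fin 3 → ℕ) → ℝ) (G : E3 → E3) :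
    (fun x => M.splineJet c 0 (G x)) ∈ splineV M G := by
  have : (fun x => M.splineJet c 0 (G x)) =
      ∑ j ∈ M.idx, c j • (fun x => M.basisFun j (G x)) := by
    ext x
    simp [splineJet, basisJet, basisFun, UnitPartition.jet]
  rw [this]
  refine Submodule.sum_mem _ fun j hj => Submodule.smul_mem _ _ (Submodule.subset_span ⟨j, ?_, rfl⟩)
  intro a
  simpa [idx] using (Fintype.mem_piFinset.1 hj a)

theorem sum_prod_mul_basisJet (φ₀ φ₁ φ₂ : ℕ → ℝ) (y : E3) :
    ∑ j ∈ M.idx, (φ₀ (j 0) * φ₁ (j 1) * φ₂ (j 2)) * M.basisJet j 0 y =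
      (∑ i ∈ Finset.range ((M 0).m + 2), φ₀ i * (M 0).jet i 0 (y 0)) *
      (∑ i ∈ Finset.range ((M 1).m + 2), φ₁ i * (M 1).jet i 0 (y 1)) *
      (∑ i ∈ Finset.range ((M 2).m + 2), φ₂ i * (M 2).jet i 0 (y 2)) := by
  have h := Finset.prod_univ_sum (fun a => Finset.range ((M a).m + 2))
    (fun a i => (![φ₀, φ₁, φ₂] a) i * (M a).jet i 0 (y a))
  rw [Fin.prod_univ_three] at h
  simp only [Matrix.cons_val] at h
  rw [h]
  refine Finset.sum_congr rfl fun j _ => ?_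
  simp only [basisJet, Fin.prod_univ_three, Matrix.cons_val, Pi.zero_apply]
  ring

/-- A quadratic polynomial in Taylor form at `z`. -/
noncomputable def quadPoly (A : ℝ) (Λ : E3 →L[ℝ] ℝ) (B : E3 →L[ℝ] E3 →L[ℝ] ℝ) (z y : E3) : ℝ :=
  A + Λ (y - z) + B (y - z) (y - z)

theorem eq_sum_single (v : E3) :
    v = v 0 • EuclideanSpace.single 0 (1 : ℝ) + v 1 • EuclideanSpace.single 1 (1 : ℝ) +
      v 2 • EuclideanSpace.single 2 (1 : ℝ) := by
  ext j
  fin_cases j <;> simp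

theorem quadPoly_eq (A : ℝ) (Λ : E3 →L[ℝ] ℝ) (B : E3 →L[ℝ] E3 →L[ℝ] ℝ) :
    ∃ l : Fin 3 → ℝ, ∃ b : Fin 3 → Fin 3 → ℝ, ∀ z y, quadPoly A Λ B z y =
      A + (l 0 * (y 0 - z 0) + l 1 * (y 1 - z 1) + l 2 * (y 2 - z 2)) +
      (b 0 0 * (y 0 - z 0) ^ 2 + b 1 1 * (y 1 - z 1) ^ 2 + b 2 2 * (y 2 - z 2) ^ 2 +
       b 0 1 * ((y 0 - z 0) * (y 1 - z 1)) + b 0 2 * ((y 0 - z 0) * (y 2 - z 2)) +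
       b 1 2 * ((y 1 - z 1) * (y 2 - z 2))) := by
  set e : Fin 3 → E3 := fun i => EuclideanSpace.single i (1 : ℝ) with he
  refine ⟨fun i => Λ (e i), fun i j => if i = j then B (e i) (e j) else
    B (e i) (e j) + B (e j) (e i), fun z y => ?_⟩
  have h := eq_sum_single (y - z)
  unfold quadPoly
  rw [h]
  simp only [map_add, map_smul, add_apply, smul_apply,
    smul_eq_mul, he, PiLp.sub_apply]
  simp
  ring

/-- In each direction, half the sum of the two stencil values is the Greville value plus the squared
half-distance of the knots times the pure second coefficient. Subtracting this correction turns the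
squared Greville abscissa into the product of the two knots, the coefficient required by Marsden's
identity. Affine and mixed terms are unaffected. The tensor sums then factor into univariate ones.
-/
theorem splineJet_quasi_quadPoly (A : ℝ) (Λ : E3 →L[ℝ] ℝ) (B : E3 →L[ℝ] E3 →L[ℝ] ℝ) (z : E3)
    {y : E3} (hy : y ∈ patch) :
    M.splineJet (M.quasi (quadPoly A Λ B z)) 0 y = quadPoly A Λ B z y := by
  obtain ⟨l, b, hlb⟩ := quadPoly_eq A Λ B
  set α : Fin 3 → ℕ → ℝ := fun a i => ((M a).knot (i + 1) + (M a).knot (i + 2)) / 2 - z a with hα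
  set β : Fin 3 → ℕ → ℝ := fun a i => ((M a).knot (i + 1) - z a) * ((M a).knot (i + 2) - z a) with hβ
  -- The constant sequence one is kept opaque so that every term stays a product of three univariate
  -- sequences, as `sum_prod_mul_basisJet` requires.
  obtain ⟨u, hu⟩ : ∃ u : ℕ → ℝ, ∀ i, u i = 1 := ⟨fun _ => 1, fun _ => rfl⟩
  have key : ∀ j, M.quasi (quadPoly A Λ B z) j =
      A * (u (j 0) * u (j 1) * u (j 2)) + l 0 * (α 0 (j 0) * u (j 1) * u (j 2)) +
      l 1 * (u (j 0) * α 1 (j 1) * u (j 2)) +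
      l 2 * (u (j 0) * u (j 1) * α 2 (j 2)) + b 0 0 * (β 0 (j 0) * u (j 1) * u (j 2)) +
      b 1 1 * (u (j 0) * β 1 (j 1) * u (j 2)) +
      b 2 2 * (u (j 0) * u (j 1) * β 2 (j 2)) + b 0 1 * (α 0 (j 0) * α 1 (j 1) * u (j 2)) +
      b 0 2 * (α 0 (j 0) * u (j 1) * α 2 (j 2)) + b 1 2 * (u (j 0) * α 1 (j 1) * α 2 (j 2)) := by
    intro j
    simp only [quasi, hlb, Fin.sum_univ_three, stencil, greville, hα, hβ, hu]
    simp
    ring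
  have s0 : ∀ a, ∑ i ∈ Finset.range ((M a).m + 2), u i * (M a).jet i 0 (y a) = 1 := fun a => by
    simpa [hu] using (M a).sum_bspline (hy a)
  have s1 : ∀ a, ∑ i ∈ Finset.range ((M a).m + 2), α a i * (M a).jet i 0 (y a) = y a - z a :=
    fun a => (M a).sum_greville_mul_bspline (z a) (hy a)
  have s2 : ∀ a, ∑ i ∈ Finset.range ((M a).m + 2), β a i * (M a).jet i 0 (y a) = (y a - z a) ^ 2 :=
    fun a => (M a).sum_blossom_mul_bspline (z a) (hy a)
  have m0 := fun (φ₀ φ₁ φ₂ : ℕ → ℝ) => M.sum_prod_mul_basisJet φ₀ φ₁ φ₂ y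
  unfold splineJet
  simp only [key, add_mul, Finset.sum_add_distrib, mul_assoc (b _ _), mul_assoc (l _), mul_assoc A,
    ← Finset.mul_sum]
  rw [m0 u u u, m0 (α 0) u u, m0 u (α 1) u, m0 u u (α 2), m0 (β 0) u u, m0 u (β 1) u,
    m0 u u (β 2), m0 (α 0) (α 1) u, m0 (α 0) u (α 2), m0 u (α 1) (α 2)]
  simp only [s0, s1, s2, hlb]
  ring

theorem hasFDerivAt_basisJet (j r : Fin 3 → ℕ) {y : E3}
    (h : ∀ a, HasDerivAt ((M a).jet (j a) (r a)) ((M a).jet (j a) (r a + 1) (y a)) (y a)) :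
    HasFDerivAt (M.basisJet j r)
      (∑ a, M.basisJet j (r + Pi.single a 1) y • (EuclideanSpace.proj a : E3 →L[ℝ] ℝ)) y := by
  have hp : ∀ a, HasFDerivAt (fun y : E3 => (M a).jet (j a) (r a) (y a))
      ((M a).jet (j a) (r a + 1) (y a) • (EuclideanSpace.proj a : E3 →L[ℝ] ℝ)) y := fun a =>
    (h a).comp_hasFDerivAt y (EuclideanSpace.proj a : E3 →L[ℝ] ℝ).hasFDerivAt
  have hfun : M.basisJet j r = fun y => (M 0).jet (j 0) (r 0) (y 0) * (M 1).jet (j 1) (r 1) (y 1) *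
      (M 2).jet (j 2) (r 2) (y 2) := by
    ext y
    simp [basisJet, Fin.prod_univ_three]
  rw [hfun]
  refine (((hp 0).mul (hp 1)).mul (hp 2)).congr_fderiv ?_
  ext v
  simp only [Fin.sum_univ_three, basisJet, Fin.prod_univ_three, Pi.add_apply]
  simp
  ring

theorem hasFDerivAt_splineJet (c : (Fin 3 → ℕ) → ℝ) (r : Fin 3 → ℕ) {y : E3}
    (h : ∀ j a, HasDerivAt ((M a).jet j (r a)) ((M a).jet j (r a + 1) (y a)) (y a)) :
    HasFDerivAt (M.splineJet c r)
      (∑ a, M.splineJet c (r + Pi.single a 1) y • (EuclideanSpace.proj a : E3 →L[ℝ] ℝ)) y := by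
  have := HasFDerivAt.fun_sum (u := M.idx) fun j _ =>
    (M.hasFDerivAt_basisJet j r fun a => h (j a) a).const_mul (c j)
  refine this.congr_fderiv ?_
  ext v
  simp only [splineJet, Fin.sum_univ_three, sum_apply,
    smul_apply, add_apply, smul_eq_mul, Finset.sum_mul,
    mul_add, Finset.sum_add_distrib]
  simp only [mul_assoc]

theorem hasFDerivAt_splineJet_zero (c : (Fin 3 → ℕ) → ℝ) {y : E3} (hy : y ∈ patch) :
    HasFDerivAt (M.splineJet c 0)
      (∑ a, M.splineJet c (Pi.single a 1) y • (EuclideanSpace.proj a : E3 →L[ℝ] ℝ)) y := by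
  have := M.hasFDerivAt_splineJet c 0 (y := y)
    (fun j a => (M a).hasDerivAt_jet_zero j (hy a))
  simpa using this

theorem hasFDerivAt_splineJet_single (c : (Fin 3 → ℕ) → ℝ) {y : E3} (hy : y ∈ patch)
    (hoff : M.OffMesh y) (b : Fin 3) :
    HasFDerivAt (M.splineJet c (Pi.single b 1))
      (∑ a, M.splineJet c (Pi.single b 1 + Pi.single a 1) y •
        (EuclideanSpace.proj a : E3 →L[ℝ] ℝ)) y := by
  refine M.hasFDerivAt_splineJet c (Pi.single b 1) (y := y) fun j a => ?_
  by_cases hab : a = b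
  · subst hab
    rw [Pi.single_eq_same]
    exact (M a).hasDerivAt_jet_one j (hy a) (hoff a)
  · rw [Pi.single_eq_of_ne hab]
    exact (M a).hasDerivAt_jet_zero j (hy a)

theorem splineJet_sub (c d : (Fin 3 → ℕ) → ℝ) (r : Fin 3 → ℕ) (y : E3) :
    M.splineJet (c - d) r y = M.splineJet c r y - M.splineJet d r y := by
  simp [splineJet, sub_mul, Finset.sum_sub_distrib]

/-- At most `3³ = 27` B-splines are active at `y`, all with knots near `y`, so only coefficients of
near indices have to be controlled. Off the mesh planes all orders up to two are allowed in each
variable, otherwise only order one. -/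
theorem abs_splineJet_le {c H E : ℝ} (hc : 0 < c) (hH : 0 < H) (hM : M.IsQuasiUniform c H)
    {e : (Fin 3 → ℕ) → ℝ} {y : E3} (hy : y ∈ patch)
    (he : ∀ j, M.IsNear H y j → |e j| ≤ E) {r : Fin 3 → ℕ} (hr : ∀ a, r a ≤ 2)
    (hr' : M.OffMesh y ∨ ∀ a, r a ≤ 1) :
    |M.splineJet e r y| ≤ 27 * (E * (4 / (c * H)) ^ (∑ a, r a)) := by
  choose k hk hks using fun a => (M a).exists_mem_Ico ⟨(hy a).1.le, (hy a).2⟩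
  set act : Finset (Fin 3 → ℕ) := Fintype.piFinset fun a => {k a, k a + 1, k a + 2} with hact
  have hcard : act.card = 27 := by
    rw [hact, Fintype.card_piFinset]
    simp
  have hnear : ∀ j ∈ act, M.IsNear H y j := fun j hj a =>
    UnitPartition.knot_near hH (hM a) (hk a) (hks a) (Fintype.mem_piFinset.1 hj a)
  have hE : 0 ≤ E := (abs_nonneg _).trans (he k (hnear k (Fintype.mem_piFinset.2 fun a => by simp)))
  have hjet : ∀ j a, |(M a).jet j (r a) (y a)| ≤ (4 / (c * H)) ^ (r a) := by
    intro j a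
    obtain ⟨h0, h1, h2⟩ := (M a).abs_jet_le hc hH (hM a) j (hy a)
    have h3 := hr a
    rcases hr' with hoff | h1'
    · interval_cases h : r a
      exacts [h0, h1, h2 (hoff a)]
    · have := h1' a
      interval_cases h : r a
      exacts [h0, h1]
  have hjet0 : ∀ a, ∀ j, j ∉ ({k a, k a + 1, k a + 2} : Finset ℕ) →
      (M a).jet j (r a) (y a) = 0 := by
    intro a j hj
    obtain ⟨h0, h1, h2⟩ := (M a).jet_eq_zero_of_inactive (hk a) (hks a) (hy a) hj
    have h3 := hr a
    rcases hr' with hoff | h1'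
    · interval_cases h : r a
      exacts [h0, h1, h2 (hoff a)]
    · have := h1' a
      interval_cases h : r a
      exacts [h0, h1]
  have hsub : act ⊆ M.idx := by
    intro j hj
    refine Fintype.mem_piFinset.2 fun a => ?_
    have h1 := Fintype.mem_piFinset.1 hj a
    have h2 := hk a
    simp only [Finset.mem_insert, Finset.mem_singleton] at h1
    rw [Finset.mem_range]
    omega
  have hsum : M.splineJet e r y = ∑ j ∈ act, e j * M.basisJet j r y := by
    symm
    refine Finset.sum_subset hsub fun j _ hj => ?_
    rw [hact, Fintype.mem_piFinset, not_forall] at hj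
    obtain ⟨a, ha⟩ := hj
    rw [basisJet, Finset.prod_eq_zero (Finset.mem_univ a) (hjet0 a _ ha), mul_zero]
  rw [hsum]
  refine (Finset.abs_sum_le_sum_abs _ _).trans ((Finset.sum_le_card_nsmul act _
    (E * (4 / (c * H)) ^ (∑ a, r a)) fun j hj => ?_).trans ?_)
  · rw [abs_mul]
    refine mul_le_mul (he j (hnear j hj)) ?_ (abs_nonneg _) hE
    rw [basisJet, Finset.abs_prod, ← Finset.prod_pow_eq_pow_sum]
    exact Finset.prod_le_prod (fun a _ => abs_nonneg _) fun a _ => hjet _ a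
  · rw [hcard, nsmul_eq_mul]
    norm_num

theorem isOpen_patch : IsOpen patch := by
  have : patch = ⋂ a : Fin 3, {y : E3 | y a ∈ Ioo (0 : ℝ) 1} := by
    ext y
    simp [patch]
  rw [this]
  exact isOpen_iInter_of_finite fun a => isOpen_Ioo.preimage (by fun_prop)

theorem hasFDerivAt_quadPoly (A : ℝ) (Λ : E3 →L[ℝ] ℝ) (B : E3 →L[ℝ] E3 →L[ℝ] ℝ) (z y : E3) :
    HasFDerivAt (quadPoly A Λ B z) (Λ + (B (y - z) + B.flip (y - z))) y := by
  unfold quadPoly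
  have h1 : HasFDerivAt (fun y : E3 => y - z) (ContinuousLinearMap.id ℝ E3) y :=
    (hasFDerivAt_id y).sub_const z
  have h2 : HasFDerivAt (fun y : E3 => Λ (y - z)) Λ y := Λ.hasFDerivAt.comp y h1
  have h3 : HasFDerivAt (fun y : E3 => B (y - z)) B y := B.hasFDerivAt.comp y h1
  have h4 := h3.clm_apply h1
  refine ((h2.const_add A).add h4).congr_fderiv ?_
  ext v
  simp

/-- If the coefficients of a spline are close to the quasi-interpolation coefficients of a
quadratic polynomial, then the derivatives of the spline are close to those of the polynomial. -/
theorem splineJet_close {c H E : ℝ} (hc : 0 < c) (hH : 0 < H) (hM : M.IsQuasiUniform c H)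
    {d : (Fin 3 → ℕ) → ℝ} {y : E3} (hy : y ∈ patch) (A : ℝ) (Λ : E3 →L[ℝ] ℝ)
    (B : E3 →L[ℝ] E3 →L[ℝ] ℝ)
    (hd : ∀ j, M.IsNear H y j → |d j - M.quasi (quadPoly A Λ B y) j| ≤ E) :
    |M.splineJet d 0 y - A| ≤ 27 * E ∧
    (∀ a, |M.splineJet d (Pi.single a 1) y - Λ (EuclideanSpace.single a (1 : ℝ))| ≤
      27 * (E * (4 / (c * H)))) ∧
    (M.OffMesh y → ∀ a b, |M.splineJet d (Pi.single a 1 + Pi.single b 1) y -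
      (B (EuclideanSpace.single a (1 : ℝ)) (EuclideanSpace.single b (1 : ℝ)) +
       B (EuclideanSpace.single b (1 : ℝ)) (EuclideanSpace.single a (1 : ℝ)))| ≤
      27 * (E * (4 / (c * H)) ^ 2)) := by
  -- The spline with coefficients `q` equals the polynomial on the open patch, so its derivatives
  -- are those of the polynomial. The inverse estimate is applied to the difference `d - q`.
  set q := M.quasi (quadPoly A Λ B y) with hq
  have hnear : ∀ j, M.IsNear H y j → |(d - q) j| ≤ E := hd
  have h0 : ∀ z ∈ patch, M.splineJet q 0 z = quadPoly A Λ B y z := fun z hz =>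
    M.splineJet_quasi_quadPoly A Λ B y hz
  have h1 : ∀ z ∈ patch, ∀ a, M.splineJet q (Pi.single a 1) z =
      Λ (EuclideanSpace.single a (1 : ℝ)) + (B (z - y) (EuclideanSpace.single a (1 : ℝ)) +
        B (EuclideanSpace.single a (1 : ℝ)) (z - y)) := by
    intro z hz a
    have e1 := M.hasFDerivAt_splineJet_zero q hz
    have e2 := (hasFDerivAt_quadPoly A Λ B y z).congr_of_eventuallyEq
      (f₁ := M.splineJet q 0) (by
        filter_upwards [isOpen_patch.mem_nhds hz] with w hw
        exact h0 w hw)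
    have e3 := congrArg (fun T : E3 →L[ℝ] ℝ => T (EuclideanSpace.single a (1 : ℝ))) (e1.unique e2)
    simp only [sum_apply, smul_apply, smul_eq_mul,
      add_apply, ContinuousLinearMap.flip_apply] at e3
    rw [← e3, Fin.sum_univ_three]
    fin_cases a <;> simp
  refine ⟨?_, fun a => ?_, fun hoff a b => ?_⟩
  · have hA : quadPoly A Λ B y y = A := by simp [quadPoly]
    have := M.abs_splineJet_le hc hH hM hy hnear (r := 0) (fun a => by simp) (Or.inr fun a => by simp)
    rw [splineJet_sub, h0 y hy, hA] at this
    simpa using this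
  · have := M.abs_splineJet_le hc hH hM hy hnear (r := Pi.single a 1)
      (fun b => by simp only [Pi.single_apply]; split_ifs <;> simp)
      (Or.inr fun b => by simp only [Pi.single_apply]; split_ifs <;> simp)
    rw [splineJet_sub, h1 y hy] at this
    simpa using this
  · have h2 : M.splineJet q (Pi.single a 1 + Pi.single b 1) y =
        B (EuclideanSpace.single a (1 : ℝ)) (EuclideanSpace.single b (1 : ℝ)) +
        B (EuclideanSpace.single b (1 : ℝ)) (EuclideanSpace.single a (1 : ℝ)) := by
      have e1 := M.hasFDerivAt_splineJet_single q hy hoff a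
      have h3 : HasFDerivAt (fun z : E3 => z - y) (ContinuousLinearMap.id ℝ E3) y :=
        (hasFDerivAt_id y).sub_const y
      have h4 : HasFDerivAt (fun z : E3 => B.flip (EuclideanSpace.single a (1 : ℝ)) (z - y))
        (B.flip (EuclideanSpace.single a (1 : ℝ))) y :=
          (B.flip (EuclideanSpace.single a (1 : ℝ))).hasFDerivAt.comp y h3
      have h5 : HasFDerivAt (fun z : E3 => B (EuclideanSpace.single a (1 : ℝ)) (z - y))
        (B (EuclideanSpace.single a (1 : ℝ))) y :=
          (B (EuclideanSpace.single a (1 : ℝ))).hasFDerivAt.comp y h3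
      have e2 := ((h4.add h5).const_add (Λ (EuclideanSpace.single a (1 : ℝ)))).congr_of_eventuallyEq
        (f₁ := M.splineJet q (Pi.single a 1)) (by
          filter_upwards [isOpen_patch.mem_nhds hy] with w hw
          simp [h1 w hw])
      have e3 := congrArg (fun T : E3 →L[ℝ] ℝ => T (EuclideanSpace.single b (1 : ℝ))) (e1.unique e2)
      simp only [sum_apply, smul_apply, smul_eq_mul,
        add_apply, ContinuousLinearMap.flip_apply] at e3
      rw [add_comm (B (EuclideanSpace.single a (1 : ℝ)) (EuclideanSpace.single b (1 : ℝ))), ← e3,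
        Fin.sum_univ_three]
      fin_cases b <;> simp
    have := M.abs_splineJet_le hc hH hM hy hnear (r := Pi.single a 1 + Pi.single b 1)
      (fun c => by simp only [Pi.add_apply, Pi.single_apply]; split_ifs <;> simp)
      (Or.inl hoff)
    rw [splineJet_sub, h2] at this
    simpa [Finset.sum_add_distrib] using this

end TensorMesh

/-! ### Quasi-uniformity of shape regular tensor product meshes -/

/-- Any interval of one direction and any interval of another direction are edges of a common
element, so shape regularity compares their lengths. Two intervals of the same direction are
compared through a third interval in a different direction, at the price of a second factor `c`. -/
theorem UniformlyShapeRegular.exists_isQuasiUniform {M : ℕ → TensorMesh}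
    (hM : UniformlyShapeRegular M) {h : ℕ → ℝ}
    (hsize : ∀ n, ∀ k : Fin 3 → ℕ, (M n).IsElement k → (M n).elementDiam k ≤ h n) :
    ∃ c > 0, ∃ C > 0, ∃ H : ℕ → ℝ, ∀ n, 0 < H n ∧ (M n).IsQuasiUniform c (H n) ∧ H n ≤ C * h n := by
  obtain ⟨c, hc, hreg⟩ := hM
  set e : ℕ → Fin 3 → ℕ → ℝ := fun n a i => (M n a).x (i + 1) - (M n a).x i with he
  have hpos : ∀ n a i, i < (M n a).m → 0 < e n a i := fun n a i hi =>
    sub_pos.2 ((M n a).lt i (i + 1) (by omega) hi)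
  have hle : ∀ n k a, (M n).edge k a ≤ (M n).elementDiam k := by
    intro n k a
    refine Real.le_sqrt_of_sq_le ?_
    exact Finset.single_le_sum (f := fun a => (M n).edge k a ^ 2) (fun i _ => sq_nonneg _)
      (Finset.mem_univ a)
  have hne : ∀ n a b i j, a ≠ b → i < (M n a).m → j < (M n b).m → c * e n b j ≤ e n a i := by
    intro n a b i j hab hi hj
    -- An element with prescribed intervals in the directions `a` and `b`; the remaining direction
    -- takes its first interval.
    set k : Fin 3 → ℕ := fun d => if d = a then i else if d = b then j else 0 with hk
    have hka : k a = i := by simp [hk]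
    have hkb : k b = j := by simp [hk, hab.symm]
    have hel : (M n).IsElement k := by
      intro d
      by_cases h1 : d = a
      · subst h1; rwa [hka]
      by_cases h2 : d = b
      · subst h2; rwa [hkb]
      · simp only [hk, h1, h2, if_false]
        exact (M n d).m_pos
    have h1 := hreg n k hel a
    have h2 := mul_le_mul_of_nonneg_left (hle n k b) hc.le
    simp only [TensorMesh.edge, hka, hkb] at h1 h2
    exact h2.trans h1
  set c₁ := min c (c ^ 2) with hc₁
  have hc₁0 : 0 < c₁ := lt_min hc (by positivity)
  have hall : ∀ n a b i j, i < (M n a).m → j < (M n b).m → c₁ * e n b j ≤ e n a i := by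
    intro n a b i j hi hj
    have hb := (hpos n b j hj).le
    by_cases hab : a = b
    · subst hab
      obtain ⟨d, hd⟩ : ∃ d : Fin 3, d ≠ a := exists_ne a
      have h1 := hne n d a 0 j hd (M n d).m_pos hj
      have h2 := hne n a d i 0 hd.symm hi (M n d).m_pos
      calc c₁ * e n a j ≤ c ^ 2 * e n a j := by gcongr; exact min_le_right _ _
        _ = c * (c * e n a j) := by ring
        _ ≤ c * e n d 0 := by gcongr
        _ ≤ _ := h2
    · exact (mul_le_mul_of_nonneg_right (min_le_left _ _) hb).trans (hne n a b i j hab hi hj)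
  -- The reference size is one fixed edge divided by `c₁`: it bounds every edge from above, and `c₁
  -- ^ 2` times it is `c₁` times that fixed edge, which bounds every edge from below.
  refine ⟨c₁ ^ 2, by positivity, 1 / c₁, by positivity, fun n => e n 0 0 / c₁, fun n => ⟨?_, ?_, ?_⟩⟩
  · exact div_pos (hpos n 0 0 (M n 0).m_pos) hc₁0
  · intro a i hi
    constructor
    · have := hall n a 0 i 0 hi (M n 0).m_pos
      have e1 : c₁ ^ 2 * (e n 0 0 / c₁) = c₁ * e n 0 0 := by field_simp
      rw [e1]
      exact this
    · rw [le_div_iff₀ hc₁0, mul_comm]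
      exact hall n 0 a 0 i (M n 0).m_pos hi
  · have h1 := hle n 0 0
    have h2 := hsize n 0 fun a => (M n a).m_pos
    have h3 : e n 0 0 ≤ h n := h1.trans h2
    rw [div_mul_eq_mul_div, one_mul]
    exact div_le_div_of_nonneg_right h3 hc₁0.le

/-! ### Location of the stencil points and stability of the coefficients -/

theorem dist_le_of_coord_le {y z : E3} {r : ℝ} (hr : 0 ≤ r) (h : ∀ a, |y a - z a| ≤ r) :
    dist y z ≤ 2 * r := by
  rw [EuclideanSpace.dist_eq]
  refine Real.sqrt_le_iff.2 ⟨by positivity, ?_⟩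
  have : ∀ a, dist (y a) (z a) ^ 2 ≤ r ^ 2 := fun a => by
    rw [Real.dist_eq]
    exact pow_le_pow_left₀ (abs_nonneg _) (h a) 2
  rw [Fin.sum_univ_three]
  have := this 0
  nlinarith [this, ‹∀ a, dist (y a) (z a) ^ 2 ≤ r ^ 2› 1, ‹∀ a, dist (y a) (z a) ^ 2 ≤ r ^ 2› 2, sq_nonneg r]

theorem TensorMesh.IsNear.dist_greville_le {M : TensorMesh} {H : ℝ} (hH : 0 < H) {y : E3} {j : Fin 3 → ℕ}
    (h : M.IsNear H y j) :
    dist (M.greville j) y ≤ 4 * H ∧ ∀ a, dist (M.stencil j a 1) y ≤ 4 * H ∧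
      dist (M.stencil j a 2) y ≤ 4 * H := by
  have hg : ∀ a, |M.greville j a - y a| ≤ 2 * H := by
    intro a
    obtain ⟨h1, h2⟩ := h a
    rw [abs_le] at *
    simp only [greville]
    constructor <;> linarith
  have e : 4 * H = 2 * (2 * H) := by ring
  rw [e]
  refine ⟨dist_le_of_coord_le (by positivity) hg, fun a => ⟨dist_le_of_coord_le (by positivity) fun b => ?_,
    dist_le_of_coord_le (by positivity) fun b => ?_⟩⟩
  · by_cases hb : b = a
    · subst hb
      simpa [stencil] using (h b).1
    · simpa [stencil, hb] using hg b
  · by_cases hb : b = a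
    · subst hb
      simpa [stencil] using (h b).2
    · simpa [stencil, hb] using hg b

theorem TensorMesh.greville_mem (M : TensorMesh) (j : Fin 3 → ℕ) (a : Fin 3) :
    M.greville j a ∈ Icc (0 : ℝ) 1 := by
  have h1 := (M a).knot_mem (j a + 1)
  have h2 := (M a).knot_mem (j a + 2)
  simp only [greville, mem_Icc] at *
  constructor <;> linarith

/-- The absolute weights of the functional add up to `4 + 6 / 2 = 7`. -/
theorem TensorMesh.abs_quasi_sub_le {M : TensorMesh} {V W : E3 → ℝ} {j : Fin 3 → ℕ} {E : ℝ}
    (hg : |V (M.greville j) - W (M.greville j)| ≤ E)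
    (hs : ∀ a, |V (M.stencil j a 1) - W (M.stencil j a 1)| ≤ E ∧
      |V (M.stencil j a 2) - W (M.stencil j a 2)| ≤ E) :
    |M.quasi V j - M.quasi W j| ≤ 7 * E := by
  simp only [quasi, Fin.sum_univ_three]
  have h0 := hs 0
  have h1 := hs 1
  have h2 := hs 2
  simp only [abs_le] at *
  constructor <;> linarith

/-! ### The optimal profile -/

/-- The optimal transition profile. -/
noncomputable def optProfile (t : ℝ) : ℝ := (1 + |t|) * Real.exp (-|t|)

theorem hasDerivAt_optProfile {t : ℝ} (ht : t ≠ 0) :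
    HasDerivAt optProfile (-t * Real.exp (-|t|)) t := by
  unfold optProfile
  have h1 := hasDerivAt_abs ht
  have h2 := (h1.const_add 1).mul h1.neg.exp
  refine h2.congr_deriv ?_
  have : (SignType.sign t : ℝ) * |t| = t := sign_mul_abs t
  linear_combination -Real.exp (-|t|) * this

theorem hasDerivAt_optProfile' {t : ℝ} (ht : t ≠ 0) :
    HasDerivAt (fun t => -t * Real.exp (-|t|)) ((|t| - 1) * Real.exp (-|t|)) t := by
  have h1 := hasDerivAt_abs ht
  have h2 := (hasDerivAt_id t).neg.mul h1.neg.exp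
  refine h2.congr_deriv ?_
  have : (SignType.sign t : ℝ) * t = |t| := sign_mul_self t
  simp only [id, Pi.neg_apply]
  linear_combination Real.exp (-|t|) * this

/-- The integrand is `w² + 2 w'² + w''²` for the optimal profile, because `(1 + t)² + 2 t² + (t -
1)² = 2 + 4 t²`. An explicit primitive gives 2 on the half line, hence 4 by symmetry: the constant
in front of the area. -/
theorem integral_optProfile_energy :
    Integrable (fun t : ℝ => (2 + 4 * |t| ^ 2) * Real.exp (-(2 * |t|))) ∧
      ∫ t : ℝ, (2 + 4 * |t| ^ 2) * Real.exp (-(2 * |t|)) = 4 := by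
  have hder : ∀ t ∈ Ici (0 : ℝ), HasDerivAt (fun t => -(2 * t ^ 2 + 2 * t + 2) * Real.exp (-(2 * t)))
      ((2 + 4 * t ^ 2) * Real.exp (-(2 * t))) t := by
    intro t _
    have h1 : HasDerivAt (fun t : ℝ => -(2 * t ^ 2 + 2 * t + 2)) (-(2 * (2 * t) + 2)) t := by
      have := (((hasDerivAt_pow 2 t).const_mul 2).add ((hasDerivAt_id t).const_mul 2)).add_const 2
      refine this.neg.congr_deriv ?_
      simp
    have h2 : HasDerivAt (fun t : ℝ => Real.exp (-(2 * t))) (Real.exp (-(2 * t)) * -(2 * 1)) t :=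
      ((hasDerivAt_id t).const_mul 2).neg.exp
    refine (h1.mul h2).congr_deriv ?_
    ring
  have hlim : Tendsto (fun t : ℝ => -(2 * t ^ 2 + 2 * t + 2) * Real.exp (-(2 * t))) atTop (𝓝 0) := by
    have h0 : Tendsto (fun t : ℝ => 2 * t) atTop atTop := tendsto_id.const_mul_atTop two_pos
    have h2 := (Real.tendsto_pow_mul_exp_neg_atTop_nhds_zero 2).comp h0
    have h1 := (Real.tendsto_pow_mul_exp_neg_atTop_nhds_zero 1).comp h0
    have h3 := (Real.tendsto_pow_mul_exp_neg_atTop_nhds_zero 0).comp h0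
    have := ((h2.const_mul (-(1/2))).add (h1.const_mul (-1))).add (h3.const_mul (-2))
    simp only [mul_zero, add_zero] at this
    refine this.congr fun t => ?_
    simp only [Function.comp]
    ring
  have hnn : ∀ t ∈ Ioi (0 : ℝ), 0 ≤ (2 + 4 * t ^ 2) * Real.exp (-(2 * t)) := fun t _ => by positivity
  have hval := integral_Ioi_of_hasDerivAt_of_nonneg' hder hnn hlim
  have h4 : ∫ t : ℝ, (2 + 4 * |t| ^ 2) * Real.exp (-(2 * |t|)) = 4 := by
    rw [integral_comp_abs (f := fun t => (2 + 4 * t ^ 2) * Real.exp (-(2 * t))), hval]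
    norm_num
  refine ⟨?_, h4⟩
  -- The integral of a non-integrable function is zero by convention, so the value 4 forces
  -- integrability.
  by_contra hni
  rw [integral_undef hni] at h4
  norm_num at h4

/-- The quadratic contact `1 - w ≤ t²` at the origin compensates the `l⁻²` produced by two
derivatives of the inner cutoff. The bounds of both derivatives by the profile itself keep the
exponential decay in the dominating function. -/
theorem optProfile_bounds (t : ℝ) : 0 ≤ optProfile t ∧ optProfile t ≤ 1 ∧
    1 - optProfile t ≤ t ^ 2 ∧ |-t * Real.exp (-|t|)| ≤ optProfile t ∧
    |-t * Real.exp (-|t|)| ≤ |t| ∧ |(|t| - 1) * Real.exp (-|t|)| ≤ optProfile t := by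
  have he := Real.exp_pos (-|t|)
  have he1 : Real.exp (-|t|) ≤ 1 := Real.exp_le_one_iff.2 (by simp)
  have h1 := Real.add_one_le_exp (-|t|)
  have h2 := Real.add_one_le_exp |t|
  have ht := abs_nonneg t
  unfold optProfile
  refine ⟨by positivity, ?_, ?_, ?_, ?_, ?_⟩
  · have : Real.exp |t| * Real.exp (-|t|) = 1 := by rw [← Real.exp_add]; simp
    nlinarith
  · rw [← sq_abs t]
    nlinarith
  · rw [abs_mul, abs_neg, abs_of_pos he]
    nlinarith
  · rw [abs_mul, abs_neg, abs_of_pos he]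
    nlinarith
  · rw [abs_mul, abs_of_pos he]
    refine mul_le_mul_of_nonneg_right ?_ he.le
    rw [abs_le]
    constructor <;> linarith

/-- A fixed smooth cutoff function, equal to one exactly on `[-1, 1]` and vanishing exactly
outside `(-2, 2)`. -/
noncomputable def stdBump (s : ℝ) : ℝ := Real.smoothTransition ((4 - s ^ 2) / 3)

theorem stdBump_nonneg (s : ℝ) : 0 ≤ stdBump s := Real.smoothTransition.nonneg _

theorem stdBump_le_one (s : ℝ) : stdBump s ≤ 1 := Real.smoothTransition.le_one _

theorem contDiff_stdBump : ContDiff ℝ ∞ stdBump :=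
  Real.smoothTransition.contDiff.comp (by fun_prop)

theorem stdBump_eq_one_iff {s : ℝ} : stdBump s = 1 ↔ |s| ≤ 1 := by
  rw [stdBump, Real.smoothTransition.eq_one_iff_one_le, ← sq_le_one_iff_abs_le_one]
  constructor <;> intro h <;> linarith

theorem stdBump_eq_zero_iff {s : ℝ} : stdBump s = 0 ↔ 2 ≤ |s| := by
  rw [stdBump, Real.smoothTransition.zero_iff_nonpos, ← abs_two (α := ℝ), ← sq_le_sq]
  constructor <;> intro h <;> linarith

theorem hasCompactSupport_stdBump : HasCompactSupport stdBump := by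
  refine HasCompactSupport.intro (isCompact_closedBall (0 : ℝ) 2) fun s hs => ?_
  rw [stdBump_eq_zero_iff]
  simpa using (not_le.1 fun h => hs (by simpa using h)).le

/-- The optimal profile modified near the origin and truncated at infinity. -/
noncomputable def profile (l t : ℝ) : ℝ :=
  stdBump (l * t) * (1 - (1 - stdBump (t / l)) * (1 - optProfile t))

theorem stdBump_one {s : ℝ} (hs : |s| ≤ 1) : stdBump s = 1 :=
  stdBump_eq_one_iff.2 hs

theorem stdBump_zero {s : ℝ} (hs : 2 ≤ |s|) : stdBump s = 0 :=
  stdBump_eq_zero_iff.2 hs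

theorem contDiff_profile {l : ℝ} (hl : 0 < l) : ContDiff ℝ ∞ (profile l) := by
  have hb : ContDiff ℝ ∞ stdBump := contDiff_stdBump
  unfold profile
  refine ContDiff.mul (hb.comp (by fun_prop)) (contDiff_const.sub ?_)
  rw [contDiff_iff_contDiffAt]
  intro t
  by_cases ht : t = 0
  · subst ht
    refine (contDiffAt_const (c := (0 : ℝ))).congr_of_eventuallyEq ?_
    filter_upwards [Metric.ball_mem_nhds (0 : ℝ) hl] with s hs
    rw [stdBump_one, sub_self, zero_mul]
    rw [abs_div, abs_of_pos hl, div_le_one hl]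
    simpa using (Metric.mem_ball.1 hs).le
  · have ha : ContDiffAt ℝ ∞ (fun t : ℝ => |t|) t := contDiffAt_abs ht
    have ho : ContDiffAt ℝ ∞ optProfile t := by
      unfold optProfile
      exact (contDiffAt_const.add ha).mul ha.neg.exp
    have h1 : ContDiff ℝ ∞ (fun t : ℝ => stdBump (t / l)) := hb.comp (by fun_prop)
    exact (contDiffAt_const.sub h1.contDiffAt).mul (contDiffAt_const.sub ho)

theorem hasDerivAt_profile {l t : ℝ} (ht : t ≠ 0) :
    HasDerivAt (profile l) (l * deriv stdBump (l * t) * (1 - (1 - stdBump (t / l)) * (1 - optProfile t)) +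
      stdBump (l * t) * (deriv stdBump (t / l) / l * (1 - optProfile t) +
        (1 - stdBump (t / l)) * (-t * Real.exp (-|t|)))) t := by
  have hb : ContDiff ℝ ∞ stdBump := contDiff_stdBump
  have hd : ∀ s, HasDerivAt stdBump (deriv stdBump s) s := fun s =>
    ((hb.differentiable (by simp)) s).hasDerivAt
  have hm : HasDerivAt (fun t : ℝ => l * t) (l * 1) t := (hasDerivAt_id t).const_mul l
  have hq : HasDerivAt (fun t : ℝ => t / l) (1 / l) t := (hasDerivAt_id t).div_const l
  have h1 := (hd (l * t)).comp t hm
  have h2 := (hd (t / l)).comp t hq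
  have h3 := hasDerivAt_optProfile ht
  refine (h1.mul (((h2.const_sub 1).mul (h3.const_sub 1)).const_sub 1)).congr_deriv ?_
  simp only [Function.comp, Pi.mul_apply]
  ring

theorem hasDerivAt_deriv_profile {l t : ℝ} (ht : t ≠ 0) :
    HasDerivAt (deriv (profile l))
      (l ^ 2 * deriv (deriv stdBump) (l * t) * (1 - (1 - stdBump (t / l)) * (1 - optProfile t)) +
      2 * (l * deriv stdBump (l * t)) * (deriv stdBump (t / l) / l * (1 - optProfile t) +
        (1 - stdBump (t / l)) * (-t * Real.exp (-|t|))) +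
      stdBump (l * t) * (deriv (deriv stdBump) (t / l) / l ^ 2 * (1 - optProfile t) -
        2 * (deriv stdBump (t / l) / l * (-t * Real.exp (-|t|))) +
        (1 - stdBump (t / l)) * ((|t| - 1) * Real.exp (-|t|)))) t := by
  have hb : ContDiff ℝ ∞ stdBump := contDiff_stdBump
  have hd : ∀ s, HasDerivAt stdBump (deriv stdBump s) s := fun s =>
    ((hb.differentiable (by simp)) s).hasDerivAt
  have hb2 : ContDiff ℝ 1 (deriv stdBump) :=
    (contDiff_infty_iff_deriv.1 hb).2.of_le (by simp)
  have hd2 : ∀ s, HasDerivAt (deriv stdBump) (deriv (deriv stdBump) s) s := fun s =>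
    ((hb2.differentiable (by simp)) s).hasDerivAt
  have hm : HasDerivAt (fun t : ℝ => l * t) (l * 1) t := (hasDerivAt_id t).const_mul l
  have hq : HasDerivAt (fun t : ℝ => t / l) (1 / l) t := (hasDerivAt_id t).div_const l
  have h1 := (hd (l * t)).comp t hm
  have h1' := (hd2 (l * t)).comp t hm
  have h2 := (hd (t / l)).comp t hq
  have h2' := (hd2 (t / l)).comp t hq
  have h3 := hasDerivAt_optProfile ht
  have h3' := hasDerivAt_optProfile' ht
  have hA := ((h2.const_sub 1).mul (h3.const_sub 1)).const_sub 1
  have hB := ((h2'.div_const l).mul (h3.const_sub 1)).add ((h2.const_sub 1).mul h3')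
  have := ((h1'.const_mul l).mul hA).add (h1.mul hB)
  refine HasDerivAt.congr_of_eventuallyEq (this.congr_deriv ?_) ?_
  · simp only [Function.comp, Pi.mul_apply, Pi.add_apply]
    ring
  · filter_upwards [isOpen_ne.mem_nhds ht] with s hs
    rw [(hasDerivAt_profile hs).deriv]
    simp [Function.comp]

/-- Continuity carries the vanishing of the derivatives to the closure, which is needed at the end
points of the flat regions of `stdBump`. -/
theorem deriv_eq_zero_of_frequently_const {f : ℝ → ℝ} (hf : ContDiff ℝ ∞ f) {s v : ℝ} {S : Set ℝ}
    (hS : IsOpen S) (hs : s ∈ closure S) (h : ∀ y ∈ S, f y = v) :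
    deriv f s = 0 ∧ deriv (deriv f) s = 0 := by
  have h1 : ContDiff ℝ ∞ (deriv f) := (contDiff_infty_iff_deriv.1 hf).2
  have h2 : ContDiff ℝ ∞ (deriv (deriv f)) := (contDiff_infty_iff_deriv.1 h1).2
  have key : ∀ y ∈ S, deriv f y = 0 ∧ deriv (deriv f) y = 0 := by
    intro y hy
    have he : f =ᶠ[𝓝 y] fun _ => v := by
      filter_upwards [hS.mem_nhds hy] with z hz
      exact h z hz
    have h1 := he.deriv
    constructor
    · rw [h1.eq_of_nhds]; simp
    · rw [h1.deriv_eq]; simp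
  constructor
  · exact closure_minimal (fun y hy => (key y hy).1)
      (isClosed_eq h1.continuous continuous_const) hs
  · exact closure_minimal (fun y hy => (key y hy).2)
      (isClosed_eq h2.continuous continuous_const) hs

theorem deriv_stdBump_zero {s : ℝ} (hs : 2 ≤ |s| ∨ |s| ≤ 1) :
    deriv stdBump s = 0 ∧ deriv (deriv stdBump) s = 0 := by
  rcases hs with hs | hs
  · refine deriv_eq_zero_of_frequently_const contDiff_stdBump (v := 0) (S := Iio (-2) ∪ Ioi 2)
      (isOpen_Iio.union isOpen_Ioi) ?_ fun y hy => ?_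
    · rw [closure_union, closure_Iio, closure_Ioi]
      rcases le_abs.1 hs with h | h
      · exact Or.inr h
      · exact Or.inl (show s ≤ -2 by linarith)
    · rw [stdBump_eq_zero_iff]
      rcases hy with hy | hy
      · exact le_abs.2 (Or.inr (by linarith [show y < -2 from hy]))
      · exact le_abs.2 (Or.inl (le_of_lt hy))
  · refine deriv_eq_zero_of_frequently_const contDiff_stdBump (v := 1) (S := Ioo (-1) 1)
      isOpen_Ioo ?_ fun y hy => ?_
    · rw [closure_Ioo (by norm_num)]
      exact abs_le.1 hs
    · exact stdBump_eq_one_iff.2 (abs_le.2 ⟨hy.1.le, hy.2.le⟩)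

/-- The energy density of a transition profile. -/
noncomputable def profileEnergy (w : ℝ → ℝ) (t : ℝ) : ℝ :=
  w t ^ 2 + 2 * deriv w t ^ 2 + deriv (deriv w) t ^ 2

theorem deriv_bump_bound : ∃ B : ℝ, 1 ≤ B ∧ ∀ s, |deriv stdBump s| ≤ B ∧
    |deriv (deriv stdBump) s| ≤ B := by
  have hb : ContDiff ℝ ∞ stdBump := contDiff_stdBump
  have hb1 : ContDiff ℝ 1 (deriv stdBump) :=
    (contDiff_infty_iff_deriv.1 hb).2.of_le (by simp)
  have hc : HasCompactSupport stdBump := hasCompactSupport_stdBump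
  obtain ⟨B1, h1⟩ := hc.deriv.exists_bound_of_continuous hb1.continuous
  obtain ⟨B2, h2⟩ := hc.deriv.deriv.exists_bound_of_continuous (hb1.continuous_deriv le_rfl)
  refine ⟨max 1 (max B1 B2), le_max_left _ _, fun s => ⟨?_, ?_⟩⟩
  · exact (h1 s).trans ((le_max_left _ _).trans (le_max_right _ _))
  · exact (h2 s).trans ((le_max_right _ _).trans (le_max_right _ _))

/-- The three jets of the product are at most 1, 2 and 4 times `B * X`, and `1 + 2 · 2² + 4² = 25`.
-/
theorem product_jet_sq_le {k k1 k2 g g1 g2 B X : ℝ} (hB1 : 1 ≤ B) (hX : 0 ≤ X) (hk : |k| ≤ 1)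
    (hk1 : |k1| ≤ B) (hk2 : |k2| ≤ B) (hg0 : |g| ≤ X) (hg1 : |g1| ≤ X) (hg2 : |g2| ≤ X) :
    (k * g) ^ 2 + 2 * (k1 * g + k * g1) ^ 2 + (k2 * g + 2 * k1 * g1 + k * g2) ^ 2 ≤
      25 * (B * X) ^ 2 := by
  have hmul : ∀ {p q P Q : ℝ}, |p| ≤ P → |q| ≤ Q → |p * q| ≤ P * Q := fun {p q P Q} h h' => by
    rw [abs_mul]
    exact mul_le_mul h h' (abs_nonneg _) ((abs_nonneg _).trans h)
  have hXB : X ≤ B * X := le_mul_of_one_le_left hX hB1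
  have w0 : |k * g| ≤ B * X := (hmul hk hg0).trans (by linarith)
  have w1 : |k1 * g + k * g1| ≤ 2 * (B * X) := by
    refine (abs_add_le _ _).trans ?_
    have a1 := hmul hk1 hg0
    have a2 := hmul hk hg1
    linarith
  have w2 : |k2 * g + 2 * k1 * g1 + k * g2| ≤ 4 * (B * X) := by
    refine (abs_add_le _ _).trans ?_
    have a0 := abs_add_le (k2 * g) (2 * k1 * g1)
    have a1 := hmul hk2 hg0
    have a2 := hmul hk1 hg1
    have a3 := hmul hk hg2
    have a4 : |2 * k1 * g1| = 2 * |k1 * g1| := by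
      rw [mul_assoc, abs_mul, abs_two]
    linarith
  have sq_le : ∀ {p Q : ℝ}, |p| ≤ Q → p ^ 2 ≤ Q ^ 2 := fun {p Q} h => sq_le_sq' (abs_le.1 h).1 (abs_le.1 h).2
  have s0 := sq_le w0
  have s1 := sq_le w1
  have s2 := sq_le w2
  linarith

/-- An integrable majorant independent of `l`. The inner cutoff varies only for `|t| ≤ 2 l`, where
`1 - w ≤ 4 l²` absorbs its derivatives, and where the profile is bounded below, so that constants
are again controlled by the profile. Elsewhere only the optimal profile and the outer cutoff enter.
-/
theorem exists_profileEnergy_bound : ∃ C : ℝ, 0 ≤ C ∧ ∀ l : ℝ, 0 < l → l ≤ 1 → ∀ t : ℝ, t ≠ 0 →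
    profileEnergy (profile l) t ≤ C * ((2 + 4 * |t| ^ 2) * Real.exp (-(2 * |t|))) := by
  obtain ⟨B, hB1, hB⟩ := deriv_bump_bound
  have hB0 : 0 < B := one_pos.trans_le hB1
  refine ⟨25 * (B * (81 * B)) ^ 2, by positivity, fun l hl hl1 t ht => ?_⟩
  obtain ⟨hE0, hE1, hz, hd1, hd1', hd2⟩ := optProfile_bounds t
  rw [profileEnergy, (hasDerivAt_deriv_profile ht).deriv, (hasDerivAt_profile ht).deriv]
  set E := optProfile t with hE
  set D1 := -t * Real.exp (-|t|)
  set D2 := (|t| - 1) * Real.exp (-|t|)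
  set b := stdBump (t / l)
  set b1 := deriv stdBump (t / l)
  set b2 := deriv (deriv stdBump) (t / l)
  have hb : 0 ≤ b ∧ b ≤ 1 := ⟨stdBump_nonneg _, stdBump_le_one _⟩
  set g := 1 - (1 - b) * (1 - E) with hg
  set g1 := b1 / l * (1 - E) + (1 - b) * D1 with hg1
  set g2 := b2 / l ^ 2 * (1 - E) - 2 * (b1 / l * D1) + (1 - b) * D2 with hg2
  have hgs : |g| ≤ 81 * B * E ∧ |g1| ≤ 81 * B * E ∧ |g2| ≤ 81 * B * E := by
    rcases le_or_gt |t| (2 * l) with hsm | hbig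
    -- Here `|t| ≤ 2`, and `e^{-2} ≥ 1/9`. The jets are at most `9 * B`, whence the factor `81 * B *
    -- E`.
    · have hE9 : 1 ≤ 9 * E := by
        have h2 : |t| ≤ 2 := by linarith
        have e1 : Real.exp (-2) ≤ Real.exp (-|t|) := Real.exp_le_exp.2 (by linarith)
        have e2 : (1 : ℝ) / 9 ≤ Real.exp (-2) := by
          rw [Real.exp_neg, one_div]
          refine inv_anti₀ (Real.exp_pos _) ?_
          have : Real.exp 2 = Real.exp 1 * Real.exp 1 := by rw [← Real.exp_add]; norm_num
          rw [this]
          have h3 := Real.exp_one_lt_d9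
          have h4 := Real.exp_pos 1
          nlinarith
        have : Real.exp (-|t|) ≤ E := by
          rw [hE, optProfile]
          have := Real.exp_pos (-|t|)
          nlinarith [abs_nonneg t]
        linarith
      have q0 : |1 - E| ≤ 4 * l ^ 2 := by
        rw [abs_of_nonneg (by linarith)]
        refine hz.trans ?_
        rw [← sq_abs]
        nlinarith [abs_nonneg t]
      have q1 : |b1 / l * (1 - E)| ≤ 4 * B := by
        rw [abs_mul, abs_div, abs_of_pos hl]
        calc |b1| / l * |1 - E| ≤ B / l * (4 * l ^ 2) := by
              gcongr
              exact (hB _).1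
          _ = 4 * B * l := by field_simp
          _ ≤ 4 * B * 1 := by gcongr
          _ = 4 * B := by ring
      have q2 : |b2 / l ^ 2 * (1 - E)| ≤ 4 * B := by
        rw [abs_mul, abs_div, abs_of_pos (pow_pos hl 2)]
        calc |b2| / l ^ 2 * |1 - E| ≤ B / l ^ 2 * (4 * l ^ 2) := by
              gcongr
              exact (hB _).2
          _ = 4 * B := by field_simp
      have q3 : |b1 / l * D1| ≤ 2 * B := by
        rw [abs_mul, abs_div, abs_of_pos hl]
        calc |b1| / l * |D1| ≤ B / l * (2 * l) := by
              gcongr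
              · exact (hB _).1
              · exact hd1'.trans hsm
          _ = 2 * B := by field_simp
      have q4 : |(1 - b) * D1| ≤ 1 := by
        rw [abs_mul, abs_of_nonneg (by linarith : 0 ≤ 1 - b)]
        calc (1 - b) * |D1| ≤ 1 * 1 := mul_le_mul (by linarith) (hd1.trans hE1) (abs_nonneg _) zero_le_one
          _ = 1 := one_mul 1
      have q5 : |(1 - b) * D2| ≤ 1 := by
        rw [abs_mul, abs_of_nonneg (by linarith : 0 ≤ 1 - b)]
        calc (1 - b) * |D2| ≤ 1 * 1 := mul_le_mul (by linarith) (hd2.trans hE1) (abs_nonneg _) zero_le_one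
          _ = 1 := one_mul 1
      have q6 : |g| ≤ 1 := by
        have : 0 ≤ (1 - b) * (1 - E) := mul_nonneg (by linarith) (by linarith)
        have : (1 - b) * (1 - E) ≤ 1 * 1 := mul_le_mul (by linarith) (by linarith) (by linarith) zero_le_one
        rw [abs_le]
        constructor <;> linarith
      have hfin : 9 * B ≤ 81 * B * E := by nlinarith
      refine ⟨?_, ?_, ?_⟩
      · exact q6.trans (by linarith)
      · rw [hg1]
        exact abs_le.2 ⟨by linarith [(abs_le.1 q4).1, (abs_le.1 q1).1], by linarith [(abs_le.1 q4).2, (abs_le.1 q1).2]⟩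
      · rw [hg2]
        exact abs_le.2 ⟨by linarith [(abs_le.1 q5).1, (abs_le.1 q2).1, (abs_le.1 q3).2],
          by linarith [(abs_le.1 q5).2, (abs_le.1 q2).2, (abs_le.1 q3).1]⟩
    · have h2 : 2 < |t / l| := by rwa [abs_div, abs_of_pos hl, lt_div_iff₀ hl]
      have e0 : b = 0 := stdBump_zero h2.le
      obtain ⟨e1, e2⟩ := deriv_stdBump_zero (Or.inl h2.le)
      have e1' : b1 = 0 := e1
      have e2' : b2 = 0 := e2
      have : E ≤ 81 * B * E := by nlinarith
      rw [hg, hg1, hg2, e0, e1', e2']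
      simp only [sub_zero, one_mul, sub_sub_cancel, zero_div, zero_mul, zero_add, mul_zero]
      rw [abs_of_nonneg hE0]
      exact ⟨this, hd1.trans this, hd2.trans this⟩
  obtain ⟨hg0, hg1', hg2'⟩ := hgs
  have hX : 0 ≤ 81 * B * E := by positivity
  set X := 81 * B * E with hXdef
  have hk : |stdBump (l * t)| ≤ 1 := abs_le.2 ⟨by linarith [stdBump_nonneg (l * t)], stdBump_le_one _⟩
  have hk1 : |l * deriv stdBump (l * t)| ≤ B := by
    rw [abs_mul, abs_of_pos hl]
    calc l * |deriv stdBump (l * t)| ≤ 1 * B := mul_le_mul hl1 (hB _).1 (abs_nonneg _) zero_le_one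
      _ = B := one_mul B
  have hk2 : |l ^ 2 * deriv (deriv stdBump) (l * t)| ≤ B := by
    rw [abs_mul, abs_of_pos (pow_pos hl 2)]
    calc l ^ 2 * |deriv (deriv stdBump) (l * t)| ≤ 1 * B :=
          mul_le_mul (pow_le_one₀ hl.le hl1) (hB _).2 (abs_nonneg _) zero_le_one
      _ = B := one_mul B
  have hE2 : E ^ 2 ≤ (2 + 4 * |t| ^ 2) * Real.exp (-(2 * |t|)) := by
    have : Real.exp (-(2 * |t|)) = Real.exp (-|t|) ^ 2 := by
      rw [sq, ← Real.exp_add]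
      ring_nf
    rw [this, hE, optProfile, mul_pow]
    refine mul_le_mul_of_nonneg_right ?_ (sq_nonneg _)
    nlinarith [sq_nonneg (|t| - 1), sq_nonneg t]
  calc _ ≤ 25 * (B * X) ^ 2 := product_jet_sq_le hB1 hX hk hk1 hk2 hg0 hg1' hg2'
    _ = 25 * (B * (81 * B)) ^ 2 * E ^ 2 := by rw [hXdef]; ring
    _ ≤ _ := mul_le_mul_of_nonneg_left hE2 (by positivity)

/-- For fixed `t ≠ 0` both modifications disappear once `l` is small, so the sequence is eventually
constant. -/
theorem tendsto_profileEnergy {t : ℝ} (ht : t ≠ 0) :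
    Tendsto (fun n : ℕ => profileEnergy (profile (1 / ((n : ℝ) + 1))) t) atTop
      (𝓝 ((2 + 4 * |t| ^ 2) * Real.exp (-(2 * |t|)))) := by
  refine tendsto_const_nhds.congr' ?_
  have hlim : Tendsto (fun n : ℕ => 1 / ((n : ℝ) + 1)) atTop (𝓝 0) :=
    tendsto_one_div_add_atTop_nhds_zero_nat
  have hta : 0 < |t| := abs_pos.2 ht
  filter_upwards [hlim.eventually (gt_mem_nhds (half_pos hta)),
    hlim.eventually (gt_mem_nhds (inv_pos.2 hta))] with n h1 h2
  set l : ℝ := 1 / ((n : ℝ) + 1) with hl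
  have hl0 : 0 < l := by positivity
  have a1 : 2 < |t / l| := by
    rw [abs_div, abs_of_pos hl0, lt_div_iff₀ hl0]
    linarith
  have a2 : |l * t| < 1 := by
    rw [abs_mul, abs_of_pos hl0]
    rwa [← one_div, lt_div_iff₀ hta] at h2
  rw [profileEnergy, (hasDerivAt_deriv_profile ht).deriv, (hasDerivAt_profile ht).deriv, profile,
    stdBump_zero a1.le, stdBump_one a2.le, (deriv_stdBump_zero (Or.inl a1.le)).1,
    (deriv_stdBump_zero (Or.inl a1.le)).2, (deriv_stdBump_zero (Or.inr a2.le)).1,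
    (deriv_stdBump_zero (Or.inr a2.le)).2, optProfile]
  have : Real.exp (-(2 * |t|)) = Real.exp (-|t|) ^ 2 := by
    rw [sq, ← Real.exp_add]
    ring_nf
  rw [this]
  have h3 : |t| ^ 2 = t ^ 2 := sq_abs t
  linear_combination (2 * Real.exp (-|t|) ^ 2) * h3

/-- Away from the origin the optimal profile lies strictly between 0 and 1. There the value 0 forces
the outer cutoff to vanish, and the value 1 forces both cutoffs to equal 1. `stdBump` takes its
extreme values exactly on closed sets on which its first two derivatives vanish. -/
theorem deriv_deriv_profile_eq_zero {l t : ℝ} (hl : 0 < l) (ht : profile l t = 0 ∨ profile l t = 1) :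
    deriv (deriv (profile l)) t = 0 := by
  by_cases h0 : t = 0
  · subst h0
    refine (deriv_eq_zero_of_frequently_const (contDiff_profile hl) (v := 1)
      (S := {t | |t / l| < 1} ∩ {t | |l * t| < 1})
      ((isOpen_lt (by fun_prop) continuous_const).inter (isOpen_lt (by fun_prop) continuous_const))
      (subset_closure (by simp)) fun y hy => ?_).2
    rw [profile, stdBump_one (le_of_lt hy.1), stdBump_one (le_of_lt hy.2)]
    simp
  have ho1 : 0 < optProfile t := by unfold optProfile; positivity
  have ho2 : optProfile t < 1 := by
    have h1 := Real.add_one_lt_exp (abs_ne_zero.2 h0)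
    have h2 : Real.exp |t| * Real.exp (-|t|) = 1 := by rw [← Real.exp_add]; simp
    unfold optProfile
    nlinarith [Real.exp_pos (-|t|)]
  have b0 := stdBump_nonneg (t / l)
  have b1 := stdBump_le_one (t / l)
  have c0 := stdBump_nonneg (l * t)
  have c1 := stdBump_le_one (l * t)
  rw [(hasDerivAt_deriv_profile h0).deriv]
  rw [profile] at ht
  rcases ht with ht | ht
  · have hz : stdBump (l * t) = 0 := by
      rcases mul_eq_zero.1 ht with h | h
      · exact h
      · nlinarith
    obtain ⟨e1, e2⟩ := deriv_stdBump_zero (Or.inl (stdBump_eq_zero_iff.1 hz))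
    rw [hz, e1, e2]
    ring
  · have hp : 0 ≤ (1 - stdBump (t / l)) * (1 - optProfile t) :=
      mul_nonneg (by linarith) (by linarith)
    have hq : (1 - stdBump (t / l)) * (1 - optProfile t) ≤ 1 := by nlinarith
    have h1 : stdBump (l * t) = 1 := by nlinarith
    rw [h1, one_mul] at ht
    have h2 : stdBump (t / l) = 1 := by
      have h3 : (1 - stdBump (t / l)) * (1 - optProfile t) = 0 := by linarith
      rcases mul_eq_zero.1 h3 with h | h <;> linarith
    obtain ⟨e1, e2⟩ := deriv_stdBump_zero (Or.inr (stdBump_eq_one_iff.1 h1))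
    obtain ⟨e3, e4⟩ := deriv_stdBump_zero (Or.inr (stdBump_eq_one_iff.1 h2))
    rw [h1, h2, e1, e2, e3, e4]
    ring

/-- Dominated convergence as `l → 0`. Being 1 near the origin makes the phase field vanish exactly
near the triangle, compact support keeps the transition in a tube, and flatness at the values 0 and
1 is what makes clamping harmless. -/
theorem exists_profile {δ : ℝ} (hδ : 0 < δ) : ∃ (w : ℝ → ℝ) (l K : ℝ), 0 < l ∧ 0 < K ∧
    ContDiff ℝ ∞ w ∧ (∀ t, 0 ≤ w t ∧ w t ≤ 1) ∧ (∀ t, |t| ≤ l → w t = 1) ∧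
    (∀ t, K ≤ |t| → w t = 0) ∧ (∀ t, w t = 0 ∨ w t = 1 → deriv (deriv w) t = 0) ∧
    ∫⁻ t, ENNReal.ofReal (profileEnergy w t) ≤ ENNReal.ofReal (4 + δ) := by
  obtain ⟨C, hC, hb⟩ := exists_profileEnergy_bound
  obtain ⟨hi, hv⟩ := integral_optProfile_energy
  have hmeas : ∀ n : ℕ, Measurable fun t =>
      ENNReal.ofReal (profileEnergy (profile (1 / ((n : ℝ) + 1))) t) := by
    intro n
    have hc : Measurable (profile (1 / ((n : ℝ) + 1))) :=
      (contDiff_profile (by positivity)).continuous.measurable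
    refine ENNReal.measurable_ofReal.comp ?_
    exact ((hc.pow_const 2).add (((measurable_deriv _).pow_const 2).const_mul 2)).add
      ((measurable_deriv _).pow_const 2)
  have hne : ∀ᵐ t : ℝ, t ≠ 0 := by
    simp [ae_iff]
  have hlim := tendsto_lintegral_of_dominated_convergence
    (bound := fun t => ENNReal.ofReal (C * ((2 + 4 * |t| ^ 2) * Real.exp (-(2 * |t|))))) hmeas
    (f := fun t => ENNReal.ofReal ((2 + 4 * |t| ^ 2) * Real.exp (-(2 * |t|)))) (fun n => by
      filter_upwards [hne] with t ht
      refine ENNReal.ofReal_le_ofReal (hb _ (by positivity) ?_ t ht)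
      rw [div_le_one (by positivity)]
      linarith [Nat.cast_nonneg (α := ℝ) n])
    ((hi.const_mul C).lintegral_lt_top.ne) (by
      filter_upwards [hne] with t ht
      exact ENNReal.tendsto_ofReal (tendsto_profileEnergy ht))
  rw [← ofReal_integral_eq_lintegral_ofReal hi (ae_of_all _ fun t => by positivity), hv] at hlim
  have hlt : ENNReal.ofReal 4 < ENNReal.ofReal (4 + δ) :=
    (ENNReal.ofReal_lt_ofReal_iff (by positivity)).2 (by linarith)
  obtain ⟨n, hn⟩ := (hlim.eventually (gt_mem_nhds hlt)).exists
  set l : ℝ := 1 / ((n : ℝ) + 1) with hl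
  have hl0 : 0 < l := by positivity
  have hl1 : l ≤ 1 := by
    rw [hl, div_le_one (by positivity)]
    linarith [Nat.cast_nonneg (α := ℝ) n]
  refine ⟨profile l, l, 2 / l, hl0, by positivity, contDiff_profile hl0, fun t => ?_, fun t ht => ?_,
    fun t ht => ?_, fun t ht => deriv_deriv_profile_eq_zero hl0 ht, hn.le⟩
  · obtain ⟨hE0, hE1, -⟩ := optProfile_bounds t
    have b0 := stdBump_nonneg (t / l)
    have b1 := stdBump_le_one (t / l)
    have c0 := stdBump_nonneg (l * t)
    have c1 := stdBump_le_one (l * t)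
    have p0 : 0 ≤ (1 - stdBump (t / l)) * (1 - optProfile t) := mul_nonneg (by linarith) (by linarith)
    have p1 : (1 - stdBump (t / l)) * (1 - optProfile t) ≤ 1 * 1 :=
      mul_le_mul (by linarith) (by linarith) (by linarith) zero_le_one
    unfold profile
    exact ⟨mul_nonneg c0 (by linarith), mul_le_one₀ c1 (by linarith) (by linarith)⟩
  · have h1 : |t / l| ≤ 1 := by rwa [abs_div, abs_of_pos hl0, div_le_one hl0]
    have h2 : |l * t| ≤ 1 := by
      rw [abs_mul, abs_of_pos hl0]
      nlinarith [abs_nonneg t]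
    rw [profile, stdBump_one h1, stdBump_one h2]
    simp
  · have h2 : 2 ≤ |l * t| := by
      rw [abs_mul, abs_of_pos hl0]
      rw [div_le_iff₀ hl0] at ht
      linarith
    rw [profile, stdBump_zero h2, zero_mul]

/-! ### Integrals over neighbourhoods of flat sets -/

theorem exists_unit_normal (J : Affine.Simplex ℝ E3 2) : ∃ n : E3, ‖n‖ = 1 ∧
    ∀ x ∈ J.closedInterior, inner ℝ n (x - J.points 0) = 0 := by
  set W := vectorSpan ℝ (Set.range J.points) with hW
  have hfin : Module.finrank ℝ W = 2 := J.independent.finrank_vectorSpan (by simp)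
  have hne : Wᗮ ≠ ⊥ := by
    intro h
    rw [Submodule.orthogonal_eq_bot_iff] at h
    rw [h, finrank_top] at hfin
    simp at hfin
  obtain ⟨v, hv, hv0⟩ := (Submodule.ne_bot_iff _).1 hne
  refine ⟨‖v‖⁻¹ • v, by rw [norm_smul, norm_inv, norm_norm, inv_mul_cancel₀ (norm_ne_zero_iff.2 hv0)],
    fun x hx => ?_⟩
  have h1 : x - J.points 0 ∈ W := by
    have h2 := J.closedInterior_subset_affineSpan hx
    have h3 : J.points 0 ∈ affineSpan ℝ (Set.range J.points) := mem_affineSpan ℝ ⟨0, rfl⟩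
    have := AffineSubspace.vsub_mem_direction h2 h3
    rwa [direction_affineSpan] at this
  rw [inner_smul_left, (Submodule.mem_orthogonal' _ _).1 hv _ h1, mul_zero]

/-- Fubini in the splitting into the normal line and the plane orthogonal to it. The thickening of
`K` projects into the thickening of the projection `T` of `K`, whose planar measure is close to that
of the compact set `T`. -/
theorem hausdorff_lt_top_and_lintegral_cthickening_le {K : Set E3} (hK : IsCompact K) {n p : E3}
    (hn : ‖n‖ = 1) (hnK : ∀ x ∈ K, inner ℝ n (x - p) = 0) :
    Measure.euclideanHausdorffMeasure 2 K < ⊤ ∧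
    ∀ δ : ℝ, 0 < δ → ∃ ρ > 0, ∀ f : ℝ → ℝ≥0∞, Measurable f →
      ∫⁻ x in Metric.cthickening ρ K, f (inner ℝ n (x - p)) ≤
        (Measure.euclideanHausdorffMeasure 2 K + ENNReal.ofReal δ) * ∫⁻ t, f t := by
  set s : Submodule ℝ E3 := Submodule.span ℝ {n} with hs
  have hn0 : n ≠ 0 := by
    rintro rfl
    simp at hn
  have hsfin : Module.finrank ℝ s = 1 := finrank_span_singleton hn0
  have hofin : Module.finrank ℝ sᗮ = 2 := by
    have := s.finrank_add_finrank_orthogonal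
    rw [hsfin, finrank_euclideanSpace_fin] at this
    omega
  have hmp : MeasurePreserving (s.measurableEquivProd p) (volume : Measure E3) volume := by
    have := s.measurePreserving_measurableEquivProd p
    rwa [finrank_euclideanSpace_fin, EuclideanSpace.euclideanHausdorffMeasure_eq_volume] at this
  set q : E3 → sᗮ := fun x => sᗮ.orthogonalProjectionOnto (x - p) with hq
  have hqd : ∀ x y, dist (q x) (q y) ≤ dist x y := by
    intro x y
    rw [hq]
    simp only
    rw [dist_eq_norm, ← map_sub, dist_eq_norm]
    refine (Submodule.norm_orthogonalProjectionOnto_apply_le _ _).trans (le_of_eq ?_)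
    congr 1
    abel
  have hqc : Continuous q := by
    refine LipschitzWith.continuous (K := 1) (LipschitzWith.of_dist_le_mul fun x y => ?_)
    simpa using hqd x y
  have hperp : ∀ x ∈ K, x - p ∈ sᗮ := by
    intro x hx
    rw [hs, Submodule.mem_orthogonal_singleton_iff_inner_right]
    exact hnK x hx
  set T : Set sᗮ := q '' K with hT
  have hTc : IsCompact T := hK.image hqc
  -- `K` lies in a translate of the plane, so it is an isometric copy of `T`, and on a plane the
  -- normalised Hausdorff measure is Lebesgue measure.
  have hμ : Measure.euclideanHausdorffMeasure 2 K = volume T := by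
    have hiso : Isometry (fun z : sᗮ => (z : E3) + p) :=
      (IsometryEquiv.addRight p).isometry.comp isometry_subtype_coe
    have himg : K = (fun z : sᗮ => (z : E3) + p) '' T := by
      ext x
      constructor
      · intro hx
        refine ⟨q x, ⟨x, hx, rfl⟩, ?_⟩
        have : ((q x : sᗮ) : E3) = x - p := by
          rw [hq]
          exact congrArg Subtype.val (sᗮ.orthogonalProjectionOnto_mem_subspace_eq_self ⟨x - p, hperp x hx⟩)
        simp only [this, sub_add_cancel]
      · rintro ⟨_, ⟨y, hy, rfl⟩, rfl⟩
        have : ((q y : sᗮ) : E3) = y - p := by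
          rw [hq]
          exact congrArg Subtype.val (sᗮ.orthogonalProjectionOnto_mem_subspace_eq_self ⟨y - p, hperp y hy⟩)
        simpa only [this, sub_add_cancel] using hy
    rw [himg, hiso.euclideanHausdorffMeasure_image, ← hofin,
      InnerProductSpace.euclideanHausdorffMeasure_eq_volume]
  have hTfin : volume T < ⊤ := hTc.measure_lt_top
  refine ⟨hμ ▸ hTfin, fun δ hδ => ?_⟩
  have hlim := tendsto_measure_cthickening_of_isCompact (μ := (volume : Measure sᗮ)) hTc
  have hev := hlim.eventually (gt_mem_nhds (ENNReal.lt_add_right hTfin.ne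
    (ENNReal.ofReal_pos.2 hδ).ne'))
  obtain ⟨ρ, hρ, hρ'⟩ := Metric.eventually_nhds_iff.1 hev
  have hρ2 : 0 < ρ / 2 := half_pos hρ
  refine ⟨ρ / 2, hρ2, fun f hf => ?_⟩
  have hvol : volume (Metric.cthickening (ρ / 2) T) < volume T + ENNReal.ofReal δ :=
    hρ' (by rw [Real.dist_eq, sub_zero, abs_of_pos hρ2]; exact half_lt_self hρ)
  have hsub : ∀ x ∈ Metric.cthickening (ρ / 2) K, q x ∈ Metric.cthickening (ρ / 2) T := by
    intro x hx
    rw [hK.cthickening_eq_biUnion_closedBall hρ2.le] at hx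
    rw [hTc.cthickening_eq_biUnion_closedBall hρ2.le]
    simp only [mem_iUnion, Metric.mem_closedBall, exists_prop] at hx ⊢
    obtain ⟨y, hy, hxy⟩ := hx
    exact ⟨q y, ⟨y, hy, rfl⟩, (hqd x y).trans hxy⟩
  have hg : ∀ x : E3, inner ℝ n (x - p) = inner ℝ n ((s.orthogonalProjectionOnto (x - p) : s) : E3) := by
    intro x
    have := s.inner_orthogonalProjectionOnto_eq_of_mem_left ⟨n, Submodule.mem_span_singleton_self n⟩ (x - p)
    simpa using this.symm
  have hmeas1 : Measurable (fun a : s => f (inner ℝ n (a : E3))) := hf.comp (by fun_prop)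
  have hTm : MeasurableSet (Metric.cthickening (ρ / 2) T) := Metric.isClosed_cthickening.measurableSet
  have hKm : MeasurableSet (Metric.cthickening (ρ / 2) K) := Metric.isClosed_cthickening.measurableSet
  set g : s × sᗮ → ℝ≥0∞ := fun z => f (inner ℝ n (z.1 : E3)) *
    (Metric.cthickening (ρ / 2) T).indicator 1 z.2 with hgdef
  have hgm : Measurable g :=
    (hmeas1.comp measurable_fst).mul ((measurable_one.indicator hTm).comp measurable_snd)
  have hline : ∫⁻ a : s, f (inner ℝ n (a : E3)) = ∫⁻ t, f t := by
    have h1 := (LinearIsometryEquiv.toSpanUnitSingleton (𝕜 := ℝ) n hn).measurePreserving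
    rw [← h1.lintegral_comp hmeas1]
    congr 1
    ext t
    simp [inner_smul_right, hn]
  calc ∫⁻ x in Metric.cthickening (ρ / 2) K, f (inner ℝ n (x - p))
      ≤ ∫⁻ x, g (s.measurableEquivProd p x) := by
        rw [← lintegral_indicator hKm]
        refine lintegral_mono fun x => ?_
        by_cases hx : x ∈ Metric.cthickening (ρ / 2) K
        · have h2 := hsub x hx
          simp only [hq] at h2
          simp only [indicator_of_mem hx, hgdef, Submodule.measurableEquivProd_apply, vsub_eq_sub]
          rw [indicator_of_mem h2, hg x]
          simp
        · simp [hx]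
    _ = ∫⁻ z, g z := hmp.lintegral_comp hgm
    _ = (∫⁻ a : s, f (inner ℝ n (a : E3))) *
        ∫⁻ b : sᗮ, (Metric.cthickening (ρ / 2) T).indicator 1 b := by
        rw [Measure.volume_eq_prod]
        exact lintegral_prod_mul hmeas1.aemeasurable (measurable_one.indicator hTm).aemeasurable
    _ = (∫⁻ t, f t) * volume (Metric.cthickening (ρ / 2) T) := by
        rw [hline, lintegral_indicator_one hTm]
    _ ≤ _ := by
        rw [mul_comm, hμ]
        gcongr

/-! ### Bounds for the parametrization -/

theorem MemWkInf.memLp {O : Set E3} {k : ℕ} {f : E3 → ℝ} (h : MemWkInf O k f) :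
    MemLp f ⊤ (volume.restrict O) := by
  cases k with
  | zero => exact h
  | succ k => exact h.1

theorem MemWkInf.exists_uniformlyLocLip {O : Set E3} (hO : IsOpen O) {k : ℕ} {f : E3 → ℝ}
    (h : MemWkInf O (k + 1) f) : ∃ (L B : ℝ) (f' : E3 → ℝ), 0 ≤ L ∧ 0 ≤ B ∧
      f =ᵐ[volume.restrict O] f' ∧ (∀ x, |f' x| ≤ B) ∧ UniformlyLocLip L O f' :=
  exists_uniformlyLocLip_of_weakPartials hO h.1 fun i => by
    obtain ⟨g, hg, hgW⟩ := h.2 i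
    exact ⟨g, hg, hgW.memLp⟩

theorem UniformlyLocLip.congr {L : ℝ} {O : Set E3} {f g : E3 → ℝ}
    (hf : UniformlyLocLip L O f) (hfg : EqOn f g O) : UniformlyLocLip L O g := by
  intro x hx
  obtain ⟨r, hr, hrO, h⟩ := hf x hx
  refine ⟨r, hr, hrO, fun y hy z hz => ?_⟩
  rw [← hfg (hrO hy), ← hfg (hrO hz)]
  exact h y hy z hz

theorem ContDiffOn.locallyLipschitzOn' {O : Set E3} (hO : IsOpen O) {f : E3 → ℝ}
    (hf : ContDiffOn ℝ 1 f O) : LocallyLipschitzOn O f := by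
  intro x hx
  obtain ⟨K, t, ht, h⟩ := (hf.contDiffAt (hO.mem_nhds hx)).exists_lipschitzOnWith
  exact ⟨K, t, mem_nhdsWithin_of_mem_nhds ht, h⟩

/-- The classical partial derivative is a weak one, hence equals the Lipschitz representative of the
given weak derivative almost everywhere. Both are continuous on the open set, so they agree at every
point. -/
theorem MemWkInf.fderiv_bounds {O : Set E3} (hO : IsOpen O) {f : E3 → ℝ}
    (hf : ContDiffOn ℝ 1 f O) (hW : MemWkInf O 2 f) (i : Fin 3) :
    ∃ L : ℝ, 0 ≤ L ∧ (∀ x ∈ O, |fderiv ℝ f x (EuclideanSpace.single i (1 : ℝ))| ≤ L) ∧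
      UniformlyLocLip L O (fun x => fderiv ℝ f x (EuclideanSpace.single i (1 : ℝ))) := by
  obtain ⟨g, hg, hgW⟩ := hW.2 i
  obtain ⟨L, B, g', hL, hB, hgg', hbd, hlip⟩ := hgW.exists_uniformlyLocLip hO
  have h1 := hg.ae_eq hO (isWeakPartial_fderiv hO (hf.locallyLipschitzOn' hO) i)
  have hcont : ContinuousOn (fun x => fderiv ℝ f x (EuclideanSpace.single i (1 : ℝ))) O :=
    (hf.continuousOn_fderiv_of_isOpen hO le_rfl).clm_apply continuousOn_const
  have heq : EqOn g' (fun x => fderiv ℝ f x (EuclideanSpace.single i (1 : ℝ))) O :=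
    Measure.eqOn_open_of_ae_eq (μ := volume) (hgg'.symm.trans h1) hO
      hlip.locallyLipschitzOn.continuousOn hcont
  refine ⟨max L B, le_max_of_le_left hL, fun x hx => ?_,
    (hlip.congr heq).mono hO subset_rfl (le_max_left _ _)⟩
  have := heq hx
  simp only at this
  rw [← this]
  exact (hbd x).trans (le_max_right _ _)

theorem norm_le_sum_abs (w : E3) : ‖w‖ ≤ |w 0| + |w 1| + |w 2| := by
  conv_lhs => rw [TensorMesh.eq_sum_single w]
  refine (norm_add₃_le).trans ?_
  simp [norm_smul]

theorem opNorm_le_of_entries {T : E3 →L[ℝ] E3} {L : ℝ} (hL : 0 ≤ L)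
    (h : ∀ i a, |T (EuclideanSpace.single i (1 : ℝ)) a| ≤ L) : ‖T‖ ≤ 9 * L := by
  refine ContinuousLinearMap.opNorm_le_bound _ (by positivity) fun v => ?_
  have hcol : ∀ i, ‖T (EuclideanSpace.single i (1 : ℝ))‖ ≤ 3 * L := fun i => by
    refine (norm_le_sum_abs _).trans ?_
    linarith [h i 0, h i 1, h i 2]
  have hv : ∀ i, |v i| ≤ ‖v‖ := fun i => by simpa using PiLp.norm_apply_le v i
  conv_lhs => rw [TensorMesh.eq_sum_single v]
  simp only [map_add, map_smul]
  refine (norm_add₃_le).trans ?_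
  simp only [norm_smul, Real.norm_eq_abs]
  have : ∀ i, |v i| * ‖T (EuclideanSpace.single i (1 : ℝ))‖ ≤ ‖v‖ * (3 * L) := fun i =>
    mul_le_mul (hv i) (hcol i) (norm_nonneg _) (norm_nonneg _)
  linarith [this 0, this 1, this 2]

theorem fderiv_coord {H : E3 → E3} {x : E3} (h : DifferentiableAt ℝ H x) (a : Fin 3) :
    HasFDerivAt (fun y => H y a) ((EuclideanSpace.proj a : E3 →L[ℝ] ℝ).comp (fderiv ℝ H x)) x :=
  (EuclideanSpace.proj a : E3 →L[ℝ] ℝ).hasFDerivAt.comp x h.hasFDerivAt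

theorem convex_patch : Convex ℝ patch := by
  intro x hx y hy s t hs ht hst a
  simp only [PiLp.add_apply, PiLp.smul_apply, smul_eq_mul]
  exact (convex_Ioo (0 : ℝ) 1) (hx a) (hy a) hs ht hst

theorem MemWkInfVec.fderiv_bounds {O : Set E3} (hO : IsOpen O) {H : E3 → E3}
    (hH : ContDiffOn ℝ 1 H O) (hW : MemWkInfVec O 2 H) : ∃ L : ℝ, 0 ≤ L ∧
      (∀ x ∈ O, ‖fderiv ℝ H x‖ ≤ 9 * L) ∧
      ∀ i a, UniformlyLocLip L O (fun x => fderiv ℝ H x (EuclideanSpace.single i (1 : ℝ)) a) := by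
  have hd : ∀ x ∈ O, DifferentiableAt ℝ H x := fun x hx =>
    (hH.differentiableOn one_ne_zero).differentiableAt (hO.mem_nhds hx)
  have hc : ∀ a, ContDiffOn ℝ 1 (fun x => H x a) O := fun a =>
    (EuclideanSpace.proj a : E3 →L[ℝ] ℝ).contDiff.comp_contDiffOn hH
  choose L hL hb hlip using fun a i => (hW a).fderiv_bounds hO (hc a) i
  have heq : ∀ a i, EqOn (fun x => fderiv ℝ (fun x => H x a) x (EuclideanSpace.single i (1 : ℝ)))
      (fun x => fderiv ℝ H x (EuclideanSpace.single i (1 : ℝ)) a) O := by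
    intro a i x hx
    simp only [(fderiv_coord (hd x hx) a).fderiv]
    rfl
  have hle : ∀ a i, L a i ≤ ∑ a, ∑ i, L a i := fun a i =>
    (Finset.single_le_sum (f := fun i => L a i) (fun i _ => hL a i) (Finset.mem_univ i)).trans
      (Finset.single_le_sum (f := fun a => ∑ i, L a i)
        (fun a _ => Finset.sum_nonneg fun i _ => hL a i) (Finset.mem_univ a))
  have hL0 : 0 ≤ ∑ a, ∑ i, L a i := Finset.sum_nonneg fun a _ => Finset.sum_nonneg fun i _ => hL a i
  refine ⟨∑ a, ∑ i, L a i, hL0, fun x hx => opNorm_le_of_entries hL0 fun i a => ?_, fun i a =>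
    ((hlip a i).congr (heq a i)).mono hO subset_rfl (hle a i)⟩
  have := hb a i x hx
  have h2 := heq a i hx
  simp only at h2
  rw [h2] at this
  exact this.trans (hle a i)

/-- The quantitative properties of the parametrization used for the approximation. -/
structure DiffeoBounds (F G : E3 → E3) (Ω : Set E3) (L : ℝ) : Prop where
  one_le : 1 ≤ L
  isOpen : IsOpen Ω
  mapsTo : MapsTo F patch Ω
  mapsTo_inv : MapsTo G Ω patch
  left_inv : ∀ y ∈ patch, G (F y) = y
  right_inv : ∀ x ∈ Ω, F (G x) = x
  differentiableAt : ∀ y ∈ patch, DifferentiableAt ℝ F y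
  contDiffOn_inv : ContDiffOn ℝ 1 G Ω
  norm_fderiv_le : ∀ y ∈ patch, ‖fderiv ℝ F y‖ ≤ L
  fderiv_lip : ∀ y ∈ patch, ∀ z ∈ patch, ‖fderiv ℝ F y - fderiv ℝ F z‖ ≤ L * dist y z
  norm_fderiv_inv_le : ∀ x ∈ Ω, ‖fderiv ℝ G x‖ ≤ L
  fderiv_inv_locLip : ∀ i a,
    UniformlyLocLip L Ω (fun x => fderiv ℝ G x (EuclideanSpace.single i (1 : ℝ)) a)

/-- The patch is convex, so the derivative of `F` is globally Lipschitz on it. The derivative of `G`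
is only locally Lipschitz with a uniform constant, because `Ω` has no geometry; this is enough to
bound its derivatives. -/
theorem IsW2InfDiffeo.exists_bounds {F G : E3 → E3} {Ω : Set E3} (hΩ : IsOpen Ω)
    (h : IsW2InfDiffeo F G Ω) : ∃ L, DiffeoBounds F G Ω L := by
  have hp := TensorMesh.isOpen_patch
  obtain ⟨L₁, hL₁, hb₁, hlip₁⟩ := h.memW.fderiv_bounds hp h.contDiffOn
  obtain ⟨L₂, hL₂, hb₂, hlip₂⟩ := h.memW_inv.fderiv_bounds hΩ h.contDiffOn_inv
  have e1 : 9 * L₁ ≤ 1 + 9 * L₁ + 9 * L₂ := by linarith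
  have e2 : 9 * L₂ ≤ 1 + 9 * L₁ + 9 * L₂ := by linarith
  refine ⟨1 + 9 * L₁ + 9 * L₂, by linarith, hΩ, h.mapsTo, h.mapsTo_inv, fun y hy => h.invOn.1 hy,
    fun x hx => h.invOn.2 hx,
    fun x hx => (h.contDiffOn.differentiableOn one_ne_zero).differentiableAt (hp.mem_nhds hx),
    h.contDiffOn_inv, fun y hy => (hb₁ y hy).trans e1, fun y hy z hz => ?_,
    fun x hx => (hb₂ x hx).trans e2, fun i a => (hlip₂ i a).mono hΩ subset_rfl (by linarith)⟩
  have hd : 0 ≤ dist y z := dist_nonneg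
  refine (opNorm_le_of_entries (L := L₁ * dist y z) (by positivity) fun i a => ?_).trans ?_
  · exact (hlip₁ i a).le_of_segment_subset (convex_patch.segment_subset hy hz)
  · nlinarith

namespace DiffeoBounds

variable {F G : E3 → E3} {Ω : Set E3} {L : ℝ}

theorem pos (h : DiffeoBounds F G Ω L) : 0 < L := one_pos.trans_le h.one_le

theorem dist_le (h : DiffeoBounds F G Ω L) {y z : E3} (hy : y ∈ patch) (hz : z ∈ patch) : dist (F y) (F z) ≤ L * dist y z := by
  rw [dist_eq_norm, dist_eq_norm]
  exact convex_patch.norm_image_sub_le_of_norm_fderiv_le h.differentiableAt h.norm_fderiv_le hz hy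

theorem taylor (h : DiffeoBounds F G Ω L) {y z : E3} (hy : y ∈ patch) (hz : z ∈ patch) :
    ‖F y - F z - fderiv ℝ F z (y - z)‖ ≤ L * dist y z ^ 2 := by
  have hseg : segment ℝ z y ⊆ patch := convex_patch.segment_subset hz hy
  have := (convex_segment z y).norm_image_sub_le_of_norm_hasFDerivWithin_le'
    (f := F) (f' := fun w => fderiv ℝ F w) (φ := fderiv ℝ F z) (C := L * dist y z)
    (fun w hw => (h.differentiableAt w (hseg hw)).hasFDerivAt.hasFDerivWithinAt)
    (fun w hw => (h.fderiv_lip w (hseg hw) z hz).trans (by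
      have : dist w z ≤ dist y z := by
        rw [dist_comm w z, dist_comm y z]
        obtain ⟨t, ht, rfl⟩ := (segment_eq_image_lineMap ℝ z y) ▸ hw
        rw [dist_left_lineMap, Real.norm_of_nonneg ht.1]
        exact mul_le_of_le_one_left dist_nonneg ht.2
      exact mul_le_mul_of_nonneg_left this h.pos.le))
    (left_mem_segment ℝ z y) (right_mem_segment ℝ z y)
  refine this.trans (le_of_eq ?_)
  rw [← dist_eq_norm]
  ring

theorem differentiableAt_inv (h : DiffeoBounds F G Ω L) {x : E3} (hx : x ∈ Ω) : DifferentiableAt ℝ G x :=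
  (h.contDiffOn_inv.differentiableOn one_ne_zero).differentiableAt (h.isOpen.mem_nhds hx)

theorem fderiv_comp_inv (h : DiffeoBounds F G Ω L) {x : E3} (hx : x ∈ Ω) (v : E3) :
    fderiv ℝ F (G x) (fderiv ℝ G x v) = v := by
  have h1 := (h.differentiableAt (G x) (h.mapsTo_inv hx)).hasFDerivAt.comp x
    (h.differentiableAt_inv hx).hasFDerivAt
  have h2 : HasFDerivAt (F ∘ G) (ContinuousLinearMap.id ℝ E3) x := by
    refine (hasFDerivAt_id x).congr_of_eventuallyEq ?_
    filter_upwards [h.isOpen.mem_nhds hx] with z hz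
    exact h.right_inv z hz
  exact congrArg (fun T : E3 →L[ℝ] E3 => T v) (h1.unique h2)

end DiffeoBounds

/-! ### Weak derivatives of push-forwards of splines -/

theorem LocallyLipschitzOn.comp_mapsTo {α β γ : Type*} [PseudoEMetricSpace α]
    [PseudoEMetricSpace β] [PseudoEMetricSpace γ] {s : Set α} {t : Set β} {g : β → γ} {f : α → β}
    (hg : LocallyLipschitzOn t g) (hf : LocallyLipschitzOn s f) (h : MapsTo f s t) :
    LocallyLipschitzOn s (fun x => g (f x)) := by
  intro x hx
  obtain ⟨K, u, hu, hK⟩ := hf hx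
  obtain ⟨K', v, hv, hK'⟩ := hg (h hx)
  have hc : ContinuousWithinAt f s x := hf.continuousOn x hx
  refine ⟨K' * K, u ∩ f ⁻¹' v, inter_mem hu ?_, ?_⟩
  · exact (hc.tendsto_nhdsWithin h) hv
  · exact hK'.comp (hK.mono inter_subset_left) fun y hy => hy.2

theorem LocallyLipschitzOn.fun_add_real {s : Set E3} {f g : E3 → ℝ} (hf : LocallyLipschitzOn s f)
    (hg : LocallyLipschitzOn s g) : LocallyLipschitzOn s (fun x => f x + g x) := by
  intro x hx
  obtain ⟨K, u, hu, hK⟩ := hf hx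
  obtain ⟨K', v, hv, hK'⟩ := hg hx
  exact ⟨K + K', u ∩ v, inter_mem hu hv,
    (hK.mono inter_subset_left).add (hK'.mono inter_subset_right)⟩

theorem LocallyLipschitzOn.fun_mul_real {s : Set E3} {f g : E3 → ℝ} (hf : LocallyLipschitzOn s f)
    (hg : LocallyLipschitzOn s g) : LocallyLipschitzOn s (fun x => f x * g x) := by
  have h : LocallyLipschitzOn s (fun x => (f x, g x)) := by
    intro x hx
    obtain ⟨K, u, hu, hK⟩ := hf hx
    obtain ⟨K', v, hv, hK'⟩ := hg hx
    exact ⟨max K K', u ∩ v, inter_mem hu hv,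
      (hK.mono inter_subset_left).prodMk (hK'.mono inter_subset_right)⟩
  have hm : LocallyLipschitzOn univ (fun p : ℝ × ℝ => p.1 * p.2) :=
    (ContDiff.locallyLipschitz (𝕂 := ℝ) (contDiff_fst.mul contDiff_snd)).locallyLipschitzOn
  exact hm.comp_mapsTo h (mapsTo_univ _ _)

theorem LocallyLipschitzOn.fun_sum_real {ι : Type*} (t : Finset ι) {s : Set E3} {f : ι → E3 → ℝ}
    (hf : ∀ i ∈ t, LocallyLipschitzOn s (f i)) :
    LocallyLipschitzOn s (fun x => ∑ i ∈ t, f i x) := by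
  classical
  induction t using Finset.induction_on with
  | empty =>
    simp only [Finset.sum_empty]
    exact (LocallyLipschitz.const (0 : ℝ)).locallyLipschitzOn
  | insert a t ha ih =>
    simp only [Finset.sum_insert ha]
    exact (hf a (Finset.mem_insert_self _ _)).fun_add_real
      (ih fun i hi => hf i (Finset.mem_insert_of_mem hi))

theorem UnitPartition.locallyLipschitzOn_jet (P : UnitPartition) (j : ℕ) {r : ℕ} (hr : r ≤ 1) :
    LocallyLipschitzOn (Ioo (0 : ℝ) 1) (P.jet j r) := by
  interval_cases r
  · have hd : ContDiffOn ℝ 1 (P.jet j 0) (Ioo (0 : ℝ) 1) := by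
      rw [show (1 : WithTop ℕ∞) = 0 + 1 from rfl, contDiffOn_succ_iff_deriv_of_isOpen isOpen_Ioo]
      refine ⟨fun s hs => (P.hasDerivAt_jet_zero j hs).differentiableAt.differentiableWithinAt,
        by simp, ?_⟩
      rw [contDiffOn_zero]
      exact (P.locallyLipschitzOn_deriv_bspline j).continuousOn
    intro x hx
    obtain ⟨K, t, ht, h⟩ := (hd.contDiffAt (isOpen_Ioo.mem_nhds hx)).exists_lipschitzOnWith
    exact ⟨K, t, mem_nhdsWithin_of_mem_nhds ht, h⟩
  · exact P.locallyLipschitzOn_deriv_bspline j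

theorem locallyLipschitzOn_coord (s : Set E3) (a : Fin 3) :
    LocallyLipschitzOn s (fun y : E3 => y a) :=
  ((EuclideanSpace.proj a : E3 →L[ℝ] ℝ).lipschitz.locallyLipschitz).locallyLipschitzOn

theorem TensorMesh.locallyLipschitzOn_splineJet (M : TensorMesh) (c : (Fin 3 → ℕ) → ℝ)
    {r : Fin 3 → ℕ} (hr : ∀ a, r a ≤ 1) : LocallyLipschitzOn patch (M.splineJet c r) := by
  unfold splineJet
  refine LocallyLipschitzOn.fun_sum_real _ fun j _ => ?_
  refine LocallyLipschitzOn.fun_mul_real (LocallyLipschitz.const (c j)).locallyLipschitzOn ?_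
  have h1 : ∀ a, LocallyLipschitzOn patch (fun y : E3 => (M a).jet (j a) (r a) (y a)) := fun a =>
    ((M a).locallyLipschitzOn_jet (j a) (hr a)).comp_mapsTo (locallyLipschitzOn_coord _ a)
      fun y hy => hy a
  have h2 : M.basisJet j r = fun y => (M 0).jet (j 0) (r 0) (y 0) * (M 1).jet (j 1) (r 1) (y 1) *
      (M 2).jet (j 2) (r 2) (y 2) := by
    ext y
    simp [basisJet, Fin.prod_univ_three]
  rw [h2]
  exact ((h1 0).fun_mul_real (h1 1)).fun_mul_real (h1 2)

theorem ae_coord_ne (a : Fin 3) (t : ℝ) : ∀ᵐ y : E3, y a ≠ t := by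
  have h := (PiLp.volume_preserving_ofLp (Fin 3)).quasiMeasurePreserving.ae
    (p := fun f : Fin 3 → ℝ => f a ≠ t) (by
      rw [ae_iff]
      simp only [ne_eq, not_not]
      rw [volume_pi]
      exact Measure.pi_hyperplane (α := fun _ : Fin 3 => ℝ) _ a t)
  exact h

namespace DiffeoBounds

variable {F G : E3 → E3} {Ω : Set E3} {L : ℝ}

/-- Mesh planes are null and the differentiable map `F` sends null sets to null sets. -/
theorem ae_offMesh (h : DiffeoBounds F G Ω L) (M : TensorMesh) :
    ∀ᵐ x ∂(volume.restrict Ω), M.OffMesh (G x) := by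
  set N : Set E3 := {y | ¬ M.OffMesh y} with hN
  have h0 : volume N = 0 := by
    have : ∀ᵐ y : E3, ∀ a, ∀ k, y a ≠ (M a).x k := by
      rw [ae_all_iff]
      intro a
      rw [ae_all_iff]
      exact fun k => ae_coord_ne a _
    refine measure_mono_null ?_ (ae_iff.1 this)
    intro y hy hy'
    exact hy fun a k _ => hy' a k
  have h1 : volume (F '' (N ∩ patch)) = 0 := by
    refine addHaar_image_eq_zero_of_differentiableOn_of_addHaar_eq_zero _
      (fun y hy => (h.differentiableAt y hy.2).differentiableWithinAt)
      (measure_mono_null inter_subset_left h0)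
  rw [ae_restrict_iff' h.isOpen.measurableSet, ae_iff]
  refine measure_mono_null (fun x hx => ?_) h1
  simp only [Classical.not_imp, Set.mem_ofPred_eq] at hx
  exact ⟨G x, ⟨hx.2, h.mapsTo_inv hx.1⟩, h.right_inv x hx.1⟩

theorem locallyLipschitzOn_inv (h : DiffeoBounds F G Ω L) : LocallyLipschitzOn Ω G := by
  intro x hx
  obtain ⟨K, t, ht, h⟩ := (h.contDiffOn_inv.contDiffAt (h.isOpen.mem_nhds hx)).exists_lipschitzOnWith
  exact ⟨K, t, mem_nhdsWithin_of_mem_nhds ht, h⟩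

/-- The classical gradient of the push-forward of a spline. -/
theorem hasFDerivAt_pushforward (h : DiffeoBounds F G Ω L) (M : TensorMesh)
    (c : (Fin 3 → ℕ) → ℝ) {x : E3} (hx : x ∈ Ω) :
    HasFDerivAt (fun x => M.splineJet c 0 (G x))
      ((∑ a, M.splineJet c (Pi.single a 1) (G x) • (EuclideanSpace.proj a : E3 →L[ℝ] ℝ)).comp
        (fderiv ℝ G x)) x :=
  (M.hasFDerivAt_splineJet_zero c (h.mapsTo_inv hx)).comp x (h.differentiableAt_inv hx).hasFDerivAt

theorem weakPartial_pushforward (h : DiffeoBounds F G Ω L) (M : TensorMesh)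
    (c : (Fin 3 → ℕ) → ℝ) (i : Fin 3) {v : E3 → ℝ}
    (hv : v =ᵐ[volume.restrict Ω] fun x => M.splineJet c 0 (G x)) :
    weakPartial Ω i v =ᵐ[volume.restrict Ω] fun x =>
      ∑ a, M.splineJet c (Pi.single a 1) (G x) *
        fderiv ℝ G x (EuclideanSpace.single i (1 : ℝ)) a := by
  have hlip : LocallyLipschitzOn Ω (fun x => M.splineJet c 0 (G x)) :=
    (M.locallyLipschitzOn_splineJet c (r := 0) (by simp)).comp_mapsTo h.locallyLipschitzOn_inv
      h.mapsTo_inv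
  refine (weakPartial_ae_eq h.isOpen (isWeakPartial_fderiv h.isOpen hlip i) hv).trans ?_
  filter_upwards [ae_restrict_mem h.isOpen.measurableSet] with x hx
  rw [(h.hasFDerivAt_pushforward M c hx).fderiv]
  simp

/-- First partials of the push-forward are sums of products of spline derivatives with entries of
`DG`, all locally Lipschitz, so they can be differentiated classically almost everywhere. The
numbers `q` are second derivatives of `G`; only their bound matters, since they multiply first
derivatives of the spline. -/
theorem weakPartial_weakPartial_pushforward (h : DiffeoBounds F G Ω L) (M : TensorMesh)
    (c : (Fin 3 → ℕ) → ℝ) (i : Fin 3) :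
    ∀ᵐ x ∂(volume.restrict Ω), M.OffMesh (G x) ∧ ∃ q : Fin 3 → ℝ, (∀ a, |q a| ≤ L) ∧
      weakPartial Ω i (weakPartial Ω i fun x => M.splineJet c 0 (G x)) x =
        ∑ a, ((∑ b, M.splineJet c (Pi.single a 1 + Pi.single b 1) (G x) *
          fderiv ℝ G x (EuclideanSpace.single i (1 : ℝ)) b) *
            fderiv ℝ G x (EuclideanSpace.single i (1 : ℝ)) a +
          M.splineJet c (Pi.single a 1) (G x) * q a) := by
  set D : E3 → ℝ := fun x => ∑ a, M.splineJet c (Pi.single a 1) (G x) *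
        fderiv ℝ G x (EuclideanSpace.single i (1 : ℝ)) a with hD
  have hDlip : LocallyLipschitzOn Ω D := by
    refine LocallyLipschitzOn.fun_sum_real _ fun a _ => ?_
    refine LocallyLipschitzOn.fun_mul_real ?_ (h.fderiv_inv_locLip i a).locallyLipschitzOn
    refine (M.locallyLipschitzOn_splineJet c fun b => ?_).comp_mapsTo h.locallyLipschitzOn_inv
      h.mapsTo_inv
    simp only [Pi.single_apply]
    split_ifs <;> simp
  have h1 := weakPartial_ae_eq h.isOpen (isWeakPartial_fderiv h.isOpen hDlip i)
    (h.weakPartial_pushforward M c i (ae_eq_refl _))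
  have h2 : ∀ a, ∀ᵐ x ∂(volume.restrict Ω), DifferentiableAt ℝ
      (fun x => fderiv ℝ G x (EuclideanSpace.single i (1 : ℝ)) a) x := fun a =>
    (h.fderiv_inv_locLip i a).locallyLipschitzOn.ae_differentiableAt h.isOpen
  filter_upwards [h1, ae_all_iff.2 h2, h.ae_offMesh M, ae_restrict_mem h.isOpen.measurableSet]
    with x hx1 hx2 hoff hx
  refine ⟨hoff, fun a => fderiv ℝ (fun x => fderiv ℝ G x (EuclideanSpace.single i (1 : ℝ)) a) x
    (EuclideanSpace.single i (1 : ℝ)), fun a => ?_, ?_⟩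
  · have := (h.fderiv_inv_locLip i a).norm_fderiv_le h.pos.le hx
    have h3 := ContinuousLinearMap.le_opNorm (fderiv ℝ
      (fun x => fderiv ℝ G x (EuclideanSpace.single i (1 : ℝ)) a) x)
      (EuclideanSpace.single i (1 : ℝ))
    rw [PiLp.norm_single, norm_one, mul_one, Real.norm_eq_abs] at h3
    exact h3.trans this
  · rw [hx1]
    have hder : HasFDerivAt D (∑ a, (M.splineJet c (Pi.single a 1) (G x) •
        fderiv ℝ (fun x => fderiv ℝ G x (EuclideanSpace.single i (1 : ℝ)) a) x +
        fderiv ℝ G x (EuclideanSpace.single i (1 : ℝ)) a •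
        (∑ b, M.splineJet c (Pi.single a 1 + Pi.single b 1) (G x) •
          (EuclideanSpace.proj b : E3 →L[ℝ] ℝ)).comp (fderiv ℝ G x))) x := by
      refine HasFDerivAt.fun_sum fun a _ => ?_
      exact ((M.hasFDerivAt_splineJet_single c (h.mapsTo_inv hx) hoff a).comp x
        (h.differentiableAt_inv hx).hasFDerivAt).mul (hx2 a).hasFDerivAt
    rw [hder.fderiv]
    have hp : ∀ b (w : E3), (EuclideanSpace.proj b : E3 →L[ℝ] ℝ) w = w b := fun _ _ => rfl
    simp only [sum_apply, add_apply,
      smul_apply, smul_eq_mul, ContinuousLinearMap.comp_apply, hp]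
    refine Finset.sum_congr rfl fun a _ => ?_
    ring

end DiffeoBounds

/-! ### Taylor expansion of compactly supported functions -/

theorem ContDiff.exists_bound_and_lipschitz {E Y : Type*} [NormedAddCommGroup E] [NormedSpace ℝ E]
    [NormedAddCommGroup Y] [NormedSpace ℝ Y] {f : E → Y} (h : ContDiff ℝ ∞ f)
    (hc : HasCompactSupport f) : ∃ K : ℝ, ∀ p q, ‖f p‖ ≤ K ∧ ‖f q - f p‖ ≤ K * ‖q - p‖ := by
  obtain ⟨K1, hK1⟩ := hc.exists_bound_of_continuous h.continuous
  obtain ⟨K2, hK2⟩ := h.lipschitzWith_of_hasCompactSupport hc (by simp)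
  refine ⟨max K1 K2, fun p q => ⟨(hK1 p).trans (le_max_left _ _), (hK2.norm_sub_le q p).trans ?_⟩⟩
  exact mul_le_mul_of_nonneg_right (le_max_right _ _) (norm_nonneg _)

/-- The second derivative is Lipschitz; two applications of the mean value inequality on a ball
raise the order of the remainder from one to three. -/
theorem ContDiff.exists_cubic_taylor_bound {E : Type*} [NormedAddCommGroup E] [NormedSpace ℝ E]
    {Θ : E → ℝ} (h : ContDiff ℝ ∞ Θ) (hc : HasCompactSupport Θ) :
    ∃ K : ℝ, 0 < K ∧ (∀ p, ‖fderiv ℝ Θ p‖ ≤ K) ∧ (∀ p, ‖fderiv ℝ (fderiv ℝ Θ) p‖ ≤ K) ∧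
      ∀ p k, |Θ (p + k) - Θ p - fderiv ℝ Θ p k - 1 / 2 * fderiv ℝ (fderiv ℝ Θ) p k k| ≤
        K * ‖k‖ ^ 3 := by
  have h1 : ContDiff ℝ ∞ (fderiv ℝ Θ) := h.fderiv_right (by simp)
  have h2 : ContDiff ℝ ∞ (fderiv ℝ (fderiv ℝ Θ)) := h1.fderiv_right (by simp)
  have c1 : HasCompactSupport (fderiv ℝ Θ) := hc.fderiv (𝕜 := ℝ)
  have c2 : HasCompactSupport (fderiv ℝ (fderiv ℝ Θ)) := c1.fderiv (𝕜 := ℝ)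
  obtain ⟨K, hK0, hK1, hK2, hb3⟩ : ∃ K : ℝ, 0 < K ∧ (∀ p, ‖fderiv ℝ Θ p‖ ≤ K) ∧
      (∀ p, ‖fderiv ℝ (fderiv ℝ Θ) p‖ ≤ K) ∧
      ∀ p q, ‖fderiv ℝ (fderiv ℝ Θ) q - fderiv ℝ (fderiv ℝ Θ) p‖ ≤ K * ‖q - p‖ := by
    obtain ⟨K1, hK1⟩ := ContDiff.exists_bound_and_lipschitz (Y := E →L[ℝ] ℝ) h1 c1
    obtain ⟨K2, hK2⟩ := ContDiff.exists_bound_and_lipschitz (Y := E →L[ℝ] E →L[ℝ] ℝ) h2 c2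
    refine ⟨max 1 (max K1 K2), one_pos.trans_le (le_max_left _ _), fun p => ?_, fun p => ?_,
      fun p q => ?_⟩
    · exact (hK1 p p).1.trans ((le_max_left _ _).trans (le_max_right _ _))
    · exact (hK2 p p).1.trans ((le_max_right _ _).trans (le_max_right _ _))
    · exact (hK2 p q).2.trans (mul_le_mul_of_nonneg_right
        ((le_max_right _ _).trans (le_max_right _ _)) (norm_nonneg _))
  have d0 : ∀ q, HasFDerivAt Θ (fderiv ℝ Θ q) q := fun q =>
    (h.differentiable (by simp) q).hasFDerivAt
  have d1 : ∀ q, HasFDerivAt (fderiv ℝ Θ) (fderiv ℝ (fderiv ℝ Θ) q) q := fun q =>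
    (h1.differentiable (by simp) q).hasFDerivAt
  refine ⟨K, hK0, hK1, hK2, fun p k => ?_⟩
  set r := ‖k‖ with hr
  have hr0 : 0 ≤ r := norm_nonneg k
  have hconv : Convex ℝ (Metric.closedBall p r) := convex_closedBall p r
  have hp : p ∈ Metric.closedBall p r := Metric.mem_closedBall_self hr0
  have e2 : ∀ q ∈ Metric.closedBall p r,
      ‖fderiv ℝ (fderiv ℝ Θ) q - fderiv ℝ (fderiv ℝ Θ) p‖ ≤ K * r := by
    intro q hq
    exact (hb3 p q).trans (mul_le_mul_of_nonneg_left (by simpa [dist_eq_norm] using hq) hK0.le)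
  have e1 : ∀ q ∈ Metric.closedBall p r,
      ‖fderiv ℝ Θ q - fderiv ℝ Θ p - fderiv ℝ (fderiv ℝ Θ) p (q - p)‖ ≤ K * r * r := by
    intro q hq
    have hd : ∀ x ∈ Metric.closedBall p r, HasFDerivWithinAt
        (fun x => fderiv ℝ Θ x - fderiv ℝ (fderiv ℝ Θ) p (x - p))
        (fderiv ℝ (fderiv ℝ Θ) x - fderiv ℝ (fderiv ℝ Θ) p) (Metric.closedBall p r) x := by
      intro x _
      refine ((d1 x).sub ?_).hasFDerivWithinAt
      exact (fderiv ℝ (fderiv ℝ Θ) p).hasFDerivAt.comp x ((hasFDerivAt_id x).sub_const p)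
    have := (hconv.norm_image_sub_le_of_norm_hasFDerivWithin_le hd e2 hp hq).trans
      (mul_le_mul_of_nonneg_left (by simpa [dist_eq_norm] using hq) (by positivity))
    simpa [sub_right_comm] using this
  -- Symmetry of the second derivative identifies the derivative of half the quadratic form.
  have hsym : ∀ v v', fderiv ℝ (fderiv ℝ Θ) p v v' = fderiv ℝ (fderiv ℝ Θ) p v' v := by
    have : IsSymmSndFDerivAt ℝ Θ p := (contDiff_infty.1 h 2).contDiffAt.isSymmSndFDerivAt (by simp)
    exact fun v v' => this v v'
  have hd : ∀ x ∈ Metric.closedBall p r, HasFDerivWithinAt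
      (fun x => Θ x - fderiv ℝ Θ p (x - p) - 1 / 2 * fderiv ℝ (fderiv ℝ Θ) p (x - p) (x - p))
      (fderiv ℝ Θ x - fderiv ℝ Θ p - fderiv ℝ (fderiv ℝ Θ) p (x - p)) (Metric.closedBall p r) x := by
    intro x _
    have hs : HasFDerivAt (fun x : E => x - p) (ContinuousLinearMap.id ℝ E) x :=
      (hasFDerivAt_id x).sub_const p
    have i1 : HasFDerivAt (fun x : E => fderiv ℝ Θ p (x - p)) (fderiv ℝ Θ p) x :=
      (fderiv ℝ Θ p).hasFDerivAt.comp x hs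
    have i2 : HasFDerivAt (fun x : E => fderiv ℝ (fderiv ℝ Θ) p (x - p))
      (fderiv ℝ (fderiv ℝ Θ) p) x := (fderiv ℝ (fderiv ℝ Θ) p).hasFDerivAt.comp x hs
    have i3 := ((i2.clm_apply hs).const_mul (1 / 2 : ℝ))
    refine (((d0 x).sub i1).sub i3).hasFDerivWithinAt.congr_fderiv ?_
    ext v
    simp only [sub_apply, smul_apply, add_apply, ContinuousLinearMap.comp_apply,
      ContinuousLinearMap.flip_apply, ContinuousLinearMap.id_apply, smul_eq_mul]
    rw [hsym v (x - p)]
    ring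
  have hk : p + k ∈ Metric.closedBall p r := by simp [hr]
  have := hconv.norm_image_sub_le_of_norm_hasFDerivWithin_le hd e1 hp hk
  simp only [add_sub_cancel_left, sub_self, map_zero, mul_zero, sub_zero] at this
  rw [Real.norm_eq_abs] at this
  calc _ = |Θ (p + k) - fderiv ℝ Θ p k - 1 / 2 * fderiv ℝ (fderiv ℝ Θ) p k k - Θ p| := by
        congr 1; ring
    _ ≤ K * r * r * ‖k‖ := this
    _ = _ := by rw [← hr]; ring

/-! ### Separated profiles -/

/-- The product of a spatial cutoff and a transition profile. -/
def sepProfile (χ : E3 → ℝ) (w : ℝ → ℝ) (q : E3 × ℝ) : ℝ := χ q.1 * w q.2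

theorem contDiff_sepProfile {χ : E3 → ℝ} {w : ℝ → ℝ} (hχ : ContDiff ℝ ∞ χ) (hw : ContDiff ℝ ∞ w) :
    ContDiff ℝ ∞ (sepProfile χ w) :=
  (hχ.comp contDiff_fst).mul (hw.comp contDiff_snd)

theorem hasCompactSupport_sepProfile {χ : E3 → ℝ} {w : ℝ → ℝ} (hχ : HasCompactSupport χ)
    (hw : HasCompactSupport w) : HasCompactSupport (sepProfile χ w) := by
  refine HasCompactSupport.intro (hχ.isCompact.prod hw.isCompact) fun q hq => ?_
  rw [mem_prod, not_and_or] at hq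
  rcases hq with h | h
  · simp [sepProfile, image_eq_zero_of_notMem_tsupport h]
  · simp [sepProfile, image_eq_zero_of_notMem_tsupport h]

theorem fderiv_sepProfile_snd {χ : E3 → ℝ} {w : ℝ → ℝ} (hχ : ContDiff ℝ ∞ χ) (hw : ContDiff ℝ ∞ w)
    (q : E3 × ℝ) : fderiv ℝ (sepProfile χ w) q (0, 1) = sepProfile χ (deriv w) q := by
  have h1 := ((contDiff_sepProfile hχ hw).differentiable (by simp) q).hasFDerivAt
  have h2 : HasDerivAt (fun t : ℝ => (q.1, t)) ((0 : E3), (1 : ℝ)) q.2 :=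
    (hasDerivAt_const q.2 q.1).prodMk (hasDerivAt_id q.2)
  have h3 := HasFDerivAt.comp_hasDerivAt (x := q.2) (l := sepProfile χ w) (f := fun t : ℝ => (q.1, t))
    (by exact h1) h2
  have h4 : HasDerivAt (fun t => χ q.1 * w t) (χ q.1 * deriv w q.2) q.2 :=
    ((hw.differentiable (by simp) q.2).hasDerivAt).const_mul _
  exact h3.unique h4

theorem fderiv_fderiv_sepProfile_snd {χ : E3 → ℝ} {w : ℝ → ℝ} (hχ : ContDiff ℝ ∞ χ)
    (hw : ContDiff ℝ ∞ w) (q : E3 × ℝ) :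
    fderiv ℝ (fderiv ℝ (sepProfile χ w)) q (0, 1) (0, 1) = sepProfile χ (deriv (deriv w)) q := by
  have h1 : ContDiff ℝ ∞ (fderiv ℝ (sepProfile χ w)) :=
    (contDiff_sepProfile hχ hw).fderiv_right (by simp)
  have h2 := ((h1.differentiable (by simp) q).hasFDerivAt).clm_apply
    (hasFDerivAt_const ((0 : E3), (1 : ℝ)) q)
  have hw' : ContDiff ℝ ∞ (deriv w) := (contDiff_infty_iff_deriv.1 hw).2
  have h3 : HasFDerivAt (sepProfile χ (deriv w)) _ q := h2.congr_of_eventuallyEq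
    (Eventually.of_forall fun z => (fderiv_sepProfile_snd hχ hw z).symm)
  have h4 := fderiv_sepProfile_snd hχ hw' q
  rw [h3.fderiv] at h4
  simpa using h4

/-- Where the profile is close to its extreme values, its second derivative is small. -/
theorem exists_sepProfile_flat {χ : E3 → ℝ} {w : ℝ → ℝ} (hχ : ContDiff ℝ ∞ χ)
    (hχc : HasCompactSupport χ) (hχb : ∀ x, 0 ≤ χ x ∧ χ x ≤ 1) (hw : ContDiff ℝ ∞ w)
    (hwc : HasCompactSupport w) (hwb : ∀ t, 0 ≤ w t ∧ w t ≤ 1)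
    (hflat : ∀ t, w t = 0 ∨ w t = 1 → deriv (deriv w) t = 0) {κ : ℝ} (hκ : 0 < κ) :
    ∃ σ : ℝ, 0 < σ ∧ ∀ q, sepProfile χ w q ≤ σ ∨ 1 - σ ≤ sepProfile χ w q →
      |sepProfile χ (deriv (deriv w)) q| ≤ κ := by
  have hw1 : ContDiff ℝ ∞ (deriv w) := (contDiff_infty_iff_deriv.1 hw).2
  have hw2 : ContDiff ℝ ∞ (deriv (deriv w)) := (contDiff_infty_iff_deriv.1 hw1).2
  have hc0 := (contDiff_sepProfile hχ hw).continuous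
  have hc2 := (contDiff_sepProfile hχ hw2).continuous
  have hk2 := hasCompactSupport_sepProfile hχc hwc.deriv.deriv
  -- On this compact set the second derivative is at least `κ` in absolute value, so by flatness the
  -- profile is strictly between 0 and 1 there. By compactness it stays at a positive distance from
  -- both values.
  set S : Set (E3 × ℝ) := {q | κ ≤ |sepProfile χ (deriv (deriv w)) q|} with hS
  have hSc : IsCompact S := by
    refine hk2.isCompact.of_isClosed_subset (isClosed_le continuous_const hc2.abs) fun q hq => ?_
    refine subset_tsupport _ ?_
    rw [Function.mem_support]
    intro h0
    rw [hS, mem_ofPred_eq, h0, abs_zero] at hq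
    exact absurd hq (not_le.2 hκ)
  by_cases hne : S.Nonempty
  · have hcm : ContinuousOn (fun q => min (sepProfile χ w q) (1 - sepProfile χ w q)) S :=
      (hc0.min (continuous_const.sub hc0)).continuousOn
    obtain ⟨q0, hq0, hmin⟩ := hSc.exists_isMinOn hne hcm
    have hpos : 0 < min (sepProfile χ w q0) (1 - sepProfile χ w q0) := by
      have hb1 := hχb q0.1
      have hb2 := hwb q0.2
      have hne0 : sepProfile χ (deriv (deriv w)) q0 ≠ 0 := by
        intro h0
        rw [hS, mem_ofPred_eq, h0, abs_zero] at hq0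
        exact absurd hq0 (not_le.2 hκ)
      have hχ0 : χ q0.1 ≠ 0 := left_ne_zero_of_mul hne0
      have hw0 : ¬ (w q0.2 = 0 ∨ w q0.2 = 1) := fun h =>
        right_ne_zero_of_mul hne0 (hflat _ h)
      rw [not_or] at hw0
      have p1 : 0 < χ q0.1 := lt_of_le_of_ne hb1.1 (Ne.symm hχ0)
      have p2 : 0 < w q0.2 := lt_of_le_of_ne hb2.1 (Ne.symm hw0.1)
      have p3 : w q0.2 < 1 := lt_of_le_of_ne hb2.2 hw0.2
      refine lt_min (mul_pos p1 p2) ?_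
      simp only [sepProfile]
      nlinarith
    refine ⟨min (sepProfile χ w q0) (1 - sepProfile χ w q0) / 2, half_pos hpos, fun q hq => ?_⟩
    by_contra hlt
    have hmem : q ∈ S := (not_le.1 hlt).le
    have h1 := hmin hmem
    have h2 : min (sepProfile χ w q0) (1 - sepProfile χ w q0) ≤
      min (sepProfile χ w q) (1 - sepProfile χ w q) := h1
    obtain ⟨h3, h4⟩ := le_min_iff.1 h2
    rcases hq with hq | hq <;> linarith
  · refine ⟨1, one_pos, fun q _ => ?_⟩
    by_contra hlt
    exact hne ⟨q, (not_le.1 hlt).le⟩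

/-- Linear scaling by `1 / ε` in the direction `n`, keeping track of the position. -/
noncomputable def scaleMap (n : E3) (ε : ℝ) : E3 →L[ℝ] E3 × ℝ :=
  (ContinuousLinearMap.id ℝ E3).prod (ε⁻¹ • innerSL ℝ n)

theorem scaleMap_apply (n : E3) (ε : ℝ) (v : E3) : scaleMap n ε v = (v, inner ℝ n v / ε) := by
  simp [scaleMap, div_eq_inv_mul]

theorem norm_scaleMap_le {n : E3} (hn : ‖n‖ = 1) {ε : ℝ} (hε : 0 < ε) (hε1 : ε ≤ 1) (v : E3) :
    ‖scaleMap n ε v‖ ≤ ‖v‖ / ε := by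
  rw [scaleMap_apply, Prod.norm_def]
  refine max_le ?_ ?_
  · rw [le_div_iff₀ hε]
    exact mul_le_of_le_one_right (norm_nonneg v) hε1
  · rw [norm_div, Real.norm_eq_abs ε, abs_of_pos hε]
    refine div_le_div_of_nonneg_right ?_ hε.le
    have := norm_inner_le_norm (𝕜 := ℝ) n v
    rwa [hn, one_mul] at this

/-- With `s = H / ε`, the scaled increment `k` has size `O(s)`, so the cubic remainder is `O(s³)`.
Replacing `F` by its linearisation changes the increment by `O(H² / ε) = O(ε s²)`. Both errors are
`s²` times a small factor, although the polynomial contains no second derivative of `F`. -/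
theorem DiffeoBounds.abs_comp_sub_quadPoly_le {F G : E3 → E3} {Ω : Set E3} {L : ℝ}
    (hD : DiffeoBounds F G Ω L) {Θ : E3 × ℝ → ℝ} {K : ℝ} (hK : 0 < K)
    (h1 : ∀ p, ‖fderiv ℝ Θ p‖ ≤ K) (h2 : ∀ p, ‖fderiv ℝ (fderiv ℝ Θ) p‖ ≤ K)
    (h3 : ∀ p k, |Θ (p + k) - Θ p - fderiv ℝ Θ p k - 1 / 2 * fderiv ℝ (fderiv ℝ Θ) p k k| ≤
        K * ‖k‖ ^ 3) {n p : E3} (hn : ‖n‖ = 1) {ε H : ℝ} (hε : 0 < ε) (hε1 : ε ≤ 1)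
    (hH : 0 < H) (hHε : H ≤ ε) {y z : E3} (hy : y ∈ patch) (hz : z ∈ patch)
    (hyz : dist y z ≤ 4 * H) :
    |Θ (F y, inner ℝ n (F y - p) / ε) - TensorMesh.quadPoly (Θ (F z, inner ℝ n (F z - p) / ε))
      ((fderiv ℝ Θ (F z, inner ℝ n (F z - p) / ε)).comp ((scaleMap n ε).comp (fderiv ℝ F z)))
      ((1 / 2 : ℝ) • (fderiv ℝ (fderiv ℝ Θ) (F z, inner ℝ n (F z - p) / ε)).bilinearComp
        ((scaleMap n ε).comp (fderiv ℝ F z)) ((scaleMap n ε).comp (fderiv ℝ F z))) z y| ≤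
      (H / ε) ^ 2 * (208 * K * L ^ 3 * (H / ε + ε)) := by
  set q : E3 × ℝ := (F z, inner ℝ n (F z - p) / ε) with hq
  set k := scaleMap n ε (F y - F z) with hk
  set k0 := scaleMap n ε (fderiv ℝ F z (y - z)) with hk0
  have hL := hD.one_le
  have hL0 := hD.pos
  set s := H / ε with hs
  have hs0 : 0 < s := by positivity
  have hs1 : s ≤ 1 := (div_le_one hε).2 hHε
  have hHs : H = s * ε := by rw [hs]; field_simp
  have hqk : (F y, inner ℝ n (F y - p) / ε) = q + k := by
    rw [hq, hk, scaleMap_apply, Prod.mk_add_mk, ← add_div, ← inner_add_right]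
    simp
  have bk : ‖k‖ ≤ 4 * L * s := by
    refine (norm_scaleMap_le hn hε hε1 _).trans ?_
    rw [div_le_iff₀ hε, ← dist_eq_norm]
    calc dist (F y) (F z) ≤ L * dist y z := hD.dist_le hy hz
      _ ≤ L * (4 * H) := by gcongr
      _ = _ := by rw [hHs]; ring
  have bk0 : ‖k0‖ ≤ 4 * L * s := by
    refine (norm_scaleMap_le hn hε hε1 _).trans ?_
    rw [div_le_iff₀ hε]
    calc ‖fderiv ℝ F z (y - z)‖ ≤ ‖fderiv ℝ F z‖ * ‖y - z‖ := ContinuousLinearMap.le_opNorm _ _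
      _ ≤ L * (4 * H) := by
        rw [← dist_eq_norm]
        exact mul_le_mul (hD.norm_fderiv_le z hz) hyz dist_nonneg hL0.le
      _ = _ := by rw [hHs]; ring
  have bd : ‖k - k0‖ ≤ 16 * L * ε * s ^ 2 := by
    rw [hk, hk0, ← map_sub]
    refine (norm_scaleMap_le hn hε hε1 _).trans ?_
    rw [div_le_iff₀ hε]
    calc _ ≤ L * dist y z ^ 2 := hD.taylor hy hz
      _ ≤ L * (4 * H) ^ 2 := by gcongr
      _ = _ := by rw [hHs]; ring
  have t1 := h3 q k
  have t2 : |fderiv ℝ Θ q (k - k0)| ≤ K * (16 * L * ε * s ^ 2) :=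
    ((fderiv ℝ Θ q).le_opNorm _).trans (mul_le_mul (h1 q) bd (norm_nonneg _) hK.le)
  have t3 : |fderiv ℝ (fderiv ℝ Θ) q (k - k0) k| ≤ K * (16 * L * ε * s ^ 2) * (4 * L * s) := by
    refine ((fderiv ℝ (fderiv ℝ Θ) q).le_opNorm₂ _ _).trans ?_
    have := h2 q
    gcongr
  have t4 : |fderiv ℝ (fderiv ℝ Θ) q k0 (k - k0)| ≤ K * (4 * L * s) * (16 * L * ε * s ^ 2) := by
    refine ((fderiv ℝ (fderiv ℝ Θ) q).le_opNorm₂ _ _).trans ?_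
    have := h2 q
    gcongr
  have t5 : K * ‖k‖ ^ 3 ≤ K * (4 * L * s) ^ 3 := by gcongr
  have hval : TensorMesh.quadPoly (Θ q) ((fderiv ℝ Θ q).comp ((scaleMap n ε).comp (fderiv ℝ F z)))
      ((1 / 2 : ℝ) • (fderiv ℝ (fderiv ℝ Θ) q).bilinearComp
        ((scaleMap n ε).comp (fderiv ℝ F z)) ((scaleMap n ε).comp (fderiv ℝ F z))) z y =
      Θ q + fderiv ℝ Θ q k0 + 1 / 2 * fderiv ℝ (fderiv ℝ Θ) q k0 k0 := by
    simp [TensorMesh.quadPoly, hk0]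
  rw [hval, hqk]
  have e1 : fderiv ℝ Θ q (k - k0) = fderiv ℝ Θ q k - fderiv ℝ Θ q k0 := map_sub _ _ _
  have e2 : fderiv ℝ (fderiv ℝ Θ) q (k - k0) k =
    fderiv ℝ (fderiv ℝ Θ) q k k - fderiv ℝ (fderiv ℝ Θ) q k0 k := by simp
  have e3 : fderiv ℝ (fderiv ℝ Θ) q k0 (k - k0) =
    fderiv ℝ (fderiv ℝ Θ) q k0 k - fderiv ℝ (fderiv ℝ Θ) q k0 k0 := map_sub _ _ _
  have main : |Θ (q + k) - (Θ q + fderiv ℝ Θ q k0 + 1 / 2 * fderiv ℝ (fderiv ℝ Θ) q k0 k0)| ≤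
      K * (4 * L * s) ^ 3 + K * (16 * L * ε * s ^ 2) + K * (16 * L * ε * s ^ 2) * (4 * L * s) := by
    rw [abs_le] at *
    constructor <;> linarith
  refine main.trans ?_
  have f1 : L ≤ L ^ 3 := le_self_pow₀ hL (by norm_num)
  have f2 : L ^ 2 ≤ L ^ 3 := pow_le_pow_right₀ hL (by norm_num)
  have g0 : 0 ≤ K * s ^ 2 := by positivity
  have : K * (4 * L * s) ^ 3 + K * (16 * L * ε * s ^ 2) + K * (16 * L * ε * s ^ 2) * (4 * L * s) =
    (K * s ^ 2) * (64 * L ^ 3 * s + 16 * L * ε + 64 * L ^ 2 * (ε * s)) := by ring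
  rw [this]
  calc _ ≤ (K * s ^ 2) * (64 * L ^ 3 * s + 16 * L ^ 3 * ε + 64 * L ^ 3 * (ε * 1)) := by gcongr
    _ ≤ (K * s ^ 2) * (208 * L ^ 3 * (s + ε)) := by
      refine mul_le_mul_of_nonneg_left ?_ g0
      have : 0 ≤ L ^ 3 * s := by positivity
      have : 0 ≤ L ^ 3 * ε := by positivity
      nlinarith
    _ = _ := by ring

/-! ### Interpolation of the phase field -/

theorem norm_prod_single (v : E3) (t : ℝ) : ‖((v, t) : E3 × ℝ)‖ = max ‖v‖ |t| := by
  rw [Prod.norm_def, Real.norm_eq_abs]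

/-- The scaled variable carries the factor `1 / ε`; the dependence on position through the cutoff is
of lower order. -/
theorem abs_apply_scaleMap_sub_le {n : E3} {T : E3 × ℝ →L[ℝ] ℝ} {K : ℝ} (hT : ‖T‖ ≤ K) (ε : ℝ)
    (v : E3) : |T (scaleMap n ε v) - inner ℝ n v / ε * T (0, 1)| ≤ K * ‖v‖ := by
  have h : scaleMap n ε v = (v, 0) + (inner ℝ n v / ε) • ((0 : E3), (1 : ℝ)) := by
    rw [scaleMap_apply]
    ext <;> simp
  rw [h, map_add, map_smul, smul_eq_mul, add_sub_cancel_right]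
  refine (T.le_opNorm _).trans ?_
  rw [norm_prod_single, abs_zero, max_eq_left (norm_nonneg v)]
  exact mul_le_mul_of_nonneg_right hT (norm_nonneg v)

theorem abs_apply_apply_scaleMap_sub_le {n : E3} (hn : ‖n‖ = 1)
    {T : E3 × ℝ →L[ℝ] E3 × ℝ →L[ℝ] ℝ} {K : ℝ} (hT : ‖T‖ ≤ K) {ε : ℝ} (hε : 0 < ε) (hε1 : ε ≤ 1)
    (v : E3) : |T (scaleMap n ε v) (scaleMap n ε v) - (inner ℝ n v / ε) ^ 2 * T (0, 1) (0, 1)| ≤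
      3 * K * ‖v‖ ^ 2 / ε := by
  have hK : 0 ≤ K := (norm_nonneg T).trans hT
  set s := inner ℝ n v / ε with hs
  have h : scaleMap n ε v = (v, 0) + s • ((0 : E3), (1 : ℝ)) := by
    rw [scaleMap_apply]
    ext <;> simp [hs]
  have hs' : |s| ≤ ‖v‖ / ε := by
    rw [hs, abs_div, abs_of_pos hε]
    refine div_le_div_of_nonneg_right ?_ hε.le
    have := norm_inner_le_norm (𝕜 := ℝ) n v
    rwa [hn, one_mul] at this
  have n1 : ‖((v, 0) : E3 × ℝ)‖ = ‖v‖ := by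
    rw [norm_prod_single, abs_zero, max_eq_left (norm_nonneg v)]
  have n2 : ‖((0, 1) : E3 × ℝ)‖ = 1 := by
    rw [norm_prod_single]; simp
  have b1 : |T (v, 0) (v, 0)| ≤ K * ‖v‖ * ‖v‖ := by
    have := T.le_opNorm₂ (v, 0) (v, 0)
    rw [n1] at this
    refine this.trans ?_
    gcongr
  have b2 : |T (v, 0) (0, 1)| ≤ K * ‖v‖ := by
    have := T.le_opNorm₂ (v, 0) (0, 1)
    rw [n1, n2, mul_one] at this
    refine this.trans ?_
    gcongr
  have b3 : |T (0, 1) (v, 0)| ≤ K * ‖v‖ := by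
    have := T.le_opNorm₂ (0, 1) (v, 0)
    rw [n1, n2, mul_one] at this
    refine this.trans ?_
    gcongr
  have e : T (scaleMap n ε v) (scaleMap n ε v) - s ^ 2 * T (0, 1) (0, 1) =
      T (v, 0) (v, 0) + s * (T (v, 0) (0, 1) + T (0, 1) (v, 0)) := by
    rw [h]
    simp only [map_add, map_smul, add_apply, smul_apply, smul_eq_mul]
    ring
  rw [e]
  calc _ ≤ |T (v, 0) (v, 0)| + |s * (T (v, 0) (0, 1) + T (0, 1) (v, 0))| := abs_add_le _ _
    _ ≤ K * ‖v‖ * ‖v‖ + ‖v‖ / ε * (K * ‖v‖ + K * ‖v‖) := by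
      refine add_le_add b1 ?_
      rw [abs_mul]
      exact mul_le_mul hs' ((abs_add_le _ _).trans (add_le_add b2 b3)) (abs_nonneg _)
        (by positivity)
    _ ≤ _ := by
      have : K * ‖v‖ * ‖v‖ ≤ K * ‖v‖ * ‖v‖ / ε := by
        rw [le_div_iff₀ hε]
        exact mul_le_of_le_one_right (by positivity) hε1
      calc _ ≤ K * ‖v‖ * ‖v‖ / ε + ‖v‖ / ε * (K * ‖v‖ + K * ‖v‖) := by gcongr
        _ = _ := by ring

namespace TensorMesh

theorem quadPoly_add_smul (A : ℝ) (Λ : E3 →L[ℝ] ℝ) (B : E3 →L[ℝ] E3 →L[ℝ] ℝ) (z g e : E3) (t : ℝ) :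
    quadPoly A Λ B z (g + t • e) = quadPoly A Λ B z g +
      t * (Λ e + B (g - z) e + B e (g - z)) + t ^ 2 * B e e := by
  have : g + t • e - z = (g - z) + t • e := by abel
  simp only [quadPoly, this, map_add, map_smul, add_apply, smul_apply, smul_eq_mul]
  ring

theorem abs_quasi_quadPoly_sub_le {M : TensorMesh} {H : ℝ} {y : E3} {j : Fin 3 → ℕ}
    (h : M.IsNear H y j) (A : ℝ) (Λ : E3 →L[ℝ] ℝ) (B : E3 →L[ℝ] E3 →L[ℝ] ℝ) (z : E3) {b : ℝ}
    (hb : ∀ a, |B (EuclideanSpace.single a (1 : ℝ)) (EuclideanSpace.single a (1 : ℝ))| ≤ b) :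
    |M.quasi (quadPoly A Λ B z) j - quadPoly A Λ B z (M.greville j)| ≤ 12 * H ^ 2 * b := by
  set r : Fin 3 → ℝ := fun a => ((M a).knot (j a + 2) - (M a).knot (j a + 1)) / 2 with hr
  have s2 : ∀ a, M.stencil j a 2 = M.greville j + r a • EuclideanSpace.single a (1 : ℝ) := by
    intro a
    ext b
    by_cases hab : b = a
    · subst hab
      simp [stencil, greville, hr]
      ring
    · simp [stencil, hab]
  have s1 : ∀ a, M.stencil j a 1 = M.greville j + (-r a) • EuclideanSpace.single a (1 : ℝ) := by
    intro a
    ext b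
    by_cases hab : b = a
    · subst hab
      simp [stencil, greville, hr]
      ring
    · simp [stencil, hab]
  have hr2 : ∀ a, r a ^ 2 ≤ 4 * H ^ 2 := by
    intro a
    obtain ⟨h1, h2⟩ := h a
    have : |r a| ≤ 2 * H := by
      simp only [hr]
      rw [abs_le] at *
      constructor <;> linarith
    calc r a ^ 2 = |r a| ^ 2 := (sq_abs _).symm
      _ ≤ (2 * H) ^ 2 := pow_le_pow_left₀ (abs_nonneg _) this 2
      _ = _ := by ring
  have key : M.quasi (quadPoly A Λ B z) j - quadPoly A Λ B z (M.greville j) =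
      -∑ a, r a ^ 2 * B (EuclideanSpace.single a (1 : ℝ)) (EuclideanSpace.single a (1 : ℝ)) := by
    simp only [quasi, s1, s2, quadPoly_add_smul, Fin.sum_univ_three]
    ring
  rw [key, abs_neg]
  refine (Finset.abs_sum_le_sum_abs _ _).trans ?_
  calc _ ≤ ∑ _a : Fin 3, 4 * H ^ 2 * b := by
        refine Finset.sum_le_sum fun a _ => ?_
        rw [abs_mul, abs_of_nonneg (sq_nonneg (r a))]
        exact mul_le_mul (hr2 a) (hb a) (abs_nonneg _) (by positivity)
    _ = _ := by
      simp
      ring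

end TensorMesh

/-- The data from which the phase fields are built: a plane through `p` with unit normal `n`
containing the compact set `J`, a cutoff `χ` near `J` and a transition profile `w`. -/
structure IsTubeData (F G : E3 → E3) (Ω J : Set E3) (L : ℝ) (n p : E3) (χ : E3 → ℝ) (w : ℝ → ℝ)
    (ρ r₀ l K : ℝ) : Prop where
  diffeo : DiffeoBounds F G Ω L
  norm_eq : ‖n‖ = 1
  abs_inner_le : ∀ x, |inner ℝ n (x - p)| ≤ Metric.infDist x J
  ρ_pos : 0 < ρ
  r₀_pos : 0 < r₀
  l_pos : 0 < l
  K_pos : 0 < K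
  ball_subset : ∀ y ∈ patch, Metric.infDist (F y) J ≤ ρ → Metric.ball y r₀ ⊆ patch
  χ_smooth : ContDiff ℝ ∞ χ
  χ_compact : HasCompactSupport χ
  χ_bounds : ∀ x, 0 ≤ χ x ∧ χ x ≤ 1
  χ_zero : ∀ x, ρ / 2 ≤ Metric.infDist x J → χ x = 0
  χ_one : ∀ x, Metric.infDist x J ≤ ρ / 4 → χ x = 1
  w_smooth : ContDiff ℝ ∞ w
  w_bounds : ∀ t, 0 ≤ w t ∧ w t ≤ 1
  w_one : ∀ t, |t| ≤ l → w t = 1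
  w_zero : ∀ t, K ≤ |t| → w t = 0
  w_flat : ∀ t, w t = 0 ∨ w t = 1 → deriv (deriv w) t = 0

/-- The point at which the separated profile is evaluated. -/
noncomputable def scaledPoint (F : E3 → E3) (n p : E3) (ε : ℝ) (y : E3) : E3 × ℝ :=
  (F y, inner ℝ n (F y - p) / ε)

/-- One minus the phase field in the parametric domain. -/
noncomputable def transition (F : E3 → E3) (n p : E3) (Θ : E3 × ℝ → ℝ) (ε : ℝ) : E3 → ℝ :=
  patch.indicator fun y => Θ (scaledPoint F n p ε y)

/-- The spline coefficients of one minus the phase field. -/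
noncomputable def transitionCoeff (F : E3 → E3) (n p : E3) (Θ : E3 × ℝ → ℝ) (ε : ℝ)
    (M : TensorMesh) (j : Fin 3 → ℕ) : ℝ :=
  max 0 (min 1 (M.quasi (transition F n p Θ ε) j))

/-- Clamping moves `q` by no more than its distance to any point `R` of `[0,1]`, and it acts only
when `q` lies outside, where the better bound `δ₃` is available. -/
theorem abs_clamp_sub_le {q R P δ₁ δ₂ δ₃ : ℝ} (hR : 0 ≤ R ∧ R ≤ 1) (h1 : |q - P| ≤ δ₁)
    (h2 : |R - q| ≤ δ₂) (h3 : q < 0 ∨ 1 < q → δ₂ ≤ δ₃) (hδ : 0 ≤ δ₃) :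
    |max 0 (min 1 q) - P| ≤ δ₁ + δ₃ := by
  have h4 : |max 0 (min 1 q) - q| ≤ δ₃ := by
    rcases lt_trichotomy q 0 with h | h | h
    · have := h3 (Or.inl h)
      rw [min_eq_right (by linarith), max_eq_left h.le]
      rw [abs_le] at *
      constructor <;> linarith
    · simp [h, hδ]
    · by_cases hq : 1 < q
      · have := h3 (Or.inr hq)
        rw [min_eq_left hq.le, max_eq_right zero_le_one]
        rw [abs_le] at *
        constructor <;> linarith
      · rw [min_eq_right (not_lt.1 hq), max_eq_right h.le]
        simpa using hδ
  calc _ = |(max 0 (min 1 q) - q) + (q - P)| := by congr 1; ring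
    _ ≤ _ := (abs_add_le _ _).trans (by linarith)

namespace IsTubeData

variable {F G : E3 → E3} {Ω J : Set E3} {L : ℝ} {n p : E3} {χ : E3 → ℝ} {w : ℝ → ℝ} {ρ r₀ l K : ℝ}

theorem w_compact (h : IsTubeData F G Ω J L n p χ w ρ r₀ l K) : HasCompactSupport w := by
  refine HasCompactSupport.intro (isCompact_closedBall (0 : ℝ) K) fun s hs => h.w_zero s ?_
  exact (not_le.1 fun hle => hs (by simpa using hle)).le

theorem sepProfile_mem (h : IsTubeData F G Ω J L n p χ w ρ r₀ l K) (q : E3 × ℝ) :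
    0 ≤ sepProfile χ w q ∧ sepProfile χ w q ≤ 1 :=
  ⟨mul_nonneg (h.χ_bounds _).1 (h.w_bounds _).1,
    mul_le_one₀ (h.χ_bounds _).2 (h.w_bounds _).1 (h.w_bounds _).2⟩

set_option maxHeartbeats 1000000 in
/-- The coefficients of the phase field are close to the quasi-interpolation coefficients of its
second order Taylor polynomials. -/
theorem transitionCoeff_close (h : IsTubeData F G Ω J L n p χ w ρ r₀ l K) {γ : ℝ} (hγ : 0 < γ) :
    ∃ σ : ℝ, 0 < σ ∧ σ ≤ 1 ∧ ∀ ε, 0 < ε → ε ≤ σ → ∀ H, 0 < H → H ≤ σ * ε → ∀ M : TensorMesh,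
      ∀ z ∈ patch, Metric.infDist (F z) J ≤ ρ → ∀ j, M.IsNear H z j →
      |transitionCoeff F n p (sepProfile χ w) ε M j -
        M.quasi (TensorMesh.quadPoly (sepProfile χ w (scaledPoint F n p ε z))
      ((fderiv ℝ (sepProfile χ w) (scaledPoint F n p ε z)).comp
        ((scaleMap n ε).comp (fderiv ℝ F z)))
      ((1 / 2 : ℝ) • (fderiv ℝ (fderiv ℝ (sepProfile χ w)) (scaledPoint F n p ε z)).bilinearComp
        ((scaleMap n ε).comp (fderiv ℝ F z)) ((scaleMap n ε).comp (fderiv ℝ F z))) z) j| ≤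
        (H / ε) ^ 2 * γ := by
  set Θ := sepProfile χ w with hΘ
  obtain ⟨N, hN, hN1, hN2, hN3⟩ := (contDiff_sepProfile h.χ_smooth h.w_smooth).exists_cubic_taylor_bound
    (hasCompactSupport_sepProfile h.χ_compact h.w_compact)
  have hL := h.diffeo.pos
  -- With this threshold the clamping error contributes `6 L² κ = γ / 2`.
  set κ := γ / (12 * L ^ 2) with hκ
  have hκ0 : 0 < κ := by positivity
  obtain ⟨σ₁, hσ₁, hflat⟩ := exists_sepProfile_flat h.χ_smooth h.χ_compact h.χ_bounds h.w_smooth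
    h.w_compact h.w_bounds h.w_flat hκ0
  set C₁ := 15 * (208 * N * L ^ 3) with hC₁
  set C₂ := 18 * L ^ 2 * N with hC₂
  set C₃ := 24 * L ^ 2 * N with hC₃
  have p1 : 0 < C₁ := by positivity
  have p2 : 0 < C₂ := by positivity
  have p3 : 0 < C₃ := by positivity
  -- One constant serves both smallness conditions: `D * σ ≤ γ / 2` for the Taylor errors and `D * σ
  -- ≤ σ₁` to reach the flat region.
  set D := 2 * C₁ + C₂ + C₃ + 4 * N * L with hD
  have pD : 0 < D := by positivity
  set σ := min (min 1 (γ / (2 * D))) (min (σ₁ / D) (r₀ / 8)) with hσ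
  have hσ0 : 0 < σ := by
    have := h.r₀_pos
    positivity
  have hσ1 : σ ≤ 1 := (min_le_left _ _).trans (min_le_left _ _)
  have hσγ : D * σ ≤ γ / 2 := by
    have : σ ≤ γ / (2 * D) := (min_le_left _ _).trans (min_le_right _ _)
    rw [le_div_iff₀ (by positivity)] at this
    linarith
  have hσσ : D * σ ≤ σ₁ := by
    have : σ ≤ σ₁ / D := (min_le_right _ _).trans (min_le_left _ _)
    rw [le_div_iff₀ (by positivity)] at this
    linarith
  have hσr : σ ≤ r₀ / 8 := (min_le_right _ _).trans (min_le_right _ _)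
  refine ⟨σ, hσ0, hσ1, fun ε hε hεσ H hH hHσ M z hz hzρ j hj => ?_⟩
  have hε1 : ε ≤ 1 := hεσ.trans hσ1
  have hHε : H ≤ ε := hHσ.trans (mul_le_of_le_one_left hε.le hσ1)
  have hHr : 4 * H < r₀ := by
    have : H ≤ σ * 1 := hHσ.trans (by gcongr)
    linarith [h.r₀_pos]
  set s := H / ε with hs
  have hs0 : 0 < s := by positivity
  have hsσ : s ≤ σ := (div_le_iff₀ hε).2 hHσ
  have hs1 : s ≤ 1 := hsσ.trans hσ1
  have hHs : H = s * ε := by rw [hs]; field_simp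
  set q₀ := scaledPoint F n p ε z with hq₀
  set T := (scaleMap n ε).comp (fderiv ℝ F z) with hT
  set P := TensorMesh.quadPoly (Θ q₀) ((fderiv ℝ Θ q₀).comp T)
    ((1 / 2 : ℝ) • (fderiv ℝ (fderiv ℝ Θ) q₀).bilinearComp T T) z with hP
  set E := s ^ 2 * (208 * N * L ^ 3 * (s + ε)) with hE
  -- Stencil points are within `4 * H < r₀`, hence inside the patch, so the extension of
  -- `transition` by zero is not seen.
  have hclose : ∀ y, dist y z ≤ 4 * H → |transition F n p Θ ε y - P y| ≤ E := by
    intro y hy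
    have hyp : y ∈ patch := h.ball_subset z hz hzρ (Metric.mem_ball.2 (hy.trans_lt hHr))
    rw [transition, indicator_of_mem hyp]
    exact h.diffeo.abs_comp_sub_quadPoly_le hN hN1 hN2 hN3 h.norm_eq hε hε1 hH hHε hyp hz hy
  obtain ⟨hg, hst⟩ := hj.dist_greville_le hH
  set Q := M.quasi (transition F n p Θ ε) j with hQ
  have d1 : |Q - M.quasi P j| ≤ 7 * E :=
    TensorMesh.abs_quasi_sub_le (hclose _ hg) fun a => ⟨hclose _ (hst a).1, hclose _ (hst a).2⟩
  set θ := |fderiv ℝ (fderiv ℝ Θ) q₀ (0, 1) (0, 1)| with hθ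
  have hθN : θ ≤ N := by
    have := (fderiv ℝ (fderiv ℝ Θ) q₀).le_opNorm₂ (0, 1) (0, 1)
    have n2 : ‖((0, 1) : E3 × ℝ)‖ = 1 := by
      rw [norm_prod_single]; simp
    rw [n2, mul_one, mul_one] at this
    exact this.trans (hN2 q₀)
  have hBb : ∀ a, |((1 / 2 : ℝ) • (fderiv ℝ (fderiv ℝ Θ) q₀).bilinearComp T T)
      (EuclideanSpace.single a (1 : ℝ)) (EuclideanSpace.single a (1 : ℝ))| ≤
      1 / 2 * (L ^ 2 * (3 * N * ε + θ) / ε ^ 2) := by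
    intro a
    set v := fderiv ℝ F z (EuclideanSpace.single a (1 : ℝ)) with hv
    have hvL : ‖v‖ ≤ L := by
      have := (fderiv ℝ F z).le_opNorm (EuclideanSpace.single a (1 : ℝ))
      rw [PiLp.norm_single, norm_one, mul_one] at this
      exact this.trans (h.diffeo.norm_fderiv_le z hz)
    have e : ((1 / 2 : ℝ) • (fderiv ℝ (fderiv ℝ Θ) q₀).bilinearComp T T)
        (EuclideanSpace.single a (1 : ℝ)) (EuclideanSpace.single a (1 : ℝ)) =
        1 / 2 * fderiv ℝ (fderiv ℝ Θ) q₀ (scaleMap n ε v) (scaleMap n ε v) := by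
      simp [hT, hv]
    rw [e, abs_mul, abs_of_pos (by norm_num : (0 : ℝ) < 1 / 2)]
    refine mul_le_mul_of_nonneg_left ?_ (by norm_num)
    have b1 := abs_apply_apply_scaleMap_sub_le h.norm_eq (hN2 q₀) hε hε1 v
    have b2 : |(inner ℝ n v / ε) ^ 2 * fderiv ℝ (fderiv ℝ Θ) q₀ (0, 1) (0, 1)| ≤
        (L / ε) ^ 2 * θ := by
      rw [abs_mul, abs_pow, abs_div, abs_of_pos hε]
      have : |inner ℝ n v| ≤ L := by
        have := norm_inner_le_norm (𝕜 := ℝ) n v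
        rw [h.norm_eq, one_mul] at this
        exact this.trans hvL
      gcongr
    have b3 : 3 * N * ‖v‖ ^ 2 / ε ≤ 3 * N * L ^ 2 / ε := by gcongr
    calc _ = |(fderiv ℝ (fderiv ℝ Θ) q₀ (scaleMap n ε v) (scaleMap n ε v) -
          (inner ℝ n v / ε) ^ 2 * fderiv ℝ (fderiv ℝ Θ) q₀ (0, 1) (0, 1)) +
          (inner ℝ n v / ε) ^ 2 * fderiv ℝ (fderiv ℝ Θ) q₀ (0, 1) (0, 1)| := by
          congr 1; ring
      _ ≤ 3 * N * L ^ 2 / ε + (L / ε) ^ 2 * θ := (abs_add_le _ _).trans (by linarith)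
      _ = _ := by field_simp
  have d2 : |M.quasi P j - P (M.greville j)| ≤ 6 * L ^ 2 * s ^ 2 * (3 * N * ε + θ) := by
    refine (TensorMesh.abs_quasi_quadPoly_sub_le hj _ _ _ _ hBb).trans (le_of_eq ?_)
    rw [hs]
    field_simp
    ring
  have d3 := hclose _ hg
  have hgp : M.greville j ∈ patch := h.ball_subset z hz hzρ (Metric.mem_ball.2 (hg.trans_lt hHr))
  set R := transition F n p Θ ε (M.greville j) with hR
  have hR' : R = Θ (scaledPoint F n p ε (M.greville j)) := by
    rw [hR, transition, indicator_of_mem hgp]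
  have hR01 : 0 ≤ R ∧ R ≤ 1 := hR' ▸ h.sepProfile_mem _
  have hRq : |R - Θ q₀| ≤ 4 * N * L * s := by
    have hlip := convex_univ.norm_image_sub_le_of_norm_hasFDerivWithin_le (𝕜 := ℝ) (f := Θ)
      (f' := fderiv ℝ Θ) (C := N)
      (fun x _ => (((contDiff_sepProfile h.χ_smooth h.w_smooth).differentiable (by simp)
        x).hasFDerivAt).hasFDerivWithinAt) (fun x _ => hN1 x)
      (mem_univ q₀) (mem_univ (scaledPoint F n p ε (M.greville j)))
    rw [hR', ← Real.norm_eq_abs]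
    refine hlip.trans ?_
    have e : scaledPoint F n p ε (M.greville j) - q₀ =
        scaleMap n ε (F (M.greville j) - F z) := by
      rw [hq₀, scaledPoint, scaledPoint, scaleMap_apply, Prod.mk_sub_mk, ← sub_div, ← inner_sub_right]
      simp
    rw [e]
    have : ‖scaleMap n ε (F (M.greville j) - F z)‖ ≤ 4 * L * s := by
      refine (norm_scaleMap_le h.norm_eq hε hε1 _).trans ?_
      rw [div_le_iff₀ hε, ← dist_eq_norm]
      calc _ ≤ L * dist (M.greville j) z := h.diffeo.dist_le hgp hz
        _ ≤ L * (4 * H) := by gcongr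
        _ = _ := by rw [hHs]; ring
    calc _ ≤ N * (4 * L * s) := by gcongr
      _ = _ := by ring
  have hE0 : 0 ≤ E := by positivity
  have hτ : |R - Q| ≤ 8 * E + 6 * L ^ 2 * s ^ 2 * (3 * N * ε + θ) := by
    rw [abs_le] at *
    constructor <;> linarith
  have hs2 : s ^ 2 ≤ s := by nlinarith
  have hEσ : 8 * E ≤ 2 * C₁ * s := by
    have : 208 * N * L ^ 3 * (s + ε) ≤ 208 * N * L ^ 3 * (1 + 1) := by gcongr
    have h5 : E ≤ s * (208 * N * L ^ 3 * (1 + 1)) := by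
      rw [hE]
      gcongr
    have : 0 < N * L ^ 3 * s := by positivity
    rw [hC₁]
    nlinarith
  -- If `Q` leaves `[0,1]`, then `Θ q₀`, which is within `O(s)` of `Q` through `R`, is within `σ₁`
  -- of 0 or 1. There the normal second derivative is at most `κ`, which improves the bound on `R -
  -- Q`.
  have h7 : |max 0 (min 1 Q) - M.quasi P j| ≤ 7 * E +
      (8 * E + 6 * L ^ 2 * s ^ 2 * (3 * N * ε + κ)) := by
    refine abs_clamp_sub_le hR01 d1 hτ (fun hout => ?_) (by positivity)
    have hτs : 8 * E + 6 * L ^ 2 * s ^ 2 * (3 * N * ε + θ) ≤ (2 * C₁ + C₃) * s := by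
      have : 6 * L ^ 2 * s ^ 2 * (3 * N * ε + θ) ≤ 6 * L ^ 2 * s * (3 * N * 1 + N) := by gcongr
      have h6 : 6 * L ^ 2 * s * (3 * N * 1 + N) = C₃ * s := by rw [hC₃]; ring
      linarith
    have hDs : (2 * C₁ + C₃) * s + 4 * N * L * s ≤ σ₁ := by
      have : D * s ≤ D * σ := by gcongr
      have h8 : 0 ≤ C₂ * s := by positivity
      rw [hD] at this hσσ
      linarith
    have hext : Θ q₀ ≤ σ₁ ∨ 1 - σ₁ ≤ Θ q₀ := by
      rcases hout with hout | hout
      · left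
        rw [abs_le] at hτ hRq
        linarith
      · right
        rw [abs_le] at hτ hRq
        linarith
    have hθκ : θ ≤ κ := by
      rw [hθ, hΘ, fderiv_fderiv_sepProfile_snd h.χ_smooth h.w_smooth]
      exact hflat q₀ hext
    gcongr
  refine h7.trans ?_
  have e1 : 7 * E + (8 * E + 6 * L ^ 2 * s ^ 2 * (3 * N * ε + κ)) =
      s ^ 2 * (C₁ * (s + ε) + C₂ * ε + 6 * L ^ 2 * κ) := by
    rw [hE, hC₁, hC₂]
    ring
  have e2 : 6 * L ^ 2 * κ = γ / 2 := by
    rw [hκ]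
    field_simp
    ring
  rw [e1, e2]
  refine mul_le_mul_of_nonneg_left ?_ (sq_nonneg s)
  have : C₁ * (s + ε) + C₂ * ε ≤ D * σ := by
    calc C₁ * (s + ε) + C₂ * ε ≤ C₁ * (σ + σ) + C₂ * σ := by gcongr
      _ ≤ D * σ := by
        rw [hD]
        have : 0 ≤ C₃ * σ := by positivity
        have : 0 ≤ 4 * N * L * σ := by positivity
        linarith
  linarith

end IsTubeData

/-! ### The energy density of the interpolated phase field -/

theorem abs_sum_mul_add_le {S : Fin 3 → ℝ} {Λ : E3 →L[ℝ] ℝ} {g : E3} {e L : ℝ}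
    (h : ∀ a, |S a + Λ (EuclideanSpace.single a (1 : ℝ))| ≤ e) (hg : ∀ a, |g a| ≤ L) :
    |∑ a, S a * g a + Λ g| ≤ 3 * L * e := by
  have hL : 0 ≤ L := (abs_nonneg _).trans (hg 0)
  have e1 : ∑ a, S a * g a + Λ g =
      ∑ a, (S a + Λ (EuclideanSpace.single a (1 : ℝ))) * g a := by
    conv_lhs => rw [TensorMesh.eq_sum_single g]
    simp [Fin.sum_univ_three]
    ring
  rw [e1]
  refine (Finset.abs_sum_le_sum_abs _ _).trans ?_
  calc _ ≤ ∑ _a : Fin 3, e * L := by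
        refine Finset.sum_le_sum fun a _ => ?_
        rw [abs_mul]
        exact mul_le_mul (h a) (hg a) (abs_nonneg _) ((abs_nonneg _).trans (h a))
    _ = _ := by
      simp
      ring

theorem abs_sum_sum_mul_add_le {S : Fin 3 → Fin 3 → ℝ} {B : E3 →L[ℝ] E3 →L[ℝ] ℝ} {g : E3} {e L : ℝ}
    (h : ∀ a b, |S a b + (B (EuclideanSpace.single a (1 : ℝ)) (EuclideanSpace.single b (1 : ℝ)) +
       B (EuclideanSpace.single b (1 : ℝ)) (EuclideanSpace.single a (1 : ℝ)))| ≤ e)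
    (hg : ∀ a, |g a| ≤ L) :
    |∑ a, (∑ b, S a b * g b) * g a + 2 * B g g| ≤ 9 * L ^ 2 * e := by
  have hL : 0 ≤ L := (abs_nonneg _).trans (hg 0)
  have he : 0 ≤ e := (abs_nonneg _).trans (h 0 0)
  have e1 : ∑ a, (∑ b, S a b * g b) * g a + 2 * B g g = ∑ a, ∑ b, (S a b +
      (B (EuclideanSpace.single a (1 : ℝ)) (EuclideanSpace.single b (1 : ℝ)) +
       B (EuclideanSpace.single b (1 : ℝ)) (EuclideanSpace.single a (1 : ℝ)))) * (g b * g a) := by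
    have hB : B g g = ∑ a, ∑ b, g a * g b *
        B (EuclideanSpace.single a (1 : ℝ)) (EuclideanSpace.single b (1 : ℝ)) := by
      conv_lhs => rw [TensorMesh.eq_sum_single g]
      simp [Fin.sum_univ_three]
      ring
    rw [hB]
    simp only [Fin.sum_univ_three]
    ring
  rw [e1]
  refine (Finset.abs_sum_le_sum_abs _ _).trans ?_
  calc _ ≤ ∑ _a : Fin 3, ∑ _b : Fin 3, e * (L * L) := by
        refine Finset.sum_le_sum fun a _ => (Finset.abs_sum_le_sum_abs _ _).trans
          (Finset.sum_le_sum fun b _ => ?_)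
        rw [abs_mul, abs_mul]
        exact mul_le_mul (h a b) (mul_le_mul (hg b) (hg a) (abs_nonneg _) hL) (by positivity) he
    _ = _ := by
      simp
      ring

theorem sq_le_sq_add_of_abs_sub_le {x y r N : ℝ} (h : |x - y| ≤ r) (hy : |y| ≤ N) (hr : r ≤ 1) :
    x ^ 2 ≤ y ^ 2 + (2 * N + 1) * r := by
  have hr0 : 0 ≤ r := (abs_nonneg _).trans h
  have hN : 0 ≤ N := (abs_nonneg y).trans hy
  have h1 : x ^ 2 = y ^ 2 + (2 * y * (x - y) + (x - y) ^ 2) := by ring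
  have h2 : 2 * y * (x - y) ≤ 2 * N * r := by
    calc 2 * y * (x - y) ≤ |2 * y * (x - y)| := le_abs_self _
      _ = 2 * |y| * |x - y| := by rw [abs_mul, abs_mul, abs_two]
      _ ≤ 2 * N * r := by gcongr
  have h3 : (x - y) ^ 2 ≤ r * 1 := by
    rw [← sq_abs, sq]
    exact mul_le_mul h (h.trans hr) (abs_nonneg _) hr0
  linarith

namespace TensorMesh

theorem quasi_one_sub_quadPoly (M : TensorMesh) (A : ℝ) (Λ : E3 →L[ℝ] ℝ)
    (B : E3 →L[ℝ] E3 →L[ℝ] ℝ) (z : E3) (j : Fin 3 → ℕ) :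
    M.quasi (quadPoly (1 - A) (-Λ) (-B) z) j = 1 - M.quasi (quadPoly A Λ B z) j := by
  simp only [quasi, quadPoly, neg_apply, Fin.sum_univ_three]
  ring

theorem splineJet_eq_of_const_near {M : TensorMesh} {c H A : ℝ} (hc : 0 < c) (hH : 0 < H)
    (hM : M.IsQuasiUniform c H) {d : (Fin 3 → ℕ) → ℝ} {y : E3} (hy : y ∈ patch)
    (hd : ∀ j, M.IsNear H y j → d j = A) :
    M.splineJet d 0 y = A ∧ (∀ a, M.splineJet d (Pi.single a 1) y = 0) ∧
      (M.OffMesh y → ∀ a b, M.splineJet d (Pi.single a 1 + Pi.single b 1) y = 0) := by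
  have h := M.splineJet_close (E := 0) hc hH hM hy A 0 0 (d := d) fun j hj => by
    simp [hd j hj, quasi, quadPoly]
    ring_nf
  obtain ⟨h0, h1, h2⟩ := h
  refine ⟨?_, fun a => ?_, fun hoff a b => ?_⟩
  · rw [mul_zero] at h0
    linarith [abs_nonpos_iff.1 h0]
  · simpa using h1 a
  · simpa using h2 hoff a b

/-- Nonnegativity and partition of unity of the B-splines; this is the reason for clamping
coefficients instead of the function, which would leave the spline space. -/
theorem splineJet_mem_Icc {M : TensorMesh} {d : (Fin 3 → ℕ) → ℝ} (hd : ∀ j, 0 ≤ d j ∧ d j ≤ 1)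
    {y : E3} (hy : y ∈ patch) : 0 ≤ M.splineJet d 0 y ∧ M.splineJet d 0 y ≤ 1 := by
  have hb : ∀ j, 0 ≤ M.basisJet j 0 y := fun j => by
    unfold basisJet
    exact Finset.prod_nonneg fun a _ => ((M a).bspline_mem_Icc (j a) (hy a)).1
  have h1 : ∑ j ∈ M.idx, M.basisJet j 0 y = 1 := by
    have := M.splineJet_quasi_quadPoly 1 0 0 0 hy
    simp only [splineJet, quasi, quadPoly] at this
    norm_num at this
    exact this
  unfold splineJet
  refine ⟨Finset.sum_nonneg fun j _ => mul_nonneg (hd j).1 (hb j), ?_⟩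
  rw [← h1]
  exact Finset.sum_le_sum fun j _ => mul_le_of_le_one_left (hb j) (hd j).2

end TensorMesh

namespace IsTubeData

variable {F G : E3 → E3} {Ω J : Set E3} {L : ℝ} {n p : E3} {χ : E3 → ℝ} {w : ℝ → ℝ} {ρ r₀ l K : ℝ}

/-- Near a point the transition function is locally constant if all values of the separated
profile at nearby points agree. -/
theorem transitionCoeff_eq {A : ℝ} (hA : A = 0 ∨ A = 1) {Θ : E3 × ℝ → ℝ} {ε H : ℝ} (hH : 0 < H)
    {M : TensorMesh} {z : E3} (h : ∀ y, dist y z ≤ 4 * H → transition F n p Θ ε y = A)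
    {j : Fin 3 → ℕ} (hj : M.IsNear H z j) : transitionCoeff F n p Θ ε M j = A := by
  obtain ⟨hg, hst⟩ := hj.dist_greville_le hH
  have hq : M.quasi (transition F n p Θ ε) j = A := by
    simp only [TensorMesh.quasi, h _ hg, h _ (hst _).1, h _ (hst _).2, Fin.sum_univ_three]
    ring
  rw [transitionCoeff, hq]
  rcases hA with rfl | rfl <;> simp

/-- One minus the phase field vanishes away from the tube. -/
theorem transitionCoeff_eq_zero (h : IsTubeData F G Ω J L n p χ w ρ r₀ l K) {ε H : ℝ} (hε : 0 < ε)
    (hH : 0 < H) (hHε : 4 * L * H ≤ ε) (hHρ : 4 * L * H ≤ ρ / 2)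
    {M : TensorMesh} {z : E3} (hz : z ∈ patch)
    (hout : ¬ (Metric.infDist (F z) J ≤ ρ ∧ |inner ℝ n (F z - p)| ≤ (K + 1) * ε))
    {j : Fin 3 → ℕ} (hj : M.IsNear H z j) :
    transitionCoeff F n p (sepProfile χ w) ε M j = 0 := by
  refine transitionCoeff_eq (Or.inl rfl) hH (fun y hy => ?_) hj
  by_cases hyp : y ∈ patch
  · rw [transition, indicator_of_mem hyp]
    by_contra hne
    have h1 : χ (F y) ≠ 0 := left_ne_zero_of_mul hne
    have h2 : w (inner ℝ n (F y - p) / ε) ≠ 0 := right_ne_zero_of_mul hne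
    have h3 : Metric.infDist (F y) J < ρ / 2 := not_le.1 fun hle => h1 (h.χ_zero _ hle)
    have h4 : |inner ℝ n (F y - p)| < K * ε := by
      have := not_le.1 fun hle => h2 (h.w_zero _ hle)
      rwa [abs_div, abs_of_pos hε, div_lt_iff₀ hε] at this
    have hd : dist (F z) (F y) ≤ 4 * L * H := by
      rw [dist_comm]
      calc dist (F y) (F z) ≤ L * dist y z := h.diffeo.dist_le hyp hz
        _ ≤ L * (4 * H) := mul_le_mul_of_nonneg_left hy h.diffeo.pos.le
        _ = _ := by ring
    refine hout ⟨?_, ?_⟩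
    · have := Metric.infDist_le_infDist_add_dist (s := J) (x := F z) (y := F y)
      linarith
    · have e : inner ℝ n (F z - p) = inner ℝ n (F y - p) + inner ℝ n (F z - F y) := by
        rw [← inner_add_right]; congr 1; abel
      have h5 : |inner ℝ n (F z - F y)| ≤ dist (F z) (F y) := by
        have := norm_inner_le_norm (𝕜 := ℝ) n (F z - F y)
        rwa [h.norm_eq, one_mul, ← dist_eq_norm] at this
      rw [e]
      refine (abs_add_le _ _).trans ?_
      linarith
  · rw [transition, indicator_of_notMem hyp]

/-- The phase field vanishes near `J`. -/
theorem transitionCoeff_eq_one (h : IsTubeData F G Ω J L n p χ w ρ r₀ l K) {ε H : ℝ} (hε : 0 < ε)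
    (hερ : l * ε ≤ ρ / 4) (hH : 0 < H) (hHε : 4 * L * H ≤ l / 2 * ε) (hHr : 4 * H < r₀)
    {M : TensorMesh} {z : E3} (hz : z ∈ patch) (hin : Metric.infDist (F z) J ≤ l / 2 * ε)
    {j : Fin 3 → ℕ} (hj : M.IsNear H z j) :
    transitionCoeff F n p (sepProfile χ w) ε M j = 1 := by
  refine transitionCoeff_eq (Or.inr rfl) hH (fun y hy => ?_) hj
  have hl := h.l_pos
  have hlε : 0 < l * ε := by positivity
  have hyp : y ∈ patch := h.ball_subset z hz (by linarith [h.ρ_pos])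
    (Metric.mem_ball.2 (hy.trans_lt hHr))
  rw [transition, indicator_of_mem hyp]
  have hd : dist (F y) (F z) ≤ 4 * L * H := by
    calc dist (F y) (F z) ≤ L * dist y z := h.diffeo.dist_le hyp hz
      _ ≤ L * (4 * H) := mul_le_mul_of_nonneg_left hy h.diffeo.pos.le
      _ = _ := by ring
  have h1 : Metric.infDist (F y) J ≤ l * ε := by
    have := Metric.infDist_le_infDist_add_dist (s := J) (x := F y) (y := F z)
    linarith
  have h2 : w (inner ℝ n (F y - p) / ε) = 1 := by
    refine h.w_one _ ?_
    rw [abs_div, abs_of_pos hε, div_le_iff₀ hε]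
    exact (h.abs_inner_le _).trans h1
  simp [sepProfile, scaledPoint, h2, h.χ_one _ (h1.trans hερ)]

theorem transitionCoeff_mem (Θ : E3 × ℝ → ℝ) (ε : ℝ) (M : TensorMesh) (j : Fin 3 → ℕ) :
    0 ≤ 1 - transitionCoeff F n p Θ ε M j ∧ 1 - transitionCoeff F n p Θ ε M j ≤ 1 := by
  have h1 : 0 ≤ transitionCoeff F n p Θ ε M j := le_max_left _ _
  have h2 : transitionCoeff F n p Θ ε M j ≤ 1 := max_le zero_le_one (min_le_left _ _)
  constructor <;> linarith

end IsTubeData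

/-- The discrete phase field. -/
noncomputable def phaseField (F G : E3 → E3) (n p : E3) (Θ : E3 × ℝ → ℝ) (ε : ℝ) (M : TensorMesh)
    (x : E3) : ℝ := M.splineJet (fun j => 1 - transitionCoeff F n p Θ ε M j) 0 (G x)

namespace IsTubeData

variable {F G : E3 → E3} {Ω J : Set E3} {L : ℝ} {n p : E3} {χ : E3 → ℝ} {w : ℝ → ℝ} {ρ r₀ l K : ℝ}

theorem phaseField_mem (h : IsTubeData F G Ω J L n p χ w ρ r₀ l K) (Θ : E3 × ℝ → ℝ) (ε : ℝ)
    (M : TensorMesh) {x : E3} (hx : x ∈ Ω) :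
    0 ≤ phaseField F G n p Θ ε M x ∧ phaseField F G n p Θ ε M x ≤ 1 :=
  TensorMesh.splineJet_mem_Icc (fun j => transitionCoeff_mem Θ ε M j) (h.diffeo.mapsTo_inv hx)

/-- The profile is identically 1 near the origin, so all active coefficients equal 1 and the
reproduction of constants gives an exact zero. An approximate zero would not do, because the elastic
density is of order `ε⁻²` here. -/
theorem phaseField_eq_zero (h : IsTubeData F G Ω J L n p χ w ρ r₀ l K) {c : ℝ} (hc : 0 < c) :
    ∃ σ : ℝ, 0 < σ ∧ ∀ ε, 0 < ε → ε ≤ σ → ∀ H, 0 < H → H ≤ σ * ε → ∀ M : TensorMesh,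
      M.IsQuasiUniform c H → ∀ x ∈ Ω, Metric.infDist x J ≤ l / 2 * ε →
      phaseField F G n p (sepProfile χ w) ε M x = 0 := by
  have hL := h.diffeo.pos
  have hl := h.l_pos
  have hρ := h.ρ_pos
  have hr := h.r₀_pos
  refine ⟨min (min 1 (ρ / (4 * l))) (min (l / (8 * L)) (r₀ / 8)), by positivity,
    fun ε hε hεσ H hH hHσ M hM x hx hxJ => ?_⟩
  set σ := min (min 1 (ρ / (4 * l))) (min (l / (8 * L)) (r₀ / 8))
  have s1 : σ ≤ 1 := (min_le_left _ _).trans (min_le_left _ _)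
  have s2 : ε ≤ ρ / (4 * l) := hεσ.trans ((min_le_left _ _).trans (min_le_right _ _))
  have s3 : σ ≤ l / (8 * L) := (min_le_right _ _).trans (min_le_left _ _)
  have s4 : σ ≤ r₀ / 8 := (min_le_right _ _).trans (min_le_right _ _)
  rw [le_div_iff₀ (by positivity)] at s2 s3
  have hxr := h.diffeo.right_inv x hx
  refine (TensorMesh.splineJet_eq_of_const_near hc hH hM (h.diffeo.mapsTo_inv hx) fun j hj => ?_).1
  rw [h.transitionCoeff_eq_one hε (by linarith) hH ?_ ?_ (h.diffeo.mapsTo_inv hx) (by rwa [hxr]) hj,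
    sub_self]
  · have : σ * ε * (8 * L) ≤ l * ε := by nlinarith
    nlinarith
  · nlinarith

set_option maxHeartbeats 2000000 in
-- In the tube the scaled gradient is close to `-D₁ n` and the scaled Laplacian to `-D₂`, where
-- `D₁`, `D₂` are the derivatives of the separated profile in the scaled variable. The
-- parametrization drops out because `DF · DG` is the identity, and `|n| = 1` sums the directions.
-- Off the tube all active coefficients of the phase field are 1, so the identities are exact.
theorem phaseField_density (h : IsTubeData F G Ω J L n p χ w ρ r₀ l K) {c : ℝ} (hc : 0 < c) {κ : ℝ}
    (hκ : 0 < κ) :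
    ∃ σ : ℝ, 0 < σ ∧ ∀ ε, 0 < ε → ε ≤ σ → ∀ H, 0 < H → H ≤ σ * ε → ∀ M : TensorMesh,
      M.IsQuasiUniform c H → ∀ᵐ x ∂(volume.restrict Ω),
      (Metric.infDist x J ≤ ρ ∧ |inner ℝ n (x - p)| ≤ (K + 1) * ε →
        (phaseField F G n p (sepProfile χ w) ε M x - 1) ^ 2 +
          2 * ε ^ 2 * ∑ i, weakPartial Ω i (phaseField F G n p (sepProfile χ w) ε M) x ^ 2 +
          ε ^ 4 * weakLaplacian Ω (phaseField F G n p (sepProfile χ w) ε M) x ^ 2 ≤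
        profileEnergy w (inner ℝ n (x - p) / ε) + κ) ∧
      (¬ (Metric.infDist x J ≤ ρ ∧ |inner ℝ n (x - p)| ≤ (K + 1) * ε) →
        phaseField F G n p (sepProfile χ w) ε M x = 1 ∧
          (∀ i, weakPartial Ω i (phaseField F G n p (sepProfile χ w) ε M) x = 0) ∧
          weakLaplacian Ω (phaseField F G n p (sepProfile χ w) ε M) x = 0) := by
  have hL := h.diffeo.pos
  have hρ := h.ρ_pos
  set Θ := sepProfile χ w with hΘ
  obtain ⟨N, hN, hN1, hN2, -⟩ := (contDiff_sepProfile h.χ_smooth h.w_smooth).exists_cubic_taylor_bound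
    (hasCompactSupport_sepProfile h.χ_compact h.w_compact)
  -- `Z * γ` collects the spline errors of all orders, and `Y * ε` the terms in which a derivative
  -- hits the cutoff or the parametrization.
  set Z := 27 + 324 * L / c + 3 * (3888 * L ^ 2 / c ^ 2 + 324 * L / c) with hZ
  set Y := N + 9 * N * L ^ 2 + 9 * N with hY
  have hZ0 : 0 < Z := by positivity
  have hY0 : 0 < Y := by positivity
  set κ' := min 1 (κ / (10 * (2 * N + 3))) with hκ'
  have hκ'0 : 0 < κ' := by positivity
  have hκ'1 : κ' ≤ 1 := min_le_left _ _
  have hκ'2 : 10 * (2 * N + 3) * κ' ≤ κ := by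
    have : κ' ≤ κ / (10 * (2 * N + 3)) := min_le_right _ _
    rw [le_div_iff₀ (by positivity)] at this
    linarith
  set γ := κ' / (2 * Z) with hγ
  have hγ0 : 0 < γ := by positivity
  obtain ⟨σ₁, hσ₁, hσ₁1, hclose⟩ := h.transitionCoeff_close hγ0
  refine ⟨min σ₁ (min (κ' / (2 * Y)) (min (1 / (4 * L)) (ρ / (8 * L)))), by positivity,
    fun ε hε hεσ H hH hHσ M hM => ?_⟩
  set σ := min σ₁ (min (κ' / (2 * Y)) (min (1 / (4 * L)) (ρ / (8 * L))))
  have s1 : σ ≤ σ₁ := min_le_left _ _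
  have s2 : ε ≤ κ' / (2 * Y) := hεσ.trans ((min_le_right _ _).trans (min_le_left _ _))
  have s3 : σ ≤ 1 / (4 * L) :=
    (min_le_right _ _).trans ((min_le_right _ _).trans (min_le_left _ _))
  have s4 : σ ≤ ρ / (8 * L) :=
    (min_le_right _ _).trans ((min_le_right _ _).trans (min_le_right _ _))
  have hε1 : ε ≤ 1 := hεσ.trans (s1.trans hσ₁1)
  have hHε : H ≤ ε := hHσ.trans (mul_le_of_le_one_left hε.le (s1.trans hσ₁1))
  rw [le_div_iff₀ (by positivity)] at s2 s3 s4
  set s := H / ε with hs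
  have hs0 : 0 < s := by positivity
  have hs1 : s ≤ 1 := (div_le_one hε).2 hHε
  have hHs : H = s * ε := by rw [hs]; field_simp
  have hr : Z * γ + Y * ε ≤ κ' := by
    have : Z * γ = κ' / 2 := by rw [hγ]; field_simp
    linarith
  set e : (Fin 3 → ℕ) → ℝ := fun j => 1 - transitionCoeff F n p Θ ε M j with he
  have hvdef : phaseField F G n p Θ ε M = fun x => M.splineJet e 0 (G x) := rfl
  filter_upwards [ae_all_iff.2 fun i => h.diffeo.weakPartial_pushforward M e i (ae_eq_refl _),
    ae_all_iff.2 fun i => h.diffeo.weakPartial_weakPartial_pushforward M e i,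
    ae_restrict_mem h.diffeo.isOpen.measurableSet] with x hx1 hx2 hx
  have hz := h.diffeo.mapsTo_inv hx
  have hxr := h.diffeo.right_inv x hx
  have hoff := (hx2 0).1
  rw [hvdef]
  simp only [weakLaplacian, hx1]
  choose q hqL hq using fun i => (hx2 i).2
  simp only [hq]
  constructor
  · rintro ⟨hin, -⟩
    have hsp : scaledPoint F n p ε (G x) = (x, inner ℝ n (x - p) / ε) := by
      rw [scaledPoint, hxr]
    have hcl := hclose ε hε (hεσ.trans s1) H hH
      (hHσ.trans (mul_le_mul_of_nonneg_right s1 hε.le)) M (G x) hz (by rwa [hxr])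
    set q₀ : E3 × ℝ := (x, inner ℝ n (x - p) / ε) with hq₀
    rw [hsp] at hcl
    set T := (scaleMap n ε).comp (fderiv ℝ F (G x)) with hT
    set Λ := (fderiv ℝ Θ q₀).comp T with hΛ
    set B := (1 / 2 : ℝ) • (fderiv ℝ (fderiv ℝ Θ) q₀).bilinearComp T T with hB
    obtain ⟨a0, a1, a2⟩ := M.splineJet_close (E := s ^ 2 * γ) (d := e) hc hH hM hz (1 - Θ q₀) (-Λ) (-B)
      fun j hj => by
        rw [TensorMesh.quasi_one_sub_quadPoly, he, sub_sub_sub_cancel_left, abs_sub_comm]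
        exact hcl j hj
    replace a2 := a2 hoff
    set g : Fin 3 → E3 := fun i => fderiv ℝ G x (EuclideanSpace.single i (1 : ℝ)) with hgdef
    have hgn : ∀ i, ‖g i‖ ≤ L := fun i => by
      have := (fderiv ℝ G x).le_opNorm (EuclideanSpace.single i (1 : ℝ))
      rw [PiLp.norm_single, norm_one, mul_one] at this
      exact this.trans (h.diffeo.norm_fderiv_inv_le x hx)
    have hg : ∀ i a, |g i a| ≤ L := fun i a => (PiLp.norm_apply_le (g i) a).trans (hgn i)
    have hTg : ∀ i, T (g i) = scaleMap n ε (EuclideanSpace.single i (1 : ℝ)) := fun i => by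
      rw [hT, ContinuousLinearMap.comp_apply, hgdef]
      simp only
      rw [h.diffeo.fderiv_comp_inv hx]
    set m : Fin 3 → ℝ := fun i => n i with hm
    have hinn : ∀ i, inner ℝ n (EuclideanSpace.single i (1 : ℝ)) = m i := fun i => by
      simp [EuclideanSpace.inner_single_right, hm]
    have hm1 : ∑ i, m i ^ 2 = 1 := by
      have := EuclideanSpace.norm_sq_eq n
      rw [h.norm_eq] at this
      simpa [hm] using this.symm
    have hmi : ∀ i, |m i| ≤ 1 := fun i => h.norm_eq ▸ PiLp.norm_apply_le n i
    set D₁ := fderiv ℝ Θ q₀ (0, 1) with hD₁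
    set D₂ := fderiv ℝ (fderiv ℝ Θ) q₀ (0, 1) (0, 1) with hD₂
    have n2 : ‖((0, 1) : E3 × ℝ)‖ = 1 := by
      rw [norm_prod_single]; simp
    have hD₁N : |D₁| ≤ N := by
      have := (fderiv ℝ Θ q₀).le_opNorm (0, 1)
      rw [n2, mul_one] at this
      exact this.trans (hN1 q₀)
    have hD₂N : |D₂| ≤ N := by
      have := (fderiv ℝ (fderiv ℝ Θ) q₀).le_opNorm₂ (0, 1) (0, 1)
      rw [n2, mul_one, mul_one] at this
      exact this.trans (hN2 q₀)
    set r := Z * γ + Y * ε with hrdef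
    have hr0 : 0 < r := by positivity
    have hr1 : r ≤ 1 := hr.trans hκ'1
    have k1 : ε * (27 * (s ^ 2 * γ * (4 / (c * H)))) ≤ 108 * γ / c := by
      have : ε * (27 * (s ^ 2 * γ * (4 / (c * H)))) = s * (108 * γ / c) := by
        rw [hHs]
        field_simp
        ring
      rw [this]
      exact mul_le_of_le_one_left (by positivity) hs1
    -- The factor `(H / ε)²` is used up entirely by `ε² / H²`: this is why the coefficients must be
    -- accurate to `o((H / ε)²)`.
    have k2 : ε ^ 2 * (27 * (s ^ 2 * γ * (4 / (c * H)) ^ 2)) = 432 * γ / c ^ 2 := by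
      rw [hHs]
      field_simp
      ring
    replace a1 : ∀ a, |M.splineJet e (Pi.single a 1) (G x) + Λ (EuclideanSpace.single a (1 : ℝ))| ≤
        27 * (s ^ 2 * γ * (4 / (c * H))) := fun a => by
      have := a1 a
      rwa [neg_apply, sub_neg_eq_add] at this
    replace a2 : ∀ a b, |M.splineJet e (Pi.single a 1 + Pi.single b 1) (G x) +
        (B (EuclideanSpace.single a (1 : ℝ)) (EuclideanSpace.single b (1 : ℝ)) +
          B (EuclideanSpace.single b (1 : ℝ)) (EuclideanSpace.single a (1 : ℝ)))| ≤
        27 * (s ^ 2 * γ * (4 / (c * H)) ^ 2) := fun a b => by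
      have := a2 a b
      rwa [neg_apply, neg_apply, neg_apply, neg_apply, ← neg_add, sub_neg_eq_add] at this
    have grad : ∀ i, |ε * (∑ a, M.splineJet e (Pi.single a 1) (G x) * g i a) - -(m i * D₁)| ≤ r := by
      intro i
      have b1 := abs_sum_mul_add_le a1 (hg i)
      have b2 := abs_apply_scaleMap_sub_le (n := n) (hN1 q₀) ε (EuclideanSpace.single i (1 : ℝ))
      rw [hinn, PiLp.norm_single, norm_one, mul_one, ← hTg] at b2
      have b3 : ε * (3 * L * (27 * (s ^ 2 * γ * (4 / (c * H))))) ≤ 324 * L / c * γ := by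
        calc _ = 3 * L * (ε * (27 * (s ^ 2 * γ * (4 / (c * H))))) := by ring
          _ ≤ 3 * L * (108 * γ / c) := by gcongr
          _ = _ := by ring
      have e1 : ε * (∑ a, M.splineJet e (Pi.single a 1) (G x) * g i a) - -(m i * D₁) =
          ε * (∑ a, M.splineJet e (Pi.single a 1) (G x) * g i a + Λ (g i)) -
          ε * (fderiv ℝ Θ q₀ (T (g i)) - m i / ε * D₁) := by
        rw [hΛ, ContinuousLinearMap.comp_apply]
        field_simp
        ring
      rw [e1]
      refine (abs_sub _ _).trans ?_
      rw [abs_mul, abs_mul, abs_of_pos hε]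
      have b4 : ε * |∑ a, M.splineJet e (Pi.single a 1) (G x) * g i a + Λ (g i)| ≤
          324 * L / c * γ := (mul_le_mul_of_nonneg_left b1 hε.le).trans b3
      have b5 : ε * |fderiv ℝ Θ q₀ (T (g i)) - m i / ε * D₁| ≤ ε * N :=
        mul_le_mul_of_nonneg_left b2 hε.le
      have b6 : 324 * L / c * γ ≤ Z * γ := by
        refine mul_le_mul_of_nonneg_right ?_ hγ0.le
        have : 0 ≤ 3 * (3888 * L ^ 2 / c ^ 2 + 324 * L / c) := by positivity
        rw [hZ]
        linarith
      have b7 : ε * N ≤ Y * ε := by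
        have : 0 ≤ (9 * N * L ^ 2 + 9 * N) * ε := by positivity
        rw [hY]
        linarith
      linarith
    have second : ∀ i, |ε ^ 2 * (∑ a, ((∑ b, M.splineJet e (Pi.single a 1 + Pi.single b 1) (G x) *
        g i b) * g i a + M.splineJet e (Pi.single a 1) (G x) * q i a)) - -(m i ^ 2 * D₂)| ≤
        (3888 * L ^ 2 / c ^ 2 + 324 * L / c) * γ + (3 * N * L ^ 2 + 3 * N) * ε := by
      intro i
      have b1 := abs_sum_sum_mul_add_le a2 (hg i)
      have b2 := abs_apply_apply_scaleMap_sub_le h.norm_eq (hN2 q₀) hε hε1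
        (EuclideanSpace.single i (1 : ℝ))
      rw [hinn, PiLp.norm_single, norm_one, one_pow, mul_one, ← hTg] at b2
      have hBg : 2 * B (g i) (g i) = fderiv ℝ (fderiv ℝ Θ) q₀ (T (g i)) (T (g i)) := by
        simp [hB]
      -- First derivatives are `O(1 / ε)`, so their products with second derivatives of `G` are
      -- negligible after multiplication by `ε²`.
      have hSa : ∀ a, ε ^ 2 * |M.splineJet e (Pi.single a 1) (G x)| ≤ N * L * ε + 108 / c * γ := by
        intro a
        have c1 : |Λ (EuclideanSpace.single a (1 : ℝ))| ≤ N * (L / ε) := by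
          rw [hΛ, ContinuousLinearMap.comp_apply]
          refine ((fderiv ℝ Θ q₀).le_opNorm _).trans (mul_le_mul (hN1 q₀) ?_ (norm_nonneg _) hN.le)
          rw [hT, ContinuousLinearMap.comp_apply]
          refine (norm_scaleMap_le h.norm_eq hε hε1 _).trans (div_le_div_of_nonneg_right ?_ hε.le)
          have := (fderiv ℝ F (G x)).le_opNorm (EuclideanSpace.single a (1 : ℝ))
          rw [PiLp.norm_single, norm_one, mul_one] at this
          exact this.trans (h.diffeo.norm_fderiv_le _ hz)
        have c2 : |M.splineJet e (Pi.single a 1) (G x)| ≤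
            N * (L / ε) + 27 * (s ^ 2 * γ * (4 / (c * H))) := by
          have c3 := a1 a
          rw [abs_le] at c1 c3 ⊢
          constructor <;> linarith
        calc _ ≤ ε ^ 2 * (N * (L / ε) + 27 * (s ^ 2 * γ * (4 / (c * H)))) := by gcongr
          _ = N * L * ε + ε * (ε * (27 * (s ^ 2 * γ * (4 / (c * H))))) := by
            field_simp
          _ ≤ N * L * ε + 1 * (108 * γ / c) := by gcongr
          _ = _ := by ring
      have hY' : ε ^ 2 * |∑ a, M.splineJet e (Pi.single a 1) (G x) * q i a| ≤
          3 * N * L ^ 2 * ε + 324 * L / c * γ := by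
        calc _ ≤ ε ^ 2 * ∑ a, |M.splineJet e (Pi.single a 1) (G x) * q i a| := by
              gcongr
              exact Finset.abs_sum_le_sum_abs _ _
          _ = ∑ a, (ε ^ 2 * |M.splineJet e (Pi.single a 1) (G x)|) * |q i a| := by
              rw [Finset.mul_sum]
              refine Finset.sum_congr rfl fun a _ => ?_
              rw [abs_mul, mul_assoc]
          _ ≤ ∑ _a : Fin 3, (N * L * ε + 108 / c * γ) * L := by
              refine Finset.sum_le_sum fun a _ => ?_
              exact mul_le_mul (hSa a) (hqL i a) (abs_nonneg _) (by positivity)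
          _ = _ := by
              simp
              ring
      have e1 : ε ^ 2 * (∑ a, ((∑ b, M.splineJet e (Pi.single a 1 + Pi.single b 1) (G x) *
          g i b) * g i a + M.splineJet e (Pi.single a 1) (G x) * q i a)) - -(m i ^ 2 * D₂) =
          ε ^ 2 * (∑ a, (∑ b, M.splineJet e (Pi.single a 1 + Pi.single b 1) (G x) *
            g i b) * g i a + 2 * B (g i) (g i)) +
          ε ^ 2 * ∑ a, M.splineJet e (Pi.single a 1) (G x) * q i a -
          ε ^ 2 * (fderiv ℝ (fderiv ℝ Θ) q₀ (T (g i)) (T (g i)) - (m i / ε) ^ 2 * D₂) := by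
        rw [hBg, Finset.sum_add_distrib]
        field_simp
        ring
      rw [e1]
      refine (abs_sub _ _).trans ?_
      refine (add_le_add_left (abs_add_le _ _) _).trans ?_
      rw [abs_mul, abs_mul, abs_mul, abs_of_pos (pow_pos hε 2)]
      have b4 := mul_le_mul_of_nonneg_left b1 (pow_pos hε 2).le
      have b5 := mul_le_mul_of_nonneg_left b2 (pow_pos hε 2).le
      have b6 : ε ^ 2 * (9 * L ^ 2 * (27 * (s ^ 2 * γ * (4 / (c * H)) ^ 2))) =
          3888 * L ^ 2 / c ^ 2 * γ := by
        calc _ = 9 * L ^ 2 * (ε ^ 2 * (27 * (s ^ 2 * γ * (4 / (c * H)) ^ 2))) := by ring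
          _ = _ := by rw [k2]; ring
      have b7 : ε ^ 2 * (3 * N / ε) = 3 * N * ε := by
        field_simp
      linarith
    have lap : |ε ^ 2 * (∑ i, ∑ a, ((∑ b, M.splineJet e (Pi.single a 1 + Pi.single b 1) (G x) *
        g i b) * g i a + M.splineJet e (Pi.single a 1) (G x) * q i a)) - -D₂| ≤ r := by
      have e1 : ε ^ 2 * (∑ i, ∑ a, ((∑ b, M.splineJet e (Pi.single a 1 + Pi.single b 1) (G x) *
          g i b) * g i a + M.splineJet e (Pi.single a 1) (G x) * q i a)) - -D₂ =
          ∑ i, (ε ^ 2 * (∑ a, ((∑ b, M.splineJet e (Pi.single a 1 + Pi.single b 1) (G x) *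
          g i b) * g i a + M.splineJet e (Pi.single a 1) (G x) * q i a)) - -(m i ^ 2 * D₂)) := by
        rw [Finset.sum_sub_distrib, ← Finset.mul_sum, Finset.sum_neg_distrib, ← Finset.sum_mul, hm1,
          one_mul]
      rw [e1]
      refine (Finset.abs_sum_le_sum_abs _ _).trans ((Finset.sum_le_sum fun i _ => second i).trans ?_)
      rw [Finset.sum_const, Finset.card_univ, Fintype.card_fin, nsmul_eq_mul, hrdef, hZ, hY]
      have : 0 ≤ (27 + 324 * L / c) * γ := by positivity
      have : 0 ≤ N * ε := by positivity
      push_cast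
      linarith
    have v0 : |(M.splineJet e 0 (G x) - 1) - -Θ q₀| ≤ r := by
      have e1 : (M.splineJet e 0 (G x) - 1) - -Θ q₀ = M.splineJet e 0 (G x) - (1 - Θ q₀) := by ring
      rw [e1]
      refine a0.trans ?_
      have c1 : s ^ 2 ≤ 1 := pow_le_one₀ hs0.le hs1
      have c2 : 27 * (s ^ 2 * γ) ≤ 27 * (1 * γ) := by gcongr
      have c3 : 27 * γ ≤ Z * γ := by
        refine mul_le_mul_of_nonneg_right ?_ hγ0.le
        have : 0 ≤ 324 * L / c + 3 * (3888 * L ^ 2 / c ^ 2 + 324 * L / c) := by positivity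
        rw [hZ]
        linarith
      have c4 : 0 ≤ Y * ε := by positivity
      linarith
    have hΘ01 := h.sepProfile_mem q₀
    have f0 := sq_le_sq_add_of_abs_sub_le v0 (N := 1)
      (by rw [abs_neg, abs_of_nonneg hΘ01.1]; exact hΘ01.2) hr1
    have f1 : ∀ i, (ε * (∑ a, M.splineJet e (Pi.single a 1) (G x) * g i a)) ^ 2 ≤
        m i ^ 2 * D₁ ^ 2 + (2 * N + 1) * r := fun i => by
      have := sq_le_sq_add_of_abs_sub_le (grad i) (N := N) (by
        rw [abs_neg, abs_mul]
        calc |m i| * |D₁| ≤ 1 * N := mul_le_mul (hmi i) hD₁N (abs_nonneg _) zero_le_one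
          _ = N := one_mul N) hr1
      have e0 : (-(m i * D₁)) ^ 2 = m i ^ 2 * D₁ ^ 2 := by ring
      rwa [e0] at this
    have f2 := sq_le_sq_add_of_abs_sub_le lap (N := N) (by rwa [abs_neg]) hr1
    have f1' : ∑ i, (ε * (∑ a, M.splineJet e (Pi.single a 1) (G x) * g i a)) ^ 2 ≤
        D₁ ^ 2 + 3 * ((2 * N + 1) * r) := by
      refine (Finset.sum_le_sum fun i _ => f1 i).trans (le_of_eq ?_)
      rw [Finset.sum_add_distrib, ← Finset.sum_mul, hm1, one_mul]
      simp
    have hχ := h.χ_bounds x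
    have hχ2 : χ x ^ 2 ≤ 1 := pow_le_one₀ hχ.1 hχ.2
    have v1 : D₁ = χ x * deriv w (inner ℝ n (x - p) / ε) := by
      rw [hD₁, hΘ, fderiv_sepProfile_snd h.χ_smooth h.w_smooth, sepProfile]
    have v2 : D₂ = χ x * deriv (deriv w) (inner ℝ n (x - p) / ε) := by
      rw [hD₂, hΘ, fderiv_fderiv_sepProfile_snd h.χ_smooth h.w_smooth, sepProfile]
    have v3 : Θ q₀ = χ x * w (inner ℝ n (x - p) / ε) := rfl
    have hpe : Θ q₀ ^ 2 + 2 * D₁ ^ 2 + D₂ ^ 2 ≤ profileEnergy w (inner ℝ n (x - p) / ε) := by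
      rw [v1, v2, v3, profileEnergy]
      have : (χ x * w (inner ℝ n (x - p) / ε)) ^ 2 +
          2 * (χ x * deriv w (inner ℝ n (x - p) / ε)) ^ 2 +
          (χ x * deriv (deriv w) (inner ℝ n (x - p) / ε)) ^ 2 =
        χ x ^ 2 * (w (inner ℝ n (x - p) / ε) ^ 2 + 2 * deriv w (inner ℝ n (x - p) / ε) ^ 2 +
          deriv (deriv w) (inner ℝ n (x - p) / ε) ^ 2) := by ring
      rw [this]
      exact mul_le_of_le_one_left (by positivity) hχ2
    have e2 : 2 * ε ^ 2 * ∑ i, (∑ a, M.splineJet e (Pi.single a 1) (G x) * g i a) ^ 2 =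
        2 * ∑ i, (ε * (∑ a, M.splineJet e (Pi.single a 1) (G x) * g i a)) ^ 2 := by
      simp only [mul_pow, ← Finset.mul_sum]
      ring
    have e3 : ∀ t : ℝ, ε ^ 4 * t ^ 2 = (ε ^ 2 * t) ^ 2 := fun t => by ring
    rw [neg_sq] at f0 f2
    change (M.splineJet e 0 (G x) - 1) ^ 2 +
      2 * ε ^ 2 * ∑ i, (∑ a, M.splineJet e (Pi.single a 1) (G x) * g i a) ^ 2 +
      ε ^ 4 * (∑ i, ∑ a, ((∑ b, M.splineJet e (Pi.single a 1 + Pi.single b 1) (G x) *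
        g i b) * g i a + M.splineJet e (Pi.single a 1) (G x) * q i a)) ^ 2 ≤ _
    rw [e2, e3]
    have hrκ : 10 * (2 * N + 3) * r ≤ κ := (mul_le_mul_of_nonneg_left hr (by positivity)).trans hκ'2
    have : 0 ≤ N * r := by positivity
    linarith
  · intro hout
    obtain ⟨a0, a1, a2⟩ := M.splineJet_eq_of_const_near (A := 1) (d := e) hc hH hM hz fun j hj => by
      rw [he]
      simp only
      rw [h.transitionCoeff_eq_zero hε hH ?_ ?_ hz (by rwa [hxr]) hj, sub_zero]
      · nlinarith
      · nlinarith
    simp [a0, a1, a2 hoff]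

end IsTubeData

/-! ### The recovery sequence for the phase field -/

theorem mem_cthickening_iff_infDist {J : Set E3} (hne : J.Nonempty) {r : ℝ} (hr : 0 ≤ r) {x : E3} :
    x ∈ Metric.cthickening r J ↔ Metric.infDist x J ≤ r := by
  rw [Metric.mem_cthickening_iff, ENNReal.le_ofReal_iff_toReal_le (Metric.infEDist_ne_top hne) hr]
  rfl

theorem abs_inner_le_infDist {J : Set E3} (hne : J.Nonempty) {n p : E3} (hn : ‖n‖ = 1)
    (h : ∀ x ∈ J, inner ℝ n (x - p) = 0) (x : E3) : |inner ℝ n (x - p)| ≤ Metric.infDist x J := by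
  refine (Metric.le_infDist hne).2 fun z hz => ?_
  have e : inner ℝ n (x - p) = inner ℝ n (x - z) := by
    have : x - p = (x - z) + (z - p) := by abel
    rw [this, inner_add_right, h z hz, add_zero]
  have := norm_inner_le_norm (𝕜 := ℝ) n (x - z)
  rwa [hn, one_mul, ← dist_eq_norm, Real.norm_eq_abs, ← e] at this

theorem lintegral_comp_div {f : ℝ → ℝ≥0∞} (hf : Measurable f) {ε : ℝ} (hε : 0 < ε) :
    ∫⁻ t, f (t / ε) = ENNReal.ofReal ε * ∫⁻ t, f t := by
  have h := Real.smul_map_volume_mul_left (a := ε⁻¹) (inv_ne_zero hε.ne')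
  rw [abs_of_pos (inv_pos.2 hε)] at h
  have h2 : ∫⁻ t, f t = ENNReal.ofReal ε⁻¹ * ∫⁻ t, f (t / ε) := by
    conv_lhs => rw [← h, lintegral_smul_measure]
    rw [lintegral_map hf (by fun_prop)]
    simp only [smul_eq_mul, div_eq_inv_mul]
  rw [h2, ← mul_assoc, ← ENNReal.ofReal_mul hε.le, mul_inv_cancel₀ hε.ne', ENNReal.ofReal_one,
    one_mul]

theorem DiffeoBounds.continuousOn_inv {F G : E3 → E3} {Ω : Set E3} {L : ℝ}
    (h : DiffeoBounds F G Ω L) : ContinuousOn G Ω := h.contDiffOn_inv.continuousOn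

theorem exists_isTubeData {F G : E3 → E3} {Ω J : Set E3} {L : ℝ} (hD : DiffeoBounds F G Ω L)
    (hJc : IsCompact J) (hne : J.Nonempty) (hJ : J ⊆ Ω) {n p : E3} (hn : ‖n‖ = 1)
    (hJn : ∀ x ∈ J, inner ℝ n (x - p) = 0) {w : ℝ → ℝ} {l K ρ₁ : ℝ} (hl : 0 < l) (hK : 0 < K)
    (hρ₁ : 0 < ρ₁) (hw : ContDiff ℝ ∞ w) (hwb : ∀ t, 0 ≤ w t ∧ w t ≤ 1)
    (hw1 : ∀ t, |t| ≤ l → w t = 1) (hw0 : ∀ t, K ≤ |t| → w t = 0)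
    (hwf : ∀ t, w t = 0 ∨ w t = 1 → deriv (deriv w) t = 0) :
    ∃ (χ : E3 → ℝ) (ρ r₀ : ℝ), ρ ≤ ρ₁ ∧ IsTubeData F G Ω J L n p χ w ρ r₀ l K := by
  obtain ⟨ρ₂, hρ₂, hsub⟩ := hJc.exists_cthickening_subset_open hD.isOpen hJ
  set ρ := min ρ₁ ρ₂ with hρdef
  have hρ : 0 < ρ := lt_min hρ₁ hρ₂
  have hsubρ : Metric.cthickening ρ J ⊆ Ω :=
    (Metric.cthickening_mono (min_le_right _ _) J).trans hsub
  have hKc : IsCompact (Metric.cthickening ρ J) := hJc.cthickening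
  -- The preimage of the compact tube is compact in the open patch, so balls of a fixed radius
  -- around its points stay inside.
  obtain ⟨r₀, hr₀, hr₀sub⟩ := (hKc.image_of_continuousOn
    (hD.continuousOn_inv.mono hsubρ)).exists_thickening_subset_open TensorMesh.isOpen_patch
      (image_subset_iff.2 fun x hx => hD.mapsTo_inv (hsubρ hx))
  have hcont : Continuous fun x : E3 => Metric.infDist x J := Metric.continuous_infDist_pt J
  obtain ⟨χ, hχ0, hχ1, hχb⟩ := exists_contMDiffMap_zero_one_of_isClosed (n := ⊤)
    (modelWithCornersSelf ℝ E3) (M := E3)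
    (s := {x | ρ / 2 ≤ Metric.infDist x J}) (t := {x | Metric.infDist x J ≤ ρ / 4})
    (isClosed_le continuous_const hcont) (isClosed_le hcont continuous_const) (by
      rw [Set.disjoint_left]
      intro x h1 h2
      have h1' : ρ / 2 ≤ Metric.infDist x J := h1
      have h2' : Metric.infDist x J ≤ ρ / 4 := h2
      linarith)
  refine ⟨χ, ρ, r₀, min_le_left _ _, ?_⟩
  exact
    { diffeo := hD
      norm_eq := hn
      abs_inner_le := abs_inner_le_infDist hne hn hJn
      ρ_pos := hρ
      r₀_pos := hr₀
      l_pos := hl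
      K_pos := hK
      ball_subset := by
        intro y hy hyρ
        have h1 : y ∈ G '' Metric.cthickening ρ J :=
          ⟨F y, (mem_cthickening_iff_infDist hne hρ.le).2 hyρ, hD.left_inv y hy⟩
        exact (Metric.ball_subset_thickening h1 r₀).trans hr₀sub
      χ_smooth := contMDiff_iff_contDiff.1 χ.contMDiff
      χ_compact := by
        refine HasCompactSupport.intro hKc fun x hx => hχ0 ?_
        rw [mem_cthickening_iff_infDist hne hρ.le] at hx
        show ρ / 2 ≤ _
        linarith
      χ_bounds := fun x => hχb x
      χ_zero := fun x hx => hχ0 hx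
      χ_one := fun x hx => hχ1 hx
      w_smooth := hw
      w_bounds := hwb
      w_one := hw1
      w_zero := hw0
      w_flat := hwf }

/-- The Fubini estimate applied to the indicator of `[-r, r]`. The linear rate turns `η / ε²` into
`η / ε` in the elastic energy, and `r = 0` shows that `J` is null. -/
theorem volume_cthickening_le {J : Set E3} (hJc : IsCompact J) (hne : J.Nonempty) {n p : E3}
    (hn : ‖n‖ = 1) (hJn : ∀ x ∈ J, inner ℝ n (x - p) = 0) :
    ∃ ρ C : ℝ, 0 < ρ ∧ 0 ≤ C ∧ ∀ r, 0 ≤ r → r ≤ ρ →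
      volume {x | Metric.infDist x J ≤ r} ≤ ENNReal.ofReal (C * r) := by
  obtain ⟨hfin, hint⟩ := hausdorff_lt_top_and_lintegral_cthickening_le hJc hn hJn
  obtain ⟨ρ, hρ, hle⟩ := hint 1 one_pos
  set m := Measure.euclideanHausdorffMeasure 2 J with hm
  have hm1 : m + ENNReal.ofReal 1 ≠ ⊤ := by simpa using hfin.ne
  refine ⟨ρ, 2 * (m + ENNReal.ofReal 1).toReal, hρ, by positivity, fun r hr hrρ => ?_⟩
  have hmeas : Measurable ((Icc (-r) r).indicator (1 : ℝ → ℝ≥0∞)) :=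
    measurable_one.indicator measurableSet_Icc
  have h1 := hle _ hmeas
  rw [lintegral_indicator_one measurableSet_Icc, Real.volume_Icc] at h1
  have hAm : MeasurableSet {x | Metric.infDist x J ≤ r} :=
    (isClosed_le (Metric.continuous_infDist_pt J) continuous_const).measurableSet
  have h2 : volume {x | Metric.infDist x J ≤ r} ≤ ∫⁻ x in Metric.cthickening ρ J,
      (Icc (-r) r).indicator (1 : ℝ → ℝ≥0∞) (inner ℝ n (x - p)) := by
    rw [← lintegral_indicator_one hAm, ← lintegral_indicator Metric.isClosed_cthickening.measurableSet]
    refine lintegral_mono fun x => ?_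
    by_cases hx : x ∈ {x | Metric.infDist x J ≤ r}
    · have hx' : Metric.infDist x J ≤ r := hx
      have h3 : x ∈ Metric.cthickening ρ J :=
        (mem_cthickening_iff_infDist hne hρ.le).2 (hx'.trans hrρ)
      have h4 : inner ℝ n (x - p) ∈ Icc (-r) r :=
        abs_le.1 ((abs_inner_le_infDist hne hn hJn x).trans hx')
      rw [indicator_of_mem hx, indicator_of_mem h3, indicator_of_mem h4]
      rfl
    · rw [indicator_of_notMem hx]
      exact zero_le
  refine h2.trans (h1.trans (le_of_eq ?_))
  rw [← ENNReal.ofReal_toReal hm1, ← ENNReal.ofReal_mul ENNReal.toReal_nonneg,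
    ENNReal.toReal_ofReal ENNReal.toReal_nonneg]
  congr 1
  ring

/-- The pointwise bound depends only on the normal coordinate, so Fubini applies, and the factor
`ε⁻¹` cancels against the substitution `t / ε`. -/
theorem exists_phaseFields {F G : E3 → E3} {Ω : Set E3} {L : ℝ} (hD : DiffeoBounds F G Ω L)
    {J : Set E3} (hJc : IsCompact J) (hne : J.Nonempty) (hJ : J ⊆ Ω) {n p : E3} (hn : ‖n‖ = 1)
    (hJn : ∀ x ∈ J, inner ℝ n (x - p) = 0) {ε H : ℕ → ℝ}
    (hε_pos : ∀ k, 0 < ε k) (hε : Tendsto ε atTop (𝓝 0)) {c : ℝ} (hc : 0 < c)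
    (hH : ∀ k, 0 < H k) (hHε : H =o[atTop] ε) {M : ℕ → TensorMesh}
    (hM : ∀ k, (M k).IsQuasiUniform c (H k)) {δ : ℝ} (hδ : 0 < δ) :
    ∃ (vh : ℕ → E3 → ℝ) (l : ℝ), 0 < l ∧ (∀ k, vh k ∈ splineV (M k) G) ∧
      (∀ k, ∀ x ∈ Ω, 0 ≤ vh k x ∧ vh k x ≤ 1) ∧
      (∀ᶠ k in atTop, ∀ x ∈ Ω, Metric.infDist x J ≤ l * ε k → vh k x = 0) ∧
      ∀ᶠ k in atTop, ∫⁻ x in Ω, ENNReal.ofReal ((ε k)⁻¹ * (vh k x - 1) ^ 2 +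
        2 * ε k * ∑ i : Fin 3, weakPartial Ω i (vh k) x ^ 2 +
          ε k ^ 3 * weakLaplacian Ω (vh k) x ^ 2) ≤
        4 * Measure.euclideanHausdorffMeasure 2 J + ENNReal.ofReal δ := by
  obtain ⟨hfin, hint⟩ := hausdorff_lt_top_and_lintegral_cthickening_le hJc hn hJn
  set m := Measure.euclideanHausdorffMeasure 2 J with hm
  -- Chosen so that `(m + δ') (4 + 2 δ') ≤ 4 m + δ' (2 m + 6) ≤ 4 m + δ`, where `δ' ≤ 1`.
  set δ' := min 1 (δ / (2 * m.toReal + 6)) with hδ'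
  have hm0 : 0 ≤ m.toReal := ENNReal.toReal_nonneg
  have hδ'0 : 0 < δ' := by positivity
  have hδ'1 : δ' ≤ 1 := min_le_left _ _
  have hδ'2 : δ' * (2 * m.toReal + 6) ≤ δ := (le_div_iff₀ (by positivity)).1 (min_le_right _ _)
  obtain ⟨ρ₁, hρ₁, hle⟩ := hint δ' hδ'0
  obtain ⟨w, l, K, hl, hK, hw, hwb, hw1, hw0, hwf, hwE⟩ := exists_profile hδ'0
  obtain ⟨χ, ρ, r₀, hρρ₁, h⟩ := exists_isTubeData hD hJc hne hJ hn hJn hl hK hρ₁ hw hwb hw1 hw0 hwf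
  -- The pointwise error lives on an interval of length `2 (K + 1)` in the scaled variable, so it
  -- costs `δ'`.
  set κ := δ' / (2 * (K + 1)) with hκ
  have hκ0 : 0 < κ := by positivity
  obtain ⟨σ₁, hσ₁, hz⟩ := h.phaseField_eq_zero hc
  obtain ⟨σ₂, hσ₂, hdens⟩ := h.phaseField_density hc hκ0
  have hev : ∀ σ : ℝ, 0 < σ → ∀ᶠ k in atTop, ε k ≤ σ ∧ H k ≤ σ * ε k := by
    intro σ hσ
    filter_upwards [hε.eventually (ge_mem_nhds hσ), isLittleO_iff.1 hHε hσ] with k h1 h2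
    refine ⟨h1, ?_⟩
    rwa [Real.norm_eq_abs, Real.norm_eq_abs, abs_of_pos (hH k), abs_of_pos (hε_pos k)] at h2
  refine ⟨fun k => phaseField F G n p (sepProfile χ w) (ε k) (M k), l / 2, half_pos hl,
    fun k => TensorMesh.splineJet_zero_mem_splineV _ _, fun k x hx => h.phaseField_mem _ _ _ hx,
    ?_, ?_⟩
  · filter_upwards [hev σ₁ hσ₁] with k hk
    exact hz (ε k) (hε_pos k) hk.1 (H k) (hH k) hk.2 (M k) (hM k)
  · filter_upwards [hev σ₂ hσ₂] with k hk
    have hd := hdens (ε k) (hε_pos k) hk.1 (H k) (hH k) hk.2 (M k) (hM k)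
    set v := phaseField F G n p (sepProfile χ w) (ε k) (M k) with hv
    set e := ε k with he
    have he0 : 0 < e := hε_pos k
    have hpm : Measurable (profileEnergy w) := by
      unfold profileEnergy
      have hc : Measurable w := hw.continuous.measurable
      exact ((hc.pow_const 2).add (((measurable_deriv _).pow_const 2).const_mul 2)).add
        ((measurable_deriv _).pow_const 2)
    set f : ℝ → ℝ≥0∞ := fun s => ENNReal.ofReal (profileEnergy w s) +
      (Icc (-(K + 1)) (K + 1)).indicator (fun _ => ENNReal.ofReal κ) s with hf
    have hfm : Measurable f := (ENNReal.measurable_ofReal.comp hpm).add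
      (measurable_const.indicator measurableSet_Icc)
    have hfint : ∫⁻ s, f s ≤ ENNReal.ofReal (4 + 2 * δ') := by
      have hpm' : Measurable fun s => ENNReal.ofReal (profileEnergy w s) :=
        ENNReal.measurable_ofReal.comp hpm
      rw [hf, lintegral_add_left hpm',
        lintegral_indicator measurableSet_Icc, lintegral_const, Measure.restrict_apply_univ,
        Real.volume_Icc, ← ENNReal.ofReal_mul hκ0.le]
      refine (add_le_add_left hwE _).trans ?_
      rw [← ENNReal.ofReal_add (by positivity) (mul_nonneg hκ0.le (by linarith))]
      refine ENNReal.ofReal_le_ofReal (le_of_eq ?_)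
      rw [hκ]
      field_simp
      ring
    have hfe : Measurable fun t => f (t / e) := hfm.comp (measurable_id.div_const e)
    have hgm : Measurable fun t => ENNReal.ofReal e⁻¹ * f (t / e) := hfe.const_mul _
    have hgint : ∫⁻ t, ENNReal.ofReal e⁻¹ * f (t / e) = ∫⁻ s, f s := by
      rw [lintegral_const_mul _ hfe, lintegral_comp_div hfm he0,
        ← mul_assoc, ← ENNReal.ofReal_mul (inv_pos.2 he0).le, inv_mul_cancel₀ he0.ne',
        ENNReal.ofReal_one, one_mul]
    have hpos : ∀ s, 0 ≤ profileEnergy w s := fun s => by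
      unfold profileEnergy
      positivity
    have hmono : ∫⁻ x in Ω, ENNReal.ofReal (e⁻¹ * (v x - 1) ^ 2 +
        2 * e * ∑ i : Fin 3, weakPartial Ω i v x ^ 2 + e ^ 3 * weakLaplacian Ω v x ^ 2) ≤
        ∫⁻ x in Ω, (Metric.cthickening ρ₁ J).indicator
          (fun x => ENNReal.ofReal e⁻¹ * f (inner ℝ n (x - p) / e)) x := by
      refine lintegral_mono_ae ?_
      filter_upwards [hd] with x hx
      by_cases hin : Metric.infDist x J ≤ ρ ∧ |inner ℝ n (x - p)| ≤ (K + 1) * e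
      · have h1 := hx.1 hin
        have h2 : x ∈ Metric.cthickening ρ₁ J :=
          (mem_cthickening_iff_infDist hne hρ₁.le).2 (hin.1.trans hρρ₁)
        have h3 : inner ℝ n (x - p) / e ∈ Icc (-(K + 1)) (K + 1) := by
          refine abs_le.1 ?_
          rw [abs_div, abs_of_pos he0, div_le_iff₀ he0]
          exact hin.2
        rw [indicator_of_mem h2, hf]
        simp only
        rw [indicator_of_mem h3, ← ENNReal.ofReal_add (hpos _) hκ0.le,
          ← ENNReal.ofReal_mul (inv_pos.2 he0).le]
        refine ENNReal.ofReal_le_ofReal ?_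
        have e1 : e⁻¹ * (v x - 1) ^ 2 + 2 * e * ∑ i : Fin 3, weakPartial Ω i v x ^ 2 +
            e ^ 3 * weakLaplacian Ω v x ^ 2 = e⁻¹ * ((v x - 1) ^ 2 +
            2 * e ^ 2 * ∑ i : Fin 3, weakPartial Ω i v x ^ 2 +
            e ^ 4 * weakLaplacian Ω v x ^ 2) := by
          field_simp
        rw [e1]
        exact mul_le_mul_of_nonneg_left h1 (inv_pos.2 he0).le
      · obtain ⟨h1, h2, h3⟩ := hx.2 hin
        rw [h1, h3]
        simp [h2]
    refine hmono.trans ?_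
    calc _ ≤ ∫⁻ x, (Metric.cthickening ρ₁ J).indicator
          (fun x => ENNReal.ofReal e⁻¹ * f (inner ℝ n (x - p) / e)) x :=
          lintegral_mono' Measure.restrict_le_self le_rfl
      _ = ∫⁻ x in Metric.cthickening ρ₁ J, ENNReal.ofReal e⁻¹ * f (inner ℝ n (x - p) / e) :=
          lintegral_indicator Metric.isClosed_cthickening.measurableSet _
      _ ≤ (m + ENNReal.ofReal δ') * ∫⁻ t, ENNReal.ofReal e⁻¹ * f (t / e) := hle _ hgm
      _ ≤ (m + ENNReal.ofReal δ') * ENNReal.ofReal (4 + 2 * δ') := by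
          rw [hgint]
          gcongr
      _ ≤ _ := by
          rw [← ENNReal.ofReal_toReal hfin.ne, ← ENNReal.ofReal_add hm0 hδ'0.le,
            ← ENNReal.ofReal_mul (by positivity),
            show (4 : ℝ≥0∞) = ENNReal.ofReal 4 by simp, ← ENNReal.ofReal_mul (by norm_num),
            ← ENNReal.ofReal_add (by positivity) hδ.le]
          refine ENNReal.ofReal_le_ofReal ?_
          nlinarith

/-! ### The recovery sequence for the displacement -/

/-- A Lipschitz cutoff vanishing at distance at most `r` from `J`, equal to one at distance at
least `2 * r`. -/
noncomputable def distCutoff (J : Set E3) (r : ℝ) (x : E3) : ℝ :=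
  min 1 (max 0 (Metric.infDist x J / r - 1))

theorem distCutoff_mem (J : Set E3) (r : ℝ) (x : E3) :
    0 ≤ distCutoff J r x ∧ distCutoff J r x ≤ 1 :=
  ⟨le_min zero_le_one (le_max_left _ _), min_le_left _ _⟩

theorem distCutoff_eq_zero {J : Set E3} {r : ℝ} (hr : 0 < r) {x : E3}
    (hx : Metric.infDist x J ≤ r) : distCutoff J r x = 0 := by
  have : Metric.infDist x J / r ≤ 1 := (div_le_one hr).2 hx
  rw [distCutoff, max_eq_left (by linarith), min_eq_right zero_le_one]

theorem distCutoff_eq_one {J : Set E3} {r : ℝ} (hr : 0 < r) {x : E3}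
    (hx : 2 * r ≤ Metric.infDist x J) : distCutoff J r x = 1 := by
  have : 2 ≤ Metric.infDist x J / r := (le_div_iff₀ hr).2 hx
  rw [distCutoff, max_eq_right (by linarith), min_eq_left (by linarith)]

theorem abs_distCutoff_sub_le (J : Set E3) {r : ℝ} (hr : 0 < r) (x y : E3) :
    |distCutoff J r x - distCutoff J r y| ≤ dist x y / r := by
  have h1 := abs_min_sub_min_le_max 1 (max 0 (Metric.infDist x J / r - 1)) 1
    (max 0 (Metric.infDist y J / r - 1))
  have h2 := abs_max_sub_max_le_max 0 (Metric.infDist x J / r - 1) 0 (Metric.infDist y J / r - 1)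
  have h3 : |Metric.infDist x J / r - 1 - (Metric.infDist y J / r - 1)| ≤ dist x y / r := by
    rw [sub_sub_sub_cancel_right, ← sub_div, abs_div, abs_of_pos hr]
    refine div_le_div_of_nonneg_right ?_ hr.le
    have := (Metric.lipschitz_infDist_pt J).dist_le_mul x y
    rwa [Real.dist_eq, NNReal.coe_one, one_mul] at this
  have h0 : 0 ≤ dist x y / r := by positivity
  rw [sub_self, abs_zero] at h1 h2
  exact h1.trans (max_le h0 (h2.trans (max_le h0 h3)))

/-- The product vanishes at distance less than `r` from `J`, so the jump of `f` across `J` is not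
seen; elsewhere the product rule gives `L + B / r`. -/
theorem UniformlyLocLip.distCutoff_mul {Ω J : Set E3} (hΩ : IsOpen Ω) {f : E3 → ℝ} {L B r : ℝ} (hL : 0 ≤ L) (hB : ∀ x, |f x| ≤ B) (hr : 0 < r)
    (hf : UniformlyLocLip L (Ω \ J) f) :
    UniformlyLocLip (L + B / r) Ω (fun x => distCutoff J r x * f x) := by
  have hB0 : 0 ≤ B := (abs_nonneg _).trans (hB 0)
  intro x hx
  by_cases hxr : Metric.infDist x J < r
  · have hopen : IsOpen (Ω ∩ {x | Metric.infDist x J < r}) :=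
      hΩ.inter (isOpen_lt (Metric.continuous_infDist_pt J) continuous_const)
    obtain ⟨s, hs, hsub⟩ := Metric.isOpen_iff.1 hopen x ⟨hx, hxr⟩
    refine ⟨s, hs, fun y hy => (hsub hy).1, fun y hy z hz => ?_⟩
    simp only
    rw [distCutoff_eq_zero hr (le_of_lt (hsub hy).2), distCutoff_eq_zero hr (le_of_lt (hsub hz).2)]
    simp only [zero_mul, sub_self, abs_zero]
    positivity
  · have hxJ : x ∉ J := fun h => hxr (by rw [Metric.infDist_zero_of_mem h]; exact hr)
    obtain ⟨s, hs, hsub, hlip⟩ := hf x ⟨hx, hxJ⟩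
    refine ⟨s, hs, fun y hy => (hsub hy).1, fun y hy z hz => ?_⟩
    have e : distCutoff J r y * f y - distCutoff J r z * f z =
        distCutoff J r y * (f y - f z) + (distCutoff J r y - distCutoff J r z) * f z := by ring
    rw [e]
    refine (abs_add_le _ _).trans ?_
    rw [abs_mul, abs_mul, abs_of_nonneg (distCutoff_mem J r y).1]
    have h1 : distCutoff J r y * |f y - f z| ≤ 1 * (L * dist y z) :=
      mul_le_mul (distCutoff_mem J r y).2 (hlip y hy z hz) (abs_nonneg _) zero_le_one
    have h2 : |distCutoff J r y - distCutoff J r z| * |f z| ≤ dist y z / r * B :=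
      mul_le_mul (abs_distCutoff_sub_le J hr y z) (hB z) (abs_nonneg _) (by positivity)
    calc _ ≤ 1 * (L * dist y z) + dist y z / r * B := add_le_add h1 h2
      _ = _ := by ring

theorem DiffeoBounds.uniformlyLocLip_comp {F G : E3 → E3} {Ω : Set E3} {L : ℝ}
    (hD : DiffeoBounds F G Ω L) {O : Set E3} {f : E3 → ℝ} {L₁ : ℝ} (hL₁ : 0 ≤ L₁)
    (hf : UniformlyLocLip L₁ O f) :
    UniformlyLocLip (L₁ * L) (patch ∩ F ⁻¹' O) (fun y => f (F y)) := by
  rintro y ⟨hy, hyO⟩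
  obtain ⟨r, hr, hsub, hlip⟩ := hf (F y) hyO
  obtain ⟨s, hs, hs'⟩ := Metric.isOpen_iff.1 TensorMesh.isOpen_patch y hy
  have hL := hD.pos
  have hmap : ∀ z ∈ Metric.ball y (min s (r / L)), z ∈ patch ∧ F z ∈ Metric.ball (F y) r := by
    intro z hz
    have hzp : z ∈ patch := hs' (Metric.ball_subset_ball (min_le_left _ _) hz)
    refine ⟨hzp, Metric.mem_ball.2 ?_⟩
    have : dist z y < r / L := (Metric.mem_ball.1 hz).trans_le (min_le_right _ _)
    rw [lt_div_iff₀ hL, mul_comm] at this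
    exact (hD.dist_le hzp hy).trans_lt this
  refine ⟨min s (r / L), lt_min hs (by positivity), fun z hz => ⟨(hmap z hz).1, hsub (hmap z hz).2⟩,
    fun z hz z' hz' => ?_⟩
  calc |f (F z) - f (F z')| ≤ L₁ * dist (F z) (F z') := hlip _ (hmap z hz).2 _ (hmap z' hz').2
    _ ≤ L₁ * (L * dist z z') :=
      mul_le_mul_of_nonneg_left (hD.dist_le (hmap z hz).1 (hmap z' hz').1) hL₁
    _ = _ := by ring

namespace TensorMesh

/-- The Greville point moved away from the boundary of the patch. -/
noncomputable def innerGreville (M : TensorMesh) (H : ℝ) (j : Fin 3 → ℕ) : E3 :=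
  WithLp.toLp 2 fun a => max H (min (1 - H) (M.greville j a))

theorem innerGreville_mem_patch (M : TensorMesh) {H : ℝ} (hH : 0 < H) (hH2 : H < 1 / 2)
    (j : Fin 3 → ℕ) : M.innerGreville H j ∈ patch := by
  intro a
  refine ⟨hH.trans_le (le_max_left _ _), max_lt (by linarith) ((min_le_left _ _).trans_lt ?_)⟩
  linarith

theorem dist_innerGreville_le (M : TensorMesh) {H : ℝ} (hH : 0 < H)
    (j : Fin 3 → ℕ) : dist (M.innerGreville H j) (M.greville j) ≤ 2 * H := by
  refine dist_le_of_coord_le hH.le fun a => ?_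
  have h := M.greville_mem j a
  simp only [innerGreville]
  rw [abs_le]
  constructor
  · have : min (1 - H) (M.greville j a) ≤ max H (min (1 - H) (M.greville j a)) := le_max_right _ _
    have : M.greville j a - H ≤ min (1 - H) (M.greville j a) :=
      le_min (by linarith [h.2]) (by linarith)
    linarith
  · have : max H (min (1 - H) (M.greville j a)) ≤ M.greville j a + H :=
      max_le (by linarith [h.1]) ((min_le_right _ _).trans (by linarith))
    linarith

theorem innerGreville_eq (M : TensorMesh) {H : ℝ} {j : Fin 3 → ℕ}
    (h : ∀ a, H ≤ M.greville j a ∧ M.greville j a ≤ 1 - H) :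
    M.innerGreville H j = M.greville j := by
  ext a
  simp [innerGreville, (h a).1, (h a).2]

theorem quasi_affine {M : TensorMesh} {H : ℝ} {y : E3} {j : Fin 3 → ℕ}
    (h : M.IsNear H y j) (A : ℝ) (Λ : E3 →L[ℝ] ℝ) (z : E3) :
    M.quasi (quadPoly A Λ 0 z) j = A + Λ (M.greville j - z) := by
  have := abs_quasi_quadPoly_sub_le h A Λ 0 z (b := 0) (by simp)
  rw [mul_zero, abs_nonpos_iff, sub_eq_zero] at this
  rw [this]
  simp [quadPoly]

end TensorMesh

theorem DiffeoBounds.abs_weakPartial_pushforward_le {F G : E3 → E3} {Ω : Set E3} {L : ℝ}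
    (hD : DiffeoBounds F G Ω L) {x : E3} (hx : x ∈ Ω) {S : Fin 3 → ℝ} {Λ : E3 →L[ℝ] ℝ} {E : ℝ}
    (hS : ∀ a, |S a - Λ (EuclideanSpace.single a (1 : ℝ))| ≤ E) (i : Fin 3) :
    |∑ a, S a * fderiv ℝ G x (EuclideanSpace.single i (1 : ℝ)) a -
      Λ (fderiv ℝ G x (EuclideanSpace.single i (1 : ℝ)))| ≤ 3 * L * E := by
  have hg : ∀ a, |fderiv ℝ G x (EuclideanSpace.single i (1 : ℝ)) a| ≤ L := fun a => by
    have h1 := (fderiv ℝ G x).le_opNorm (EuclideanSpace.single i (1 : ℝ))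
    rw [PiLp.norm_single, norm_one, mul_one] at h1
    exact (PiLp.norm_apply_le (fderiv ℝ G x (EuclideanSpace.single i (1 : ℝ))) a).trans
      (h1.trans (hD.norm_fderiv_inv_le x hx))
  have := abs_sum_mul_add_le (S := S) (Λ := -Λ) (e := E) (L := L)
    (fun a => by simpa [← sub_eq_add_neg] using hS a) hg
  simpa [← sub_eq_add_neg] using this

/-- Splines approximating a bounded Lipschitz function on `Ω \ J`, with a gradient of order
`1 / ε` at distance of order `ε` from `J`, and bounded elsewhere. -/
theorem exists_displacement {F G : E3 → E3} {Ω : Set E3} {L : ℝ} (hD : DiffeoBounds F G Ω L)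
    {J : Set E3} (hJ : IsClosed J) (hne : J.Nonempty) {f : E3 → ℝ} {L₁ B : ℝ} (hL₁ : 0 ≤ L₁)
    (hB : ∀ x, |f x| ≤ B) (hf : UniformlyLocLip L₁ (Ω \ J) f) {ε H : ℕ → ℝ}
    (hε_pos : ∀ k, 0 < ε k) (hε : Tendsto ε atTop (𝓝 0)) {c : ℝ} (hc : 0 < c)
    (hH : ∀ k, 0 < H k) (hHε : H =o[atTop] ε) {M : ℕ → TensorMesh}
    (hM : ∀ k, (M k).IsQuasiUniform c (H k)) {l : ℝ} (hl : 0 < l) :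
    ∃ (uh : ℕ → E3 → ℝ) (C : ℝ), 0 ≤ C ∧ (∀ k, uh k ∈ splineV (M k) G) ∧
      (∀ k, ContinuousOn (uh k) Ω) ∧
      (∀ᶠ k in atTop, ∀ x ∈ Ω, |uh k x| ≤ C) ∧
      (∀ᶠ k in atTop, ∀ᵐ x ∂(volume.restrict Ω), ∀ i, |weakPartial Ω i (uh k) x| ≤ C / ε k) ∧
      (∀ᶠ k in atTop, ∀ᵐ x ∂(volume.restrict Ω), l * ε k < Metric.infDist x J →
        ∀ i, |weakPartial Ω i (uh k) x| ≤ C) ∧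
      (∀ x ∈ Ω \ J, DifferentiableAt ℝ f x → Tendsto (fun k => uh k x) atTop (𝓝 (f x))) ∧
      (∀ᵐ x ∂(volume.restrict Ω), x ∉ J → ∀ i, Tendsto (fun k => weakPartial Ω i (uh k) x) atTop
        (𝓝 (fderiv ℝ f x (EuclideanSpace.single i (1 : ℝ))))) := by
  have hL := hD.pos
  have hB0 : 0 ≤ B := (abs_nonneg _).trans (hB 0)
  -- The cutoff is inactive at distance `l ε / 2`, so points beyond `l ε` keep this margin after
  -- moving by `O(H)`.
  set r : ℕ → ℝ := fun k => l / 4 * ε k with hr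
  have hr0 : ∀ k, 0 < r k := fun k => by have := hε_pos k; positivity
  set φ : ℕ → E3 → ℝ := fun k x => distCutoff J (r k) x * f x with hφ
  -- Values at Greville points reproduce affine functions, which is enough for first derivatives.
  -- The points are moved inward because nothing is known about `F` on the boundary of the patch.
  set d : ℕ → (Fin 3 → ℕ) → ℝ := fun k j => φ k (F ((M k).innerGreville (H k) j)) with hd
  set u : ℕ → E3 → ℝ := fun k x => (M k).splineJet (d k) 0 (G x) with hu
  have hφB : ∀ k x, |φ k x| ≤ B := fun k x => by
    rw [hφ, abs_mul, abs_of_nonneg (distCutoff_mem J (r k) x).1]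
    calc _ ≤ 1 * B := mul_le_mul (distCutoff_mem J (r k) x).2 (hB x) (abs_nonneg _) zero_le_one
      _ = B := one_mul B
  have hH0 : Tendsto H atTop (𝓝 0) := hHε.isBigO.trans_tendsto hε
  have hev : ∀ σ : ℝ, 0 < σ → ∀ᶠ k in atTop, H k ≤ σ * ε k := by
    intro σ hσ
    filter_upwards [isLittleO_iff.1 hHε hσ] with k h2
    rwa [Real.norm_eq_abs, Real.norm_eq_abs, abs_of_pos (hH k), abs_of_pos (hε_pos k)] at h2
  have hhalf : ∀ᶠ k in atTop, H k < 1 / 2 := hH0.eventually (gt_mem_nhds (by norm_num))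
  have hwp : ∀ᵐ x ∂(volume.restrict Ω), ∀ k i, weakPartial Ω i (u k) x =
      ∑ a, (M k).splineJet (d k) (Pi.single a 1) (G x) *
        fderiv ℝ G x (EuclideanSpace.single i (1 : ℝ)) a := by
    rw [ae_all_iff]
    intro k
    rw [ae_all_iff]
    exact fun i => hD.weakPartial_pushforward (M k) (d k) i (ae_eq_refl _)
  have hdist : ∀ k, H k < 1 / 2 → ∀ y j, (M k).IsNear (H k) y j →
      dist ((M k).innerGreville (H k) j) y ≤ 6 * H k := by
    intro k hk y j hj
    have h1 := (M k).dist_innerGreville_le (hH k) j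
    have h2 := (hj.dist_greville_le (hH k)).1
    linarith [dist_triangle ((M k).innerGreville (H k) j) ((M k).greville j) y]
  -- Comparison with a constant: coefficients that vary by `N` per unit length give a gradient of
  -- order `N`, the `1 / H` of the inverse estimate being compensated; `1944 = 3 · 27 · 6 · 4`.
  have hgrad : ∀ k, ∀ x ∈ Ω, ∀ N, (∀ j, (M k).IsNear (H k) (G x) j →
      |d k j - φ k x| ≤ N * (6 * H k)) → ∀ i,
      |∑ a, (M k).splineJet (d k) (Pi.single a 1) (G x) *
        fderiv ℝ G x (EuclideanSpace.single i (1 : ℝ)) a| ≤ 1944 * L / c * N := by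
    intro k x hx N hN i
    obtain ⟨-, h1, -⟩ := (M k).splineJet_close (E := N * (6 * H k)) hc (hH k) (hM k)
      (hD.mapsTo_inv hx) (φ k x) 0 0 fun j hj => by
        rw [TensorMesh.quasi_affine hj]
        simpa using hN j hj
    have h2 := hD.abs_weakPartial_pushforward_le hx h1 i
    rw [zero_apply, sub_zero] at h2
    refine h2.trans (le_of_eq ?_)
    have := (hH k).ne'
    field_simp
    ring
  -- At a point of differentiability the coefficients are `o(H)` close to those of the affine Taylor
  -- polynomial, so values and gradients converge. For fixed `x`, the cutoff and the inward shift
  -- are eventually inactive nearby.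
  have hasymp : ∀ x ∈ Ω \ J, DifferentiableAt ℝ f x → ∀ τ, 0 < τ → ∀ᶠ k in atTop,
      ∀ j, (M k).IsNear (H k) (G x) j → |d k j - (M k).quasi (TensorMesh.quadPoly (f x)
        ((fderiv ℝ f x).comp (fderiv ℝ F (G x))) 0 (G x)) j| ≤ τ * (4 * H k) := by
    rintro x ⟨hxΩ, hxJ⟩ hfx τ hτ
    have hz := hD.mapsTo_inv hxΩ
    have hxr := hD.right_inv x hxΩ
    have hder : HasFDerivAt (fun y => f (F y)) ((fderiv ℝ f x).comp (fderiv ℝ F (G x))) (G x) := by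
      refine HasFDerivAt.comp (G x) (g := f) ?_ (hD.differentiableAt _ hz).hasFDerivAt
      rw [hxr]
      exact hfx.hasFDerivAt
    obtain ⟨s, hs, hs'⟩ := Metric.eventually_nhds_iff.1 (isLittleO_iff.1 hder.isLittleO hτ)
    have hpos : 0 < Metric.infDist x J := (hJ.notMem_iff_infDist_pos hne).1 hxJ
    have hr1 : Tendsto (fun k => 2 * r k + 4 * L * H k) atTop (𝓝 0) := by
      have := ((hε.const_mul (l / 4)).const_mul 2).add (hH0.const_mul (4 * L))
      simpa using this
    have hbd : ∀ᶠ k in atTop, ∀ a, 5 * H k ≤ G x a ∧ 5 * H k ≤ 1 - G x a := by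
      rw [eventually_all]
      intro a
      have h5 : Tendsto (fun k => 5 * H k) atTop (𝓝 0) := by simpa using hH0.const_mul 5
      exact (h5.eventually (ge_mem_nhds (hz a).1)).and
        (h5.eventually (ge_mem_nhds (sub_pos.2 (hz a).2)))
    have h4 : Tendsto (fun k => 4 * H k) atTop (𝓝 0) := by simpa using hH0.const_mul 4
    filter_upwards [h4.eventually (gt_mem_nhds hs), hbd,
      hr1.eventually (ge_mem_nhds hpos)] with k hk1 hk2 hk3 j hj
    obtain ⟨hg, -⟩ := hj.dist_greville_le (hH k)
    set y := (M k).greville j with hy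
    have hyc : ∀ a, |y a - G x a| ≤ 4 * H k := fun a => by
      have h1 := PiLp.norm_apply_le (y - G x) a
      rw [← dist_eq_norm] at h1
      exact h1.trans hg
    have hyb : ∀ a, H k ≤ y a ∧ y a ≤ 1 - H k := fun a => by
      have h1 := abs_le.1 (hyc a)
      have h2 := hk2 a
      constructor <;> linarith
    have hyp : y ∈ patch := fun a =>
      ⟨(hH k).trans_le (hyb a).1, (hyb a).2.trans_lt (by linarith [hH k])⟩
    have hone : distCutoff J (r k) (F y) = 1 := by
      refine distCutoff_eq_one (hr0 k) ?_
      have h1 : dist x (F y) ≤ 4 * L * H k := by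
        rw [dist_comm]
        nth_rewrite 1 [← hxr]
        calc _ ≤ L * dist y (G x) := hD.dist_le hyp hz
          _ ≤ L * (4 * H k) := by gcongr
          _ = _ := by ring
      have h2 := Metric.infDist_le_infDist_add_dist (s := J) (x := x) (y := F y)
      linarith
    rw [TensorMesh.quasi_affine hj, hd]
    simp only
    rw [TensorMesh.innerGreville_eq _ hyb, hφ]
    simp only
    rw [← hy, hone, one_mul]
    have h1 := hs' (hg.trans_lt hk1)
    rw [hxr, Real.norm_eq_abs, ← dist_eq_norm, sub_sub] at h1
    exact h1.trans (mul_le_mul_of_nonneg_left hg hτ.le)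
  -- The product with the cutoff has Lipschitz constant `L₁ + B / r`, where `B / r = 4 B / (l ε)`.
  set N₀ := (L₁ + 4 * B / l) * L with hN₀
  set C := 27 * B + B + 1944 * L / c * N₀ + 1944 * L / c * (L₁ * L) with hC
  have hN₀0 : 0 ≤ N₀ := by positivity
  have c1 : 0 ≤ 1944 * L / c * N₀ := by positivity
  have c2 : 0 ≤ 1944 * L / c * (L₁ * L) := by positivity
  refine ⟨u, C, by positivity, fun k => TensorMesh.splineJet_zero_mem_splineV _ _,
    fun k x hx => (hD.hasFDerivAt_pushforward (M k) (d k) hx).continuousAt.continuousWithinAt,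
    Eventually.of_forall fun k x hx => ?_, ?_, ?_, fun x hx hfx => ?_, ?_⟩
  · obtain ⟨h0, -, -⟩ := (M k).splineJet_close (E := B) hc (hH k) (hM k)
      (hD.mapsTo_inv hx) 0 0 0 (d := d k) fun j hj => by
        rw [TensorMesh.quasi_affine hj]
        simpa using hφB k _
    rw [sub_zero] at h0
    refine h0.trans ?_
    rw [hC]
    linarith
  · filter_upwards [hhalf, hε.eventually (ge_mem_nhds one_pos)] with k hk hε1
    filter_upwards [hwp, ae_restrict_mem hD.isOpen.measurableSet] with x hx hxΩ i
    have hlip : UniformlyLocLip ((L₁ + B / r k) * L) (patch ∩ F ⁻¹' Ω) (fun y => φ k (F y)) :=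
      hD.uniformlyLocLip_comp (by have := hr0 k; positivity)
        (hf.distCutoff_mul hD.isOpen hL₁ hB (hr0 k))
    rw [hx]
    have hεk := hε_pos k
    have hle : (L₁ + B / r k) * L ≤ N₀ / ε k := by
      have e : (L₁ + B / r k) * L = L₁ * L + 4 * B / l * L / ε k := by
        rw [hr]
        field_simp
      have e' : N₀ / ε k = L₁ * L / ε k + 4 * B / l * L / ε k := by
        rw [hN₀]
        ring
      have : L₁ * L ≤ L₁ * L / ε k := by
        rw [le_div_iff₀ hεk]
        exact mul_le_of_le_one_right (by positivity) hε1
      rw [e, e']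
      linarith
    have := hgrad k x hxΩ (N₀ / ε k) (fun j hj => ?_) i
    · refine this.trans ?_
      rw [← mul_div_assoc]
      refine div_le_div_of_nonneg_right ?_ hεk.le
      rw [hC]
      linarith
    · have hm := (M k).innerGreville_mem_patch (hH k) hk j
      have hz := hD.mapsTo_inv hxΩ
      have h1 := hlip.le_of_segment_subset (x := (M k).innerGreville (H k) j) (y := G x)
        fun y hy => by
          have hy' := convex_patch.segment_subset hm hz hy
          exact ⟨hy', hD.mapsTo hy'⟩
      rw [hD.right_inv x hxΩ] at h1
      refine h1.trans ?_
      exact mul_le_mul hle (hdist k hk _ _ hj) dist_nonneg (by positivity)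
  · filter_upwards [hhalf, hev (l / (16 * L)) (by positivity)] with k hk hHk
    filter_upwards [hwp, ae_restrict_mem hD.isOpen.measurableSet] with x hx hxΩ hxl i
    have hεk := hε_pos k
    have hHk' : 8 * L * H k ≤ l / 2 * ε k := by
      calc 8 * L * H k ≤ 8 * L * (l / (16 * L) * ε k) := by gcongr
        _ = _ := by field_simp; norm_num
    rw [hx]
    have hz := hD.mapsTo_inv hxΩ
    have hfar : ∀ y ∈ patch, dist y (G x) ≤ 6 * H k →
        y ∈ patch ∩ F ⁻¹' (Ω \ J) ∧ φ k (F y) = f (F y) := by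
      intro y hy hyx
      have h1 : dist x (F y) ≤ 6 * L * H k := by
        rw [dist_comm]
        nth_rewrite 1 [← hD.right_inv x hxΩ]
        calc _ ≤ L * dist y (G x) := hD.dist_le hy hz
          _ ≤ L * (6 * H k) := by gcongr
          _ = _ := by ring
      have h2 := Metric.infDist_le_infDist_add_dist (s := J) (x := x) (y := F y)
      have h3 : 2 * r k ≤ Metric.infDist (F y) J := by
        have : 0 < L * H k := mul_pos hL (hH k)
        rw [hr]
        simp only
        linarith
      refine ⟨⟨hy, hD.mapsTo hy, fun hmem => ?_⟩, ?_⟩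
      · rw [Metric.infDist_zero_of_mem hmem] at h3
        linarith [hr0 k]
      · rw [hφ]
        simp only
        rw [distCutoff_eq_one (hr0 k) h3, one_mul]
    have hlip := hD.uniformlyLocLip_comp hL₁ hf
    refine (hgrad k x hxΩ (L₁ * L) (fun j hj => ?_) i).trans (by rw [hC]; linarith)
    have hm := (M k).innerGreville_mem_patch (hH k) hk j
    have hdm := hdist k hk _ _ hj
    -- The segment in the patch is mapped away from `J`, so the local bound for `f` itself applies
    -- and the cutoff does not enter.
    have h1 := hlip.le_of_segment_subset (x := (M k).innerGreville (H k) j) (y := G x)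
      fun y hy => by
        refine (hfar y (convex_patch.segment_subset hm hz hy) ?_).1
        have hconv := convex_closedBall (G x) (6 * H k)
        exact hconv.segment_subset hdm (Metric.mem_closedBall_self (by linarith [hH k])) hy
    have e1 := (hfar _ hm hdm).2
    have e2 := (hfar _ hz (by rw [dist_self]; linarith [hH k])).2
    rw [hD.right_inv x hxΩ] at h1 e2
    rw [hd]
    simp only
    rw [e1, e2]
    exact h1.trans (mul_le_mul_of_nonneg_left hdm (by positivity))
  · rw [Metric.tendsto_atTop']
    intro τ hτ
    have h4 : Tendsto (fun k => 108 * H k) atTop (𝓝 0) := by simpa using hH0.const_mul 108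
    obtain ⟨k₀, hk₀⟩ := eventually_atTop.1 ((hasymp x hx hfx 1 one_pos).and
      (h4.eventually (gt_mem_nhds hτ)))
    refine ⟨k₀, fun k hk => ?_⟩
    obtain ⟨h1, h2⟩ := hk₀ k hk.le
    obtain ⟨h0, -, -⟩ := (M k).splineJet_close hc (hH k) (hM k) (hD.mapsTo_inv hx.1) _ _ _ h1
    rw [Real.dist_eq]
    exact h0.trans_lt (by linarith)
  · filter_upwards [hwp, ae_restrict_mem hD.isOpen.measurableSet,
      (ae_restrict_iff' hD.isOpen.measurableSet).2 ((ae_restrict_iff'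
        (hD.isOpen.sdiff hJ).measurableSet).1 (hf.locallyLipschitzOn.ae_differentiableAt
        (hD.isOpen.sdiff hJ)) |>.mono fun x h hxΩ (hxJ : x ∉ J) => h ⟨hxΩ, hxJ⟩)]
      with x hx hxΩ hdiff hxJ i
    have hfx := hdiff hxJ
    rw [Metric.tendsto_atTop']
    intro τ hτ
    -- Tuned so that the inverse estimate, with its factor `3 · 27 · 4 · 4 · L / c`, returns `τ /
    -- 2`.
    set τ' := τ * c / (2592 * L) with hτ'
    have hτ'0 : 0 < τ' := by positivity
    obtain ⟨k₀, hk₀⟩ := eventually_atTop.1 (hasymp x ⟨hxΩ, hxJ⟩ hfx τ' hτ'0)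
    refine ⟨k₀, fun k hk => ?_⟩
    obtain ⟨-, h1, -⟩ := (M k).splineJet_close hc (hH k) (hM k) (hD.mapsTo_inv hxΩ) _ _ _
      (hk₀ k hk.le)
    have h2 := hD.abs_weakPartial_pushforward_le hxΩ h1 i
    rw [ContinuousLinearMap.comp_apply, hD.fderiv_comp_inv hxΩ] at h2
    rw [Real.dist_eq, hx]
    refine h2.trans_lt ?_
    have e : 3 * L * (27 * (τ' * (4 * H k) * (4 / (c * H k)))) = τ / 2 := by
      have := (hH k).ne'
      rw [hτ']
      field_simp
      norm_num
    rw [e]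
    exact half_lt_self hτ

/-! ### The elastic energy and the main result -/

theorem aestronglyMeasurable_weakPartial (O : Set E3) (i : Fin 3) (f : E3 → ℝ) :
    AEStronglyMeasurable (weakPartial O i f) (volume.restrict O) := by
  unfold weakPartial
  split_ifs with h
  · exact h.choose_spec.2.1.aestronglyMeasurable
  · exact aestronglyMeasurable_zero

theorem continuous_elasticDensity (Cel : Mat3 →ₗ[ℝ] Mat3) :
    Continuous fun B : Fin 3 → Fin 3 → ℝ => elasticDensity Cel (Matrix.of B) := by
  have hof : Continuous fun B : Fin 3 → Fin 3 → ℝ => (Matrix.of B : Mat3) := continuous_id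
  have hC : Continuous fun B : Fin 3 → Fin 3 → ℝ => Cel (Matrix.of B) :=
    (LinearMap.continuous_of_finiteDimensional Cel).comp hof
  unfold elasticDensity
  refine continuous_const.mul (continuous_finsetSum _ fun a _ => continuous_finsetSum _ fun b _ => ?_)
  exact (hof.matrix_elem a b).mul (hC.matrix_elem a b)

theorem aemeasurable_elasticDensity_strain (Cel : Mat3 →ₗ[ℝ] Mat3) (O : Set E3) (u : E3 → E3) :
    AEMeasurable (fun x => elasticDensity Cel (strain O u x)) (volume.restrict O) := by
  have h : AEMeasurable (fun x => fun a b =>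
      (weakPartial O b (fun y => u y a) x + weakPartial O a (fun y => u y b) x) / 2)
      (volume.restrict O) := by
    refine aemeasurable_pi_lambda _ fun a => aemeasurable_pi_lambda _ fun b => ?_
    exact ((aestronglyMeasurable_weakPartial O b _).aemeasurable.add
      (aestronglyMeasurable_weakPartial O a _).aemeasurable).div_const 2
  exact (continuous_elasticDensity Cel).measurable.comp_aemeasurable h

theorem isSymm_strain (O : Set E3) (u : E3 → E3) (x : E3) : (strain O u x).IsSymm := by
  ext a b
  simp [strain, Matrix.transpose_apply, add_comm]

theorem elasticDensity_strain_le {Cel : Mat3 →ₗ[ℝ] Mat3} {c₂ : ℝ} (hc₂ : 0 ≤ c₂)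
    (h : ∀ A : Mat3, A.IsSymm → elasticDensity Cel A ≤ c₂ * ∑ a : Fin 3, ∑ b : Fin 3, A a b ^ 2)
    {O : Set E3} {u : E3 → E3} {x : E3} {C : ℝ}
    (hu : ∀ a i, |weakPartial O i (fun y => u y a) x| ≤ C) :
    elasticDensity Cel (strain O u x) ≤ 9 * c₂ * C ^ 2 := by
  refine (h _ (isSymm_strain O u x)).trans ?_
  have : ∀ a b, strain O u x a b ^ 2 ≤ C ^ 2 := by
    intro a b
    rw [← sq_abs]
    refine pow_le_pow_left₀ (abs_nonneg _) ?_ 2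
    have h1 := abs_le.1 (hu a b)
    have h2 := abs_le.1 (hu b a)
    simp only [strain, Matrix.of_apply]
    rw [abs_le]
    constructor <;> linarith
  calc c₂ * ∑ a : Fin 3, ∑ b : Fin 3, strain O u x a b ^ 2
      ≤ c₂ * ∑ _a : Fin 3, ∑ _b : Fin 3, C ^ 2 := by
        exact mul_le_mul_of_nonneg_left
          (Finset.sum_le_sum fun a _ => Finset.sum_le_sum fun b _ => this a b) hc₂
    _ = _ := by
      simp
      ring

theorem tendsto_eLpNorm_two {α : Type*} [MeasurableSpace α] {μ : Measure α} {g : ℕ → α → ℝ}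
    (h : Tendsto (fun k => ∫⁻ x, ENNReal.ofReal (g k x ^ 2) ∂μ) atTop (𝓝 0)) :
    Tendsto (fun k => eLpNorm (g k) 2 μ) atTop (𝓝 0) := by
  have e : ∀ k, eLpNorm (g k) 2 μ = (∫⁻ x, ENNReal.ofReal (g k x ^ 2) ∂μ) ^ (1 / 2 : ℝ) := by
    intro k
    rw [eLpNorm_eq_lintegral_rpow_enorm_toReal (by norm_num) (by norm_num)]
    simp only [ENNReal.toReal_ofNat]
    congr 1
    refine lintegral_congr fun x => ?_
    rw [Real.enorm_eq_ofReal_abs, ENNReal.ofReal_rpow_of_nonneg (abs_nonneg _) (by norm_num)]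
    norm_num
  simp only [e]
  have h2 := (ENNReal.continuous_rpow_const (y := 1 / 2)).continuousAt.tendsto.comp h
  simpa [Function.comp_def] using h2

theorem tendsto_lintegral_of_eventually_le_const {α : Type*} [MeasurableSpace α] {μ : Measure α}
    [IsFiniteMeasure μ] {g : ℕ → α → ℝ≥0∞} {f : α → ℝ≥0∞} (hm : ∀ k, AEMeasurable (g k) μ) {C : ℝ}
    (hb : ∀ᶠ k in atTop, ∀ᵐ x ∂μ, g k x ≤ ENNReal.ofReal C)
    (hlim : ∀ᵐ x ∂μ, Tendsto (fun k => g k x) atTop (𝓝 (f x))) :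
    Tendsto (fun k => ∫⁻ x, g k x ∂μ) atTop (𝓝 (∫⁻ x, f x ∂μ)) := by
  obtain ⟨k₀, hk₀⟩ := eventually_atTop.1 hb
  refine (tendsto_add_atTop_iff_nat k₀).1 ?_
  refine tendsto_lintegral_of_dominated_convergence' (fun _ => ENNReal.ofReal C)
    (fun k => hm _) (fun k => hk₀ _ (Nat.le_add_left _ _)) ?_ ?_
  · rw [lintegral_const]
    exact ENNReal.mul_ne_top ENNReal.ofReal_ne_top (measure_ne_top _ _)
  · filter_upwards [hlim] with x hx
    exact hx.comp (tendsto_add_atTop_nat k₀)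

theorem tendsto_eLpNorm_two_of_bounded {α : Type*} [MeasurableSpace α] {μ : Measure α}
    [IsFiniteMeasure μ] {g : ℕ → α → ℝ} (hm : ∀ k, AEStronglyMeasurable (g k) μ) {C : ℝ}
    (hb : ∀ᶠ k in atTop, ∀ᵐ x ∂μ, |g k x| ≤ C)
    (hlim : ∀ᵐ x ∂μ, Tendsto (fun k => g k x) atTop (𝓝 0)) :
    Tendsto (fun k => eLpNorm (g k) 2 μ) atTop (𝓝 0) := by
  refine tendsto_eLpNorm_two ?_
  have h := tendsto_lintegral_of_eventually_le_const (μ := μ)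
    (g := fun k x => ENNReal.ofReal (g k x ^ 2)) (f := fun _ => 0) (C := C ^ 2)
    (fun k => ((hm k).aemeasurable.pow_const 2).ennreal_ofReal) (by
      filter_upwards [hb] with k hk
      filter_upwards [hk] with x hx
      refine ENNReal.ofReal_le_ofReal ?_
      rw [← sq_abs]
      exact pow_le_pow_left₀ (abs_nonneg _) hx 2) (by
      filter_upwards [hlim] with x hx
      have := ENNReal.tendsto_ofReal (hx.pow 2)
      simpa using this)
  simpa using h

/-! ### Assembly of the recovery sequence -/

theorem proposition6p1
    (Ω : Set E3) (hΩ_open : IsOpen Ω) (hΩ_bdd : Bornology.IsBounded Ω) (hΩ_conn : IsConnected Ω)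
    (F G : E3 → E3) (hF : IsW2InfDiffeo F G Ω)
    (Cel : Mat3 →ₗ[ℝ] Mat3) (hC : IsCoerciveContinuous Cel)
    (ε η h : ℕ → ℝ)
    (hε_pos : ∀ n, 0 < ε n) (hε : Tendsto ε atTop (𝓝 0))
    (hη_nonneg : ∀ n, 0 ≤ η n) (hη : η =o[atTop] ε) (hh : h =o[atTop] ε)
    (M : ℕ → TensorMesh) (hM_reg : UniformlyShapeRegular M)
    (hM_size : ∀ n, ∀ k : Fin 3 → ℕ, (M n).IsElement k → (M n).elementDiam k ≤ h n)
    (J : Affine.Simplex ℝ E3 2) (hJ : J.closedInterior ⊆ Ω)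
    (u : E3 → E3) (hu : MemWkInfVec (Ω \ J.closedInterior) 2 u) :
    ∃ C : ℝ, 0 < C ∧ ∀ δ : ℝ, 0 < δ →
      ∃ (uh : ℕ → E3 → E3) (vh : ℕ → E3 → ℝ),
        (∀ n, uh n ∈ splineU (M n) G) ∧
        (∀ n, vh n ∈ splineV (M n) G) ∧
        (∀ n, ∀ x ∈ Ω, 0 ≤ vh n x ∧ vh n x ≤ 1) ∧
        Tendsto (fun n => eLpNorm (fun x => uh n x - u x) 2 (volume.restrict Ω)) atTop (𝓝 0) ∧
        Tendsto (fun n => eLpNorm (fun x => vh n x - 1) 2 (volume.restrict Ω)) atTop (𝓝 0) ∧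
        limsup (fun n => discreteEnergy Cel Ω G (M n) (ε n) (η n) (uh n) (vh n)) atTop ≤
          ENNReal.ofReal (1 + δ) *
              (∫⁻ x in Ω \ J.closedInterior,
                ENNReal.ofReal (elasticDensity Cel (strain (Ω \ J.closedInterior) u x))) +
            4 * MeasureTheory.Measure.euclideanHausdorffMeasure 2 J.closedInterior +
            ENNReal.ofReal (C * δ) := by
  -- `C = 1` suffices: `δ / 2` is spent on the elastic energy near the triangle and `δ / 2` on the
  -- phase field, while `1 + δ` is only used to be at least 1.
  refine ⟨1, one_pos, fun δ hδ => ?_⟩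
  set K := J.closedInterior with hK
  have hKc : IsCompact K := J.isCompact_closedInterior
  have hKne : K.Nonempty := J.nonempty_closedInterior
  obtain ⟨n, hn, hnK⟩ := exists_unit_normal J
  obtain ⟨L, hD⟩ := hF.exists_bounds hΩ_open
  obtain ⟨c, hc, C₀, hC₀, H, hH⟩ := hM_reg.exists_isQuasiUniform hM_size
  have hH0 : ∀ k, 0 < H k := fun k => (hH k).1
  have hHM : ∀ k, (M k).IsQuasiUniform c (H k) := fun k => (hH k).2.1
  have hHε : H =o[atTop] ε := by
    refine IsBigO.trans_isLittleO (IsBigO.of_bound C₀ (Eventually.of_forall fun k => ?_)) hh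
    rw [Real.norm_eq_abs, Real.norm_eq_abs, abs_of_pos (hH0 k)]
    exact (hH k).2.2.trans (mul_le_mul_of_nonneg_left (le_abs_self _) hC₀.le)
  have hO : IsOpen (Ω \ K) := hΩ_open.sdiff hKc.isClosed
  obtain ⟨ρ, V, hρ, hV, hvol⟩ := volume_cthickening_le hKc hKne hn hnK
  have hK0 : volume K = 0 := by
    have h1 : ∀ r, 0 ≤ r → r ≤ ρ → volume K ≤ ENNReal.ofReal (V * r) := fun r hr hrρ =>
      (measure_mono fun x hx => (by
        show Metric.infDist x K ≤ r
        rwa [Metric.infDist_zero_of_mem hx])).trans (hvol r hr hrρ)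
    have := h1 0 le_rfl hρ.le
    simpa using this
  have hres : volume.restrict (Ω \ K) = volume.restrict Ω :=
    Measure.restrict_congr_set (sdiff_null_ae_eq_self hK0)
  have hfinΩ : IsFiniteMeasure (volume.restrict Ω) :=
    ⟨by rw [Measure.restrict_apply_univ]; exact hΩ_bdd.measure_lt_top⟩
  have hae : ∀ᵐ x ∂(volume.restrict Ω), x ∈ Ω \ K := by
    rw [← hres]
    exact ae_restrict_mem hO.measurableSet
  obtain ⟨vh, l, hl, hv1, hv2, hv3, hv4⟩ := exists_phaseFields hD hKc hKne hJ hn hnK hε_pos hε hc hH0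
    hHε hHM (half_pos hδ)
  -- The components of `u` are replaced by bounded, locally Lipschitz representatives off the
  -- triangle, across which they may jump.
  choose Lu Bu f hLu hBu huf hfB hfL using fun a => (hu a).exists_uniformlyLocLip hO
  choose U CU hCU hU1 hU2 hU3 hU4 hU5 hU6 hU7 using fun a =>
    exists_displacement hD hKc.isClosed hKne (hLu a) (hfB a) (hfL a) hε_pos hε hc hH0 hHε hHM hl
  set C := ∑ a, CU a with hCdef
  have hC0 : 0 ≤ C := Finset.sum_nonneg fun a _ => hCU a
  have hCle : ∀ a, CU a ≤ C := fun a => Finset.single_le_sum (fun b _ => hCU b) (Finset.mem_univ a)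
  set uh : ℕ → E3 → E3 := fun k x => WithLp.toLp 2 fun a => U a k x with huh
  have huhU : ∀ k, uh k ∈ splineU (M k) G := fun k a => hU1 a k
  have hcoord : ∀ k a, (fun x => uh k x a) = U a k := fun k a => rfl
  have hfd : ∀ᵐ x ∂(volume.restrict Ω), ∀ a, DifferentiableAt ℝ (f a) x := by
    rw [ae_all_iff, ← hres]
    exact fun a => (hfL a).locallyLipschitzOn.ae_differentiableAt hO
  have huf' : ∀ᵐ x ∂(volume.restrict Ω), ∀ a, u x a = f a x := by
    rw [ae_all_iff, ← hres]
    exact huf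
  have hUx : ∀ᵐ x ∂(volume.restrict Ω), ∀ a, Tendsto (fun k => U a k x) atTop (𝓝 (u x a)) := by
    filter_upwards [hfd, huf', hae] with x h1 h2 h3 a
    rw [h2 a]
    exact hU6 a x h3 (h1 a)
  set S : E3 → Fin 3 → Fin 3 → ℝ := fun x a b =>
    (fderiv ℝ (f a) x (EuclideanSpace.single b (1 : ℝ)) +
      fderiv ℝ (f b) x (EuclideanSpace.single a (1 : ℝ))) / 2 with hS
  have hSu : ∀ᵐ x ∂(volume.restrict Ω), strain (Ω \ K) u x = Matrix.of (S x) := by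
    have h1 : ∀ᵐ x ∂(volume.restrict Ω), ∀ a b, weakPartial (Ω \ K) b (fun y => u y a) x =
        fderiv ℝ (f a) x (EuclideanSpace.single b (1 : ℝ)) := by
      rw [ae_all_iff]
      intro a
      rw [ae_all_iff, ← hres]
      exact fun b => weakPartial_ae_eq hO
        (isWeakPartial_fderiv hO (hfL a).locallyLipschitzOn b) (huf a)
    filter_upwards [h1] with x hx
    ext a b
    simp [strain, hS, hx]
  have hSlim : ∀ᵐ x ∂(volume.restrict Ω), Tendsto
      (fun k => elasticDensity Cel (strain Ω (uh k) x)) atTop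
      (𝓝 (elasticDensity Cel (strain (Ω \ K) u x))) := by
    filter_upwards [ae_all_iff.2 hU7, hSu, hae] with x h1 h2 h3
    rw [h2]
    refine ((continuous_elasticDensity Cel).tendsto (S x)).comp (f := fun k a b =>
      (weakPartial Ω b (U a k) x + weakPartial Ω a (U b k) x) / 2) ?_
    rw [tendsto_pi_nhds]
    intro a
    rw [tendsto_pi_nhds]
    intro b
    exact ((h1 a h3.2 b).add (h1 b h3.2 a)).div_const 2
  obtain ⟨c₁, c₂, hc₁, hc₂, hCel⟩ := hC
  have hCel2 : ∀ A : Mat3, A.IsSymm →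
      elasticDensity Cel A ≤ c₂ * ∑ a : Fin 3, ∑ b : Fin 3, A a b ^ 2 := fun A hA => (hCel A hA).2
  have hη0 : Tendsto η atTop (𝓝 0) := hη.isBigO.trans_tendsto hε
  -- The elastic energy beyond distance `l ε`, with `v²` bounded by 1. Gradients are bounded there,
  -- so dominated convergence applies.
  set Efar : ℕ → ℝ≥0∞ := fun k => ∫⁻ x in Ω, {x | l * ε k < Metric.infDist x K}.indicator
    (fun x => ENNReal.ofReal ((1 + η k) * elasticDensity Cel (strain Ω (uh k) x))) x with hEfar
  have hfarm : ∀ k, MeasurableSet {x : E3 | l * ε k < Metric.infDist x K} := fun k =>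
    (isOpen_lt continuous_const (Metric.continuous_infDist_pt K)).measurableSet
  have hfar : Tendsto Efar atTop (𝓝 (∫⁻ x in Ω \ K,
      ENNReal.ofReal (elasticDensity Cel (strain (Ω \ K) u x)))) := by
    rw [hres]
    refine tendsto_lintegral_of_eventually_le_const (C := 2 * (9 * c₂ * C ^ 2)) (fun k => ?_) ?_ ?_
    · exact (((aemeasurable_elasticDensity_strain Cel Ω (uh k)).const_mul _).ennreal_ofReal).indicator
        (hfarm k)
    · filter_upwards [hη0.eventually (ge_mem_nhds one_pos), eventually_all.2 hU5] with k h1 h2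
      filter_upwards [ae_all_iff.2 h2] with x hx
      by_cases hxl : x ∈ {x | l * ε k < Metric.infDist x K}
      · rw [indicator_of_mem hxl]
        refine ENNReal.ofReal_le_ofReal ?_
        have h3 := elasticDensity_strain_le (u := uh k) (O := Ω) (x := x) hc₂.le hCel2
          (fun a i => (hx a hxl i).trans (hCle a))
        have h4 : 0 ≤ 9 * c₂ * C ^ 2 := by positivity
        calc _ ≤ (1 + η k) * (9 * c₂ * C ^ 2) :=
              mul_le_mul_of_nonneg_left h3 (by linarith [hη_nonneg k])
          _ ≤ _ := mul_le_mul_of_nonneg_right (by linarith) h4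
      · rw [indicator_of_notMem hxl]
        exact zero_le
    · filter_upwards [hSlim, hae] with x h1 h2
      have hpos : 0 < Metric.infDist x K := (hKc.isClosed.notMem_iff_infDist_pos hKne).1 h2.2
      have hl0 : Tendsto (fun k => l * ε k) atTop (𝓝 0) := by simpa using hε.const_mul l
      have h3 : Tendsto (fun k => ENNReal.ofReal ((1 + η k) * elasticDensity Cel (strain Ω (uh k) x)))
          atTop (𝓝 (ENNReal.ofReal (elasticDensity Cel (strain (Ω \ K) u x)))) := by
        have := ENNReal.tendsto_ofReal ((hη0.const_add 1).mul h1)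
        simpa using this
      refine h3.congr' ?_
      filter_upwards [hl0.eventually (gt_mem_nhds hpos)] with k hk
      rw [indicator_of_mem]
      exact hk
  -- Within distance `l ε` the phase field vanishes and only `η` weights a density `O(ε⁻²)`, on a
  -- set of volume `O(ε)`.
  have hnear : ∀ᶠ k in atTop, ∫⁻ x in Ω, ENNReal.ofReal ((vh k x ^ 2 + η k) *
      elasticDensity Cel (strain Ω (uh k) x)) ≤ ENNReal.ofReal (δ / 2) + Efar k := by
    -- The `+ 1` keeps the denominator positive when the constant is zero.
    have hsmall : ∀ᶠ k in atTop, η k ≤ δ / 2 / (9 * c₂ * C ^ 2 * (V * l) + 1) * ε k := by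
      filter_upwards [isLittleO_iff.1 hη (c := δ / 2 / (9 * c₂ * C ^ 2 * (V * l) + 1))
        (by positivity)] with k hk
      rwa [Real.norm_eq_abs, Real.norm_eq_abs, abs_of_nonneg (hη_nonneg k),
        abs_of_pos (hε_pos k)] at hk
    have hlρ : ∀ᶠ k in atTop, l * ε k ≤ ρ := by
      have hl0 : Tendsto (fun k => l * ε k) atTop (𝓝 0) := by simpa using hε.const_mul l
      exact hl0.eventually (ge_mem_nhds hρ)
    filter_upwards [hsmall, hlρ, hv3, eventually_all.2 hU4] with k h1 h2 h3 h4
    have hεk := hε_pos k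
    have hηk := hη_nonneg k
    set A : Set E3 := {x | Metric.infDist x K ≤ l * ε k} with hA
    have hAm : MeasurableSet A :=
      (isClosed_le (Metric.continuous_infDist_pt K) continuous_const).measurableSet
    set b := η k * (9 * c₂ * (C / ε k) ^ 2) with hb
    have hb0 : 0 ≤ b := by positivity
    calc _ ≤ ∫⁻ x in Ω, (A.indicator (fun _ => ENNReal.ofReal b) x +
          {x | l * ε k < Metric.infDist x K}.indicator
            (fun x => ENNReal.ofReal ((1 + η k) * elasticDensity Cel (strain Ω (uh k) x))) x) := by
          refine lintegral_mono_ae ?_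
          filter_upwards [ae_all_iff.2 h4, ae_restrict_mem hΩ_open.measurableSet] with x hx hxΩ
          have hW : 0 ≤ elasticDensity Cel (strain Ω (uh k) x) :=
            le_trans (by positivity) (hCel _ (isSymm_strain Ω (uh k) x)).1
          by_cases hxA : x ∈ A
          · rw [indicator_of_mem hxA, h3 x hxΩ hxA]
            refine le_trans (ENNReal.ofReal_le_ofReal ?_) le_self_add
            have h5 := elasticDensity_strain_le (u := uh k) (O := Ω) (x := x) hc₂.le hCel2
              (fun a i => (hx a i).trans (div_le_div_of_nonneg_right (hCle a) hεk.le))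
            rw [hb]
            calc _ = η k * elasticDensity Cel (strain Ω (uh k) x) := by ring
              _ ≤ _ := mul_le_mul_of_nonneg_left h5 hηk
          · have hxl : x ∈ {x | l * ε k < Metric.infDist x K} :=
              show l * ε k < Metric.infDist x K from not_le.1 hxA
            rw [indicator_of_mem hxl]
            refine le_trans (ENNReal.ofReal_le_ofReal ?_) le_add_self
            have h5 := hv2 k x hxΩ
            have : vh k x ^ 2 ≤ 1 := pow_le_one₀ h5.1 h5.2
            exact mul_le_mul_of_nonneg_right (by linarith) hW
      _ = (∫⁻ x in Ω, A.indicator (fun _ => ENNReal.ofReal b) x) + Efar k := by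
          rw [lintegral_add_left (measurable_const.indicator hAm)]
      _ ≤ _ := by
          refine add_le_add_left ?_ _
          calc _ ≤ ∫⁻ x, A.indicator (fun _ => ENNReal.ofReal b) x :=
                lintegral_mono' Measure.restrict_le_self le_rfl
            _ = ENNReal.ofReal b * volume A := lintegral_indicator_const hAm _
            _ ≤ ENNReal.ofReal b * ENNReal.ofReal (V * (l * ε k)) := by
                gcongr
                exact hvol _ (by positivity) h2
            _ ≤ _ := by
                rw [← ENNReal.ofReal_mul hb0]
                refine ENNReal.ofReal_le_ofReal ?_
                set D := 9 * c₂ * C ^ 2 * (V * l) with hDdef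
                have hD0 : 0 ≤ D := by positivity
                have e : b * (V * (l * ε k)) = D * (η k / ε k) := by
                  rw [hb, hDdef]
                  field_simp
                rw [e]
                have h6 : η k / ε k ≤ δ / 2 / (D + 1) := (div_le_iff₀ hεk).2 h1
                calc D * (η k / ε k) ≤ D * (δ / 2 / (D + 1)) := mul_le_mul_of_nonneg_left h6 hD0
                  _ = D / (D + 1) * (δ / 2) := by ring
                  _ ≤ 1 * (δ / 2) := by
                    refine mul_le_mul_of_nonneg_right ?_ (by positivity)
                    rw [div_le_one (by positivity)]
                    linarith
                  _ = _ := one_mul _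
  have hdisc : ∀ k, discreteEnergy Cel Ω G (M k) (ε k) (η k) (uh k) (vh k) =
      (∫⁻ x in Ω, ENNReal.ofReal ((vh k x ^ 2 + η k) * elasticDensity Cel (strain Ω (uh k) x))) +
      ∫⁻ x in Ω, ENNReal.ofReal ((ε k)⁻¹ * (vh k x - 1) ^ 2 +
        2 * ε k * ∑ i : Fin 3, weakPartial Ω i (vh k) x ^ 2 +
          ε k ^ 3 * weakLaplacian Ω (vh k) x ^ 2) := by
    intro k
    rw [discreteEnergy, if_pos]
    refine ⟨⟨uh k, huhU k, ae_eq_refl _⟩, ⟨vh k, hv1 k, ae_eq_refl _⟩, ?_⟩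
    filter_upwards [ae_restrict_mem hΩ_open.measurableSet] with x hx
    exact hv2 k x hx
  have hmfin : Measure.euclideanHausdorffMeasure 2 K < ⊤ :=
    (hausdorff_lt_top_and_lintegral_cthickening_le hKc hn hnK).1
  refine ⟨uh, vh, huhU, hv1, hv2, ?_, ?_, ?_⟩
  · have hg : Tendsto (fun k => eLpNorm (fun x => |U 0 k x - u x 0| + |U 1 k x - u x 1| +
        |U 2 k x - u x 2|) 2 (volume.restrict Ω)) atTop (𝓝 0) := by
      have hum : ∀ a, AEStronglyMeasurable (fun x => u x a) (volume.restrict Ω) := fun a => by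
        rw [← hres]
        exact (hu a).memLp.aestronglyMeasurable
      have hUm : ∀ a k, AEStronglyMeasurable (fun x => |U a k x - u x a|) (volume.restrict Ω) :=
        fun a k => (((hU2 a k).aestronglyMeasurable hΩ_open.measurableSet).sub (hum a)).norm
      refine tendsto_eLpNorm_two_of_bounded (C := (C + Bu 0) + (C + Bu 1) + (C + Bu 2))
        (fun k => ((hUm 0 k).add (hUm 1 k)).add (hUm 2 k)) ?_ ?_
      · filter_upwards [eventually_all.2 hU3] with k hk
        filter_upwards [huf', ae_restrict_mem hΩ_open.measurableSet] with x hx hxΩ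
        have hb : ∀ a, |U a k x - u x a| ≤ C + Bu a := fun a => by
          refine (abs_sub _ _).trans (add_le_add ((hk a x hxΩ).trans (hCle a)) ?_)
          rw [hx a]
          exact hfB a x
        rw [abs_of_nonneg (by positivity)]
        exact add_le_add (add_le_add (hb 0) (hb 1)) (hb 2)
      · filter_upwards [hUx] with x hx
        have hb : ∀ a, Tendsto (fun k => |U a k x - u x a|) atTop (𝓝 0) := fun a => by
          have := ((hx a).sub_const (u x a)).abs
          simpa using this
        simpa using ((hb 0).add (hb 1)).add (hb 2)
    refine tendsto_of_tendsto_of_tendsto_of_le_of_le tendsto_const_nhds hg (fun k => zero_le)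
      fun k => ?_
    exact eLpNorm_mono_real fun x => norm_le_sum_abs (uh k x - u x)
  -- The squared `L²` distance to 1 is at most `ε` times the phase field energy, which is eventually
  -- bounded.
  · refine tendsto_eLpNorm_two ?_
    have hfin : 4 * Measure.euclideanHausdorffMeasure 2 K + ENNReal.ofReal (δ / 2) ≠ ⊤ :=
      ENNReal.add_ne_top.2 ⟨ENNReal.mul_ne_top (by norm_num) hmfin.ne, ENNReal.ofReal_ne_top⟩
    have hlim : Tendsto (fun k => ENNReal.ofReal (ε k) *
        (4 * Measure.euclideanHausdorffMeasure 2 K + ENNReal.ofReal (δ / 2))) atTop (𝓝 0) := by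
      have := ENNReal.Tendsto.mul_const (ENNReal.tendsto_ofReal hε) (Or.inr hfin)
      simpa using this
    refine tendsto_of_tendsto_of_tendsto_of_le_of_le' tendsto_const_nhds hlim
      (Eventually.of_forall fun k => zero_le) ?_
    filter_upwards [hv4] with k hk
    have hεk := hε_pos k
    refine le_trans ?_ (mul_le_mul_right hk _)
    rw [← lintegral_const_mul' _ _ ENNReal.ofReal_ne_top]
    refine lintegral_mono fun x => ?_
    rw [← ENNReal.ofReal_mul hεk.le]
    refine ENNReal.ofReal_le_ofReal ?_
    have e : (vh k x - 1) ^ 2 = ε k * ((ε k)⁻¹ * (vh k x - 1) ^ 2) := by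
      field_simp
    conv_lhs => rw [e]
    refine mul_le_mul_of_nonneg_left ?_ hεk.le
    have h1 : 0 ≤ 2 * ε k * ∑ i : Fin 3, weakPartial Ω i (vh k) x ^ 2 := by positivity
    have h2 : 0 ≤ ε k ^ 3 * weakLaplacian Ω (vh k) x ^ 2 := by positivity
    linarith
  · set E := ∫⁻ x in Ω \ K, ENNReal.ofReal (elasticDensity Cel (strain (Ω \ K) u x)) with hE
    set m := Measure.euclideanHausdorffMeasure 2 K with hm
    have hlim : Tendsto (fun k => (ENNReal.ofReal (δ / 2) + Efar k) +
        (4 * m + ENNReal.ofReal (δ / 2))) atTop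
        (𝓝 ((ENNReal.ofReal (δ / 2) + E) + (4 * m + ENNReal.ofReal (δ / 2)))) :=
      (tendsto_const_nhds.add hfar).add tendsto_const_nhds
    calc _ ≤ limsup (fun k => (ENNReal.ofReal (δ / 2) + Efar k) +
          (4 * m + ENNReal.ofReal (δ / 2))) atTop := by
          refine limsup_le_limsup ?_
          filter_upwards [hnear, hv4] with k h1 h2
          rw [hdisc]
          exact add_le_add h1 h2
      _ = (ENNReal.ofReal (δ / 2) + E) + (4 * m + ENNReal.ofReal (δ / 2)) := hlim.limsup_eq
      _ = E + 4 * m + (ENNReal.ofReal (δ / 2) + ENNReal.ofReal (δ / 2)) := by ring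
      _ = E + 4 * m + ENNReal.ofReal (1 * δ) := by
          rw [← ENNReal.ofReal_add (by positivity) (by positivity), add_halves, one_mul]
      _ ≤ _ := by
          gcongr
          refine le_mul_of_one_le_left' ?_
          rw [← ENNReal.ofReal_one]
          exact ENNReal.ofReal_le_ofReal (by linarith)
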